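/- Let $n\ge 1$, let $B=\{x\in\mathbb R^n:|x|<1\}$ carry the Riemannian metric $g$ with matrix $G(x)=I+\frac{xx^{T}}{1-|x|^2}$ (the Baran metric of the ball), and let $\Delta u=\frac1{\sqrt{\det G}}\sum_i\partial_i\Big(\sqrt{\det G}\,\sum_j (G^{-1})_{ij}\,\partial_j u\Big)$ be its Laplace–Beltrami operator. Functions are real or complex valued. The Riemannian volume is $d\mathrm{Vol}_g=d\mu:=(1-|x|^2)^{-1/2}dx$; write $L^2=L^2(B,\mu)$. Let $L=-\Delta$, with domain the space $C^2_b(B)$ of $C^2$ functions on $B$ that are bounded together with their partial derivatives of order at most $2$ (no boundary condition is imposed). Put $\lambda_s=s(s+n-1)$ for $s=0,1,2,\dots$ For $\alpha\in\mathbb N^n$ let $\phi_\alpha=\tilde\phi_\alpha/\|\tilde\phi_\alpha\|_{L^2}$, where $$\tilde\phi_\alpha(x)=w_n^{\alpha_n/2}\,T_{\alpha_n}\!\Big(\tfrac{x_n}{\sqrt{w_n}}\Big)\prod_{j=1}^{n-1}w_j^{\alpha_j/2}\,C^{\nu_j}_{\alpha_j}\!\Big(\tfrac{x_j}{\sqrt{w_j}}\Big),\qquad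 w_j=1-\sum_{k<j}x_k^2,\quad \nu_j=\tfrac{n-j}2+\sum_{k>j}\alpha_k,$$ $T_m$ is the Chebyshev polynomial of the first kind and $C^\nu_m$ the monic Gegenbauer polynomial, which is orthogonal for the weight $(1-t^2)^{\nu-1/2}$ on $(-1,1)$. For $u\in L^2$ let $\hat u_\alpha=\int_B u\,\phi_\alpha\,d\mu$. Let $H^1(B,g)$ be the closure, in $L^2$, of $\{u\in C^\infty(B):\|u\|_{1,2}<\infty\}$ with respect to the norm $\|u\|_{1,2}=(\int|u|^2d\mathrm{Vol}_g)^{1/2}+(\int|\mathrm{grad}\,u|_g^2\,d\mathrm{Vol}_g)^{1/2}$, that is, the set of $L^2$-limits of sequences of such functions that are Cauchy for $\|\cdot\|_{1,2}$. For an operator $A$ that need not be closed, $\sigma(A)$ is the set of $z$ such that $A-z$ fails to be injective with dense range and bounded inverse on its range; for closed $A$ this is the usual spectrum. A spectrum is called discrete if each of its points is isolated in it and is an eigenvalue of finite multiplicity. Then: 1. $L$ is a well-defined, densely defined, symmetric, unbounded operator in $L^2$. 2. The $\phi_\alpha$ are polynomials of total degree $|\alpha|$, orthonormal in $L^2(\mu)$.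 The spectrum of $L$ is discrete, $\sigma(L)=\{\lambda_s:s\in\mathbb N\}$, this is also the set of eigenvalues of $L$, and the eigenspace of $\lambda_s$ is $\mathrm{span}\{\phi_\alpha:|\alpha|=s\}$. 3. $L$ is closable and its closure $\overline L$ is self-adjoint. It has the same discrete spectrum (every $\overline L-z$ with $z\notin\{\lambda_s\}$ is a bijection of its domain onto $L^2$ with bounded inverse) and the same eigenspaces, and $$\mathcal D(\overline L)=\Big\{u\in L^2:\sum_{s=0}^\infty\lambda_s^2\sum_{|\alpha|=s}|\hat u_\alpha|^2<\infty\Big\}\subset H^1(B,g).$$ 4. $\overline L$ has a unique nonnegative self-adjoint square root $\overline L^{1/2}$, and its domain (the form domain of $\overline L$) is $$\mathcal D(\overline L^{1/2})=\Big\{u\in L^2:\sum_{s=0}^\infty\lambda_s\sum_{|\alpha|=s}|\hat u_\alpha|^2<\infty\Big\}=H^1(B,g).$$ -/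

import Mathlib

open MeasureTheory Filter Topology
open scoped ENNReal ContDiff InnerProductSpace ComplexConjugate

noncomputable section

namespace BaranBall

/-! ### The ball with its Baran metric -/

/-- Euclidean space of dimension `n`. -/
abbrev E (n : ℕ) : Type := EuclideanSpace ℝ (Fin n)

/-- The open unit ball. -/
def ball (n : ℕ) : Set (E n) := Metric.ball 0 1

/-- The matrix of the Baran metric of the ball. -/
def G (n : ℕ) (x : E n) : Matrix (Fin n) (Fin n) ℝ :=
  Matrix.of fun i j => (if i = j then 1 else 0) + x i * x j / (1 - ∑ k, x k ^ 2)

/-- The Riemannian volume of the metric on the ball, with density `√(det G)`, seen as a measure on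
the ambient space that is carried by the ball. -/
def volG (n : ℕ) : Measure (E n) :=
  (volume.restrict (ball n)).withDensity fun x => ENNReal.ofReal (√(G n x).det)

/-- The measure `(1 - |x|²)^(-1/2) dx` on the ball. -/
def muBall (n : ℕ) : Measure (E n) :=
  (volume.restrict (ball n)).withDensity fun x => ENNReal.ofReal (1 / √(1 - ‖x‖ ^ 2))

/-- The space of square integrable functions on the ball for the Riemannian volume. -/
abbrev L2 (𝕜 : Type*) [RCLike 𝕜] (n : ℕ) : Type _ := Lp 𝕜 2 (volG n)

variable {𝕜 : Type*} [RCLike 𝕜] {n : ℕ}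

/-- The partial derivative in the `i`-th coordinate. -/
def pd (i : Fin n) (u : E n → 𝕜) (x : E n) : 𝕜 := fderiv ℝ u x (EuclideanSpace.single i 1)

/-- The covariant gradient, `(grad u)_i = ∑ j, g^{ij} ∂_j u`. -/
def grad (u : E n → 𝕜) (x : E n) (i : Fin n) : 𝕜 := ∑ j, (G n x)⁻¹ i j • pd j u x

/-- The Laplace-Beltrami operator `Δ u = div (grad u)`,
`Δ u = (det G)^(-1/2) ∑ i, ∂_i ((det G)^(1/2) (grad u)_i)`. -/
def laplaceBeltrami (u : E n → 𝕜) (x : E n) : 𝕜 :=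
  (1 / √(G n x).det) • ∑ i, pd i (fun y => √(G n y).det • grad u y i) x

/-- The space of functions that are `C²` on the open ball and bounded there together with all
their partial derivatives of order at most two (values off the ball do not matter). -/
structure IsC2b (u : E n → 𝕜) : Prop where
  contDiffOn : ContDiffOn ℝ 2 u (ball n)
  bdd : ∃ C : ℝ, ∀ x ∈ ball n, ‖u x‖ ≤ C ∧ (∀ i, ‖pd i u x‖ ≤ C) ∧ ∀ i j, ‖pd i (pd j u) x‖ ≤ C

/-! ### The Sobolev space -/

/-- The squared length `⟨grad u, grad u⟩_g` (hermitian for complex valued functions). -/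
def gradNormSq (u : E n → 𝕜) (x : E n) : ℝ :=
  RCLike.re (∑ i, ∑ j, G n x i j • (conj (grad u x i) * grad u x j))

/-- The norm `‖u‖_{1,2} = (∫ |u|² dVol_g)^(1/2) + (∫ |grad u|² dVol_g)^(1/2)`. -/
def h1Norm (u : E n → 𝕜) : ℝ≥0∞ :=
  (∫⁻ x, ‖u x‖ₑ ^ 2 ∂volG n) ^ (1 / 2 : ℝ) +
    (∫⁻ x, ENNReal.ofReal (gradNormSq u x) ∂volG n) ^ (1 / 2 : ℝ)

/-- Smooth functions on the ball with finite `‖u‖_{1,2}`. -/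
def IsSmoothH1 (u : E n → 𝕜) : Prop := ContDiffOn ℝ ∞ u (ball n) ∧ h1Norm u < ⊤

/-- The Sobolev space `H¹`: the closure, inside the square integrable functions, of the smooth
functions with finite norm `‖u‖_{1,2}` with respect to this norm. -/
def MemH1 (u : L2 𝕜 n) : Prop :=
  ∃ w : ℕ → E n → 𝕜, (∀ k, IsSmoothH1 (w k)) ∧
    Tendsto (fun k => eLpNorm (fun x => w k x - u x) 2 (volG n)) atTop (𝓝 0) ∧
    ∀ ε : ℝ≥0∞, 0 < ε → ∃ N, ∀ k ≥ N, ∀ l ≥ N, h1Norm (fun x => w k x - w l x) < ε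

/-! ### The orthogonal polynomials -/

/-- The classical Gegenbauer polynomial
`C_m^s = ∑_{k ≤ m/2} (-1)^k (s)_{m-k} / (k! (m-2k)!) (2X)^{m-2k}`, for `s > 0`. -/
def gegenbauer (s : ℝ) (m : ℕ) : Polynomial ℝ :=
  ∑ k ∈ Finset.range (m / 2 + 1),
    Polynomial.C ((-1) ^ k * (ascPochhammer ℝ (m - k)).eval s /
      ((k.factorial : ℝ) * ((m - 2 * k).factorial : ℝ))) * (2 * Polynomial.X) ^ (m - 2 * k)

/-- The monic Gegenbauer polynomial, for `s > 0`. -/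
def monicGegenbauer (s : ℝ) (m : ℕ) : Polynomial ℝ :=
  Polynomial.C (gegenbauer s m).leadingCoeff⁻¹ * gegenbauer s m

/-- `1 - ∑_{k < j} x_k²`. -/
def headRem (j : Fin n) (x : E n) : ℝ := 1 - ∑ k ∈ Finset.univ.filter (· < j), x k ^ 2

/-- The Gegenbauer parameter; with `j` counted from `0` it is `(n - 1 - j)/2 + ∑_{k > j} α_k`. -/
def gegParam (α : Fin n → ℕ) (j : Fin n) : ℝ :=
  ((n : ℝ) - 1 - (j : ℕ)) / 2 + ∑ k ∈ Finset.univ.filter (j < ·), (α k : ℝ)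

/-- The one-variable polynomial of the `j`-th factor: a Chebyshev polynomial of the first kind for
the last coordinate, a monic Gegenbauer polynomial for the other ones. -/
def factorPoly (α : Fin n → ℕ) (j : Fin n) : Polynomial ℝ :=
  if (j : ℕ) + 1 = n then Polynomial.Chebyshev.T ℝ (α j)
  else monicGegenbauer (gegParam α j) (α j)

/-- The orthogonal polynomials on the ball, before normalization. -/
def phiRaw (α : Fin n → ℕ) (x : E n) : ℝ :=
  ∏ j, √(headRem j x) ^ α j * (factorPoly α j).eval (x j / √(headRem j x))

/-- The orthonormal polynomials on the ball. -/
def phi (α : Fin n → ℕ) (x : E n) : ℝ := phiRaw α x / √(∫ y, phiRaw α y ^ 2 ∂muBall n)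

/-- The Fourier coefficient `∫ u φ_α dμ`. -/
def fourierCoeff (α : Fin n → ℕ) (u : L2 𝕜 n) : 𝕜 := ∫ x, u x * (phi α x : 𝕜) ∂muBall n

/-- The multi-indices of length `s`. -/
def multiIndices (n s : ℕ) : Finset (Fin n → ℕ) := Finset.piAntidiag Finset.univ s

/-- The numbers `s (s + n - 1)`. -/
def lam (n s : ℕ) : ℝ := (s : ℝ) * ((s : ℝ) + (n : ℝ) - 1)

/-! ### Unbounded operators on a Hilbert space -/

section Operators

variable {H : Type*} [NormedAddCommGroup H] [InnerProductSpace 𝕜 H]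

/-- The eigenspace `{f ∈ D(A) : A f = z f}`. -/
def eigenspace (A : H →ₗ.[𝕜] H) (z : 𝕜) : Submodule 𝕜 H :=
  A.graph.comap (LinearMap.id.prod (z • LinearMap.id))

/-- The spectrum of a closed operator: `z` is not in it iff `A - z : D(A) → H` is a bijection with
a bounded inverse `R`. -/
def closedSpectrum (A : H →ₗ.[𝕜] H) : Set 𝕜 :=
  {z | ¬ ∃ R : H →L[𝕜] H, (∀ f : A.domain, R (A f - z • (f : H)) = f) ∧
    ∀ h : H, ∃ f : A.domain, (f : H) = R h ∧ A f - z • (f : H) = h}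

/-- The spectrum of an operator that need not be closed: `z` is not in it iff `A - z` is injective
with dense range, and its inverse, defined on the range, is bounded. -/
def opSpectrum (A : H →ₗ.[𝕜] H) : Set 𝕜 :=
  {z | ¬ ((∃ c : ℝ, 0 < c ∧ ∀ f : A.domain, c * ‖(f : H)‖ ≤ ‖A f - z • (f : H)‖) ∧
    DenseRange fun f : A.domain => A f - z • (f : H))}

/-- The set `σ`, the spectrum of `A`, is discrete: its points are isolated in it and are eigenvalues
of finite multiplicity. -/
def IsDiscreteSpectrum (A : H →ₗ.[𝕜] H) (σ : Set 𝕜) : Prop :=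
  ∀ z ∈ σ, (∃ ε : ℝ, 0 < ε ∧ ∀ w ∈ σ, ‖w - z‖ < ε → w = z) ∧
    eigenspace A z ≠ ⊥ ∧ FiniteDimensional 𝕜 (eigenspace A z)

/-- `S` is a nonnegative self-adjoint square root of `A`: the domain of `A` consists of the `f`
in `D(S)` with `S f` in `D(S)`, and `A f = S (S f)` there. -/
def IsPosSqrt [CompleteSpace H] (S A : H →ₗ.[𝕜] H) : Prop :=
  IsSelfAdjoint S ∧ (∀ f : S.domain, 0 ≤ RCLike.re ⟪S f, (f : H)⟫_𝕜) ∧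
    ∀ f h : H, (f, h) ∈ A.graph ↔ ∃ g, (f, g) ∈ S.graph ∧ (g, h) ∈ S.graph

end Operators

/-! ### The Laplace-Beltrami operator as an unbounded operator -/

lemma isOpen_ball : IsOpen (ball n) := Metric.isOpen_ball

lemma sum_sq_lt {x : E n} (hx : x ∈ ball n) : 0 < 1 - ∑ k, x k ^ 2 := by
  have h : ‖x‖ < 1 := by simpa [ball] using hx
  have h2 : ‖x‖ ^ 2 = ∑ k, x k ^ 2 := by
    rw [EuclideanSpace.norm_sq_eq]; simp
  nlinarith [norm_nonneg x]

lemma G_mul (x : E n) (hx : x ∈ ball n) :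
    G n x * (1 - Matrix.vecMulVec x x : Matrix (Fin n) (Fin n) ℝ) = 1 := by
  have h := (sum_sq_lt hx).ne'
  have e : G n x = 1 + (1 - ∑ k, x k ^ 2)⁻¹ • Matrix.vecMulVec x x := by
    ext i j
    simp [G, Matrix.one_apply, Matrix.vecMulVec_apply]
    ring
  have hv : (Matrix.vecMulVec x x * Matrix.vecMulVec x x : Matrix (Fin n) (Fin n) ℝ)
      = (∑ k, x k ^ 2) • Matrix.vecMulVec x x := by
    ext i j
    simp only [Matrix.mul_apply, Matrix.vecMulVec_apply, Matrix.smul_apply, smul_eq_mul,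
      Finset.sum_mul]
    exact Finset.sum_congr rfl fun k _ => by ring
  rw [e, Matrix.mul_sub, Matrix.mul_one, Matrix.add_mul, Matrix.one_mul, Matrix.smul_mul, hv]
  ext i j
  simp only [Matrix.sub_apply, Matrix.add_apply, Matrix.smul_apply, smul_eq_mul]
  field_simp
  ring

lemma G_inv (x : E n) (hx : x ∈ ball n) :
    (G n x)⁻¹ = (1 - Matrix.vecMulVec x x : Matrix (Fin n) (Fin n) ℝ) :=
  Matrix.inv_eq_right_inv (G_mul x hx)

lemma det_G_ne (x : E n) (hx : x ∈ ball n) : (G n x).det ≠ 0 := by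
  intro h
  have := congrArg Matrix.det (G_mul x hx)
  simp [h] at this

lemma diff_G (x : E n) (hx : x ∈ ball n) (i j : Fin n) :
    DifferentiableAt ℝ (fun y => G n y i j) x := by
  have h := (sum_sq_lt hx).ne'
  simp only [G, Matrix.of_apply]
  fun_prop (disch := assumption)

lemma diff_sqrt_det (x : E n) (hx : x ∈ ball n) :
    DifferentiableAt ℝ (fun y => √(G n y).det) x := by
  refine DifferentiableAt.sqrt ?_ (det_G_ne x hx)
  simp only [Matrix.det_apply]
  refine DifferentiableAt.fun_sum fun σ _ => DifferentiableAt.const_smul ?_ _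
  classical
  exact (HasFDerivAt.finsetProd (u := Finset.univ) (g := fun i y => G n y (σ i) i)
    fun i _ => (diff_G x hx (σ i) i).hasFDerivAt).differentiableAt

lemma diff_inv (x : E n) (hx : x ∈ ball n) (i j : Fin n) :
    DifferentiableAt ℝ (fun y => (G n y)⁻¹ i j) x := by
  have h : (fun y => (G n y)⁻¹ i j) =ᶠ[𝓝 x]
      fun y => (1 : Matrix (Fin n) (Fin n) ℝ) i j - y i * y j := by
    filter_upwards [isOpen_ball.mem_nhds hx] with y hy
    rw [G_inv y hy]; simp [Matrix.vecMulVec_apply]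
  refine DifferentiableAt.congr_of_eventuallyEq ?_ h
  fun_prop

lemma IsC2b.diff {u : E n → 𝕜} (hu : IsC2b u) {x : E n} (hx : x ∈ ball n) :
    DifferentiableAt ℝ u x :=
  (hu.contDiffOn.contDiffAt (isOpen_ball.mem_nhds hx)).differentiableAt (by norm_num)

lemma IsC2b.diff_pd {u : E n → 𝕜} (hu : IsC2b u) {x : E n} (hx : x ∈ ball n) (i : Fin n) :
    DifferentiableAt ℝ (pd i u) x := by
  have h : ContDiffAt ℝ 1 (fderiv ℝ u) x :=
    (hu.contDiffOn.contDiffAt (isOpen_ball.mem_nhds hx)).fderiv_right (by norm_num)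
  exact (h.differentiableAt (by norm_num)).clm_apply (differentiableAt_const _)

lemma pd_congr {u v : E n → 𝕜} (h : ∀ y ∈ ball n, u y = v y) {x : E n} (hx : x ∈ ball n)
    (i : Fin n) : pd i u x = pd i v x := by
  have : u =ᶠ[𝓝 x] v := by
    filter_upwards [isOpen_ball.mem_nhds hx] with y hy using h y hy
  simp only [pd, this.fderiv_eq]

lemma pd_add {u v : E n → 𝕜} {x : E n} (hu : DifferentiableAt ℝ u x)
    (hv : DifferentiableAt ℝ v x) (i : Fin n) :
    pd i (fun y => u y + v y) x = pd i u x + pd i v x := by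
  simp [pd, fderiv_fun_add hu hv]

lemma pd_mul {u : E n → 𝕜} {x : E n} (hu : DifferentiableAt ℝ u x) (c : 𝕜) (i : Fin n) :
    pd i (fun y => c * u y) x = c * pd i u x := by
  simp [pd, fderiv_const_mul hu c]

lemma IsC2b.diff_flux {u : E n → 𝕜} (hu : IsC2b u) {x : E n} (hx : x ∈ ball n) (i : Fin n) :
    DifferentiableAt ℝ (fun y => √(G n y).det • grad u y i) x := by
  refine (diff_sqrt_det x hx).smul ?_
  exact DifferentiableAt.fun_sum fun j _ => (diff_inv x hx i j).smul (hu.diff_pd hx j)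

lemma laplaceBeltrami_add {u v : E n → 𝕜} (hu : IsC2b u) (hv : IsC2b v) {x : E n}
    (hx : x ∈ ball n) : laplaceBeltrami (fun y => u y + v y) x =
      laplaceBeltrami u x + laplaceBeltrami v x := by
  simp only [laplaceBeltrami, ← smul_add, ← Finset.sum_add_distrib]
  congr 1
  refine Finset.sum_congr rfl fun i _ => ?_
  rw [← pd_add (hu.diff_flux hx i) (hv.diff_flux hx i)]
  refine pd_congr (fun y hy => ?_) hx i
  rw [← smul_add]
  congr 1
  simp only [grad, ← Finset.sum_add_distrib, ← smul_add]
  exact Finset.sum_congr rfl fun j _ => by rw [pd_add (hu.diff hy) (hv.diff hy)]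

lemma laplaceBeltrami_mul {u : E n → 𝕜} (hu : IsC2b u) (c : 𝕜) {x : E n} (hx : x ∈ ball n) :
    laplaceBeltrami (fun y => c * u y) x = c * laplaceBeltrami u x := by
  simp only [laplaceBeltrami, mul_smul_comm, Finset.mul_sum]
  congr 1
  refine Finset.sum_congr rfl fun i _ => ?_
  rw [← pd_mul (hu.diff_flux hx i)]
  refine pd_congr (fun y hy => ?_) hx i
  rw [mul_smul_comm]
  congr 1
  simp only [grad, Finset.mul_sum, mul_smul_comm]
  exact Finset.sum_congr rfl fun j _ => by rw [pd_mul (hu.diff hy)]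

lemma IsC2b.add {u v : E n → 𝕜} (hu : IsC2b u) (hv : IsC2b v) : IsC2b fun y => u y + v y := by
  refine ⟨hu.contDiffOn.add hv.contDiffOn, ?_⟩
  obtain ⟨C, hC⟩ := hu.bdd
  obtain ⟨D, hD⟩ := hv.bdd
  refine ⟨C + D, fun x hx => ⟨?_, fun i => ?_, fun i j => ?_⟩⟩
  · exact norm_add_le_of_le (hC x hx).1 (hD x hx).1
  · rw [pd_add (hu.diff hx) (hv.diff hx)]
    exact norm_add_le_of_le ((hC x hx).2.1 i) ((hD x hx).2.1 i)
  · rw [pd_congr (fun y hy => pd_add (hu.diff hy) (hv.diff hy) j) hx i,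
      pd_add (hu.diff_pd hx j) (hv.diff_pd hx j)]
    exact norm_add_le_of_le ((hC x hx).2.2 i j) ((hD x hx).2.2 i j)

lemma IsC2b.mul {u : E n → 𝕜} (hu : IsC2b u) (c : 𝕜) : IsC2b fun y => c * u y := by
  refine ⟨contDiffOn_const.mul hu.contDiffOn, ?_⟩
  obtain ⟨C, hC⟩ := hu.bdd
  refine ⟨‖c‖ * C, fun x hx => ⟨?_, fun i => ?_, fun i j => ?_⟩⟩
  · rw [norm_mul]; exact mul_le_mul_of_nonneg_left (hC x hx).1 (norm_nonneg c)
  · rw [pd_mul (hu.diff hx), norm_mul]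
    exact mul_le_mul_of_nonneg_left ((hC x hx).2.1 i) (norm_nonneg c)
  · rw [pd_congr (fun y hy => pd_mul (hu.diff hy) c j) hx i, pd_mul (hu.diff_pd hx j), norm_mul]
    exact mul_le_mul_of_nonneg_left ((hC x hx).2.2 i j) (norm_nonneg c)

lemma isC2b_zero : IsC2b (fun _ : E n => (0 : 𝕜)) := by
  have h : ∀ i : Fin n, pd i (fun _ : E n => (0 : 𝕜)) = fun _ => 0 := fun i => by
    funext x; simp [pd]
  exact ⟨contDiffOn_const, 0, fun x _ => by simp [h]⟩

lemma ae_mem_ball : ∀ᵐ x ∂volG n, x ∈ ball n :=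
  (withDensity_absolutelyContinuous _ _).ae_le (ae_restrict_mem isOpen_ball.measurableSet)

variable (𝕜 n)

/-- The pairs of classes `([u], [-Δ u])` with `u` a bounded `C²` function in the sense above: the
graph of `-Δ` acting on this space of functions. -/
def negLaplaceGraph : Submodule 𝕜 (L2 𝕜 n × L2 𝕜 n) where
  carrier := {p | ∃ u : E n → 𝕜, IsC2b u ∧ p.1 =ᵐ[volG n] u ∧
    p.2 =ᵐ[volG n] fun x => -laplaceBeltrami u x}
  zero_mem' := by
    refine ⟨fun _ => 0, isC2b_zero, Lp.coeFn_zero _ _ _, ?_⟩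
    have h : laplaceBeltrami (fun _ : E n => (0 : 𝕜)) = fun _ => 0 := by
      funext x; simp [laplaceBeltrami, grad, pd]
    rw [h]
    filter_upwards [Lp.coeFn_zero 𝕜 2 (volG n)] with x hx
    simpa using hx
  add_mem' := by
    rintro ⟨f, f'⟩ ⟨g, g'⟩ ⟨u, hu, hf, hf'⟩ ⟨v, hv, hg, hg'⟩
    refine ⟨_, hu.add hv, ?_, ?_⟩
    · filter_upwards [hf, hg, Lp.coeFn_add f g] with x h1 h2 h3
      simp only [Prod.mk_add_mk, h3, Pi.add_apply, ← h1, ← h2]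
    · filter_upwards [hf', hg', Lp.coeFn_add f' g', ae_mem_ball] with x h1 h2 h3 hx
      simp only [Prod.mk_add_mk, h3, Pi.add_apply, laplaceBeltrami_add hu hv hx, neg_add]
      simp only [← h1, ← h2]
  smul_mem' := by
    rintro c ⟨f, f'⟩ ⟨u, hu, hf, hf'⟩
    refine ⟨_, hu.mul c, ?_, ?_⟩
    · filter_upwards [hf, Lp.coeFn_smul c f] with x h1 h2
      simp only [Prod.smul_mk, h2, Pi.smul_apply, smul_eq_mul, ← h1]
    · filter_upwards [hf', Lp.coeFn_smul c f', ae_mem_ball] with x h1 h2 hx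
      simp only [Prod.smul_mk, h2, Pi.smul_apply, smul_eq_mul, laplaceBeltrami_mul hu c hx,
        ← mul_neg]
      simp only [← h1]

/-- The operator `-Δ` with domain the bounded `C²` functions, as an unbounded operator. -/
def negLaplace : L2 𝕜 n →ₗ.[𝕜] L2 𝕜 n := (negLaplaceGraph 𝕜 n).toLinearPMap

end BaranBall

end

noncomputable section

namespace BaranBall

/-! ### Diagonal operators in a Hilbert basis -/

section Diagonal

variable {𝕜 : Type*} [RCLike 𝕜] {H : Type*} [NormedAddCommGroup H] [InnerProductSpace 𝕜 H]
  {ι : Type*}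

/-! The operator L is symmetric, and its domain contains a complete orthonormal system of
eigenvectors. These two facts decide everything. Testing against the eigenvectors puts the graph of
L inside the graph of the diagonal operator with the same eigenvalues on its maximal domain; finite
Fourier sums show that this diagonal operator is the closure (`closure_eq_diagOp`). Spectrum,
self-adjointness, resolvent and square root are then read off coordinate by coordinate, using that
the eigenvalues are natural numbers tending to infinity with finite multiplicity.

Symmetry needs no boundary condition: the radial component of √(det G) grad u is √(1-|x|²) times the
radial derivative of u (`sum_mul_flux`), so for bounded derivatives it dies at the sphere. A cutoff
argument turns this into Green's formula (`integral_mul_laplaceBeltrami`).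

For the eigenvectors, the singular terms of Δ cancel and leave an operator with polynomial
coefficients. It does not raise degrees, and by Euler's identity it multiplies the leading part of a
polynomial of degree s by -λ_s (`totalDegree_lapPoly_add`). The φ_α are orthogonal by induction on
the dimension: slicing the ball along the first coordinate factors the measure (`muBall_succ`) and
φ_α (`phiRaw_slice`), and the one-variable factors are orthogonal by their Sturm-Liouville equation.
By a dimension count the φ_α with |α| ≤ s span all polynomials of degree at most s. Therefore Δφ_α +
λφ_α, of degree below |α| and by symmetry orthogonal to all such polynomials, vanishes
(`eval_lapPoly_phiPoly`). Completeness is Stone-Weierstrass (`dense_span_polyL2`).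

The form domain is H¹ because the Dirichlet integral is the sum of λ|û_α|²: with equality for
bounded C² functions (`IsC2b.hasSum_eigval_mul`), and as a Bessel inequality for C¹ functions in L²
of finite energy (`sum_eigval_mul_le`). The inequality survives H¹ limits; conversely, Fourier
partial sums are polynomials that are Cauchy in the H¹ norm (`memH1_iff`). -/

lemma hasSum_norm_sq_repr (b : HilbertBasis ι 𝕜 H) (f : H) :
    HasSum (fun i => ‖b.repr f i‖ ^ 2) (‖f‖ ^ 2) := by
  have h := b.hasSum_inner_mul_inner f f
  rw [inner_self_eq_norm_sq_to_K] at h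
  have h2 : HasSum (fun i => ((‖b.repr f i‖ ^ 2 : ℝ) : 𝕜)) ((‖f‖ ^ 2 : ℝ) : 𝕜) := by
    convert! h using 1
    · funext i
      rw [b.repr_apply_apply, ← inner_conj_symm f (b i), RCLike.conj_mul]
      push_cast; rfl
    · push_cast; rfl
  exact_mod_cast RCLike.hasSum_ofReal 𝕜 |>.mp h2

lemma exists_repr_eq (b : HilbertBasis ι 𝕜 H) {a : ι → 𝕜} (ha : Summable fun i => ‖a i‖ ^ 2) :
    ∃ g : H, ∀ i, b.repr g i = a i := by
  have : Memℓp a 2 := by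
    rw [memℓp_gen_iff (by norm_num)]
    simpa using ha
  exact ⟨b.repr.symm ⟨a, this⟩, fun i => by simp⟩

lemma repr_ext (b : HilbertBasis ι 𝕜 H) {f g : H} (h : ∀ i, b.repr f i = b.repr g i) : f = g :=
  b.repr.injective (lp.ext (funext h))

lemma mul_norm_le_of_repr (b : HilbertBasis ι 𝕜 H) {f g : H} {c : ℝ} (hc : 0 ≤ c)
    (h : ∀ i, c * ‖b.repr f i‖ ≤ ‖b.repr g i‖) : c * ‖f‖ ≤ ‖g‖ := by
  refine le_of_sq_le_sq ?_ (norm_nonneg g)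
  rw [mul_pow]
  refine hasSum_le (fun i => ?_) ((hasSum_norm_sq_repr b f).mul_left (c ^ 2))
    (hasSum_norm_sq_repr b g)
  rw [← mul_pow]
  exact pow_le_pow_left₀ (by positivity) (h i) 2

/-- The graph of the diagonal operator with entries `μ`. -/
def diagGraph (b : HilbertBasis ι 𝕜 H) (μ : ι → ℝ) : Submodule 𝕜 (H × H) where
  carrier := {p | ∀ i, b.repr p.2 i = (μ i : 𝕜) * b.repr p.1 i}
  zero_mem' := fun i => by simp
  add_mem' := fun {p q} hp hq i => by simp [hp i, hq i, mul_add]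
  smul_mem' := fun c p hp i => by simp [hp i, mul_left_comm]

/-- The diagonal operator with entries `μ` in the Hilbert basis `b`, on its maximal domain. -/
def diagOp (b : HilbertBasis ι 𝕜 H) (μ : ι → ℝ) : H →ₗ.[𝕜] H := (diagGraph b μ).toLinearPMap

variable (b : HilbertBasis ι 𝕜 H) (μ : ι → ℝ)

lemma mem_diagGraph {p : H × H} :
    p ∈ diagGraph b μ ↔ ∀ i, b.repr p.2 i = (μ i : 𝕜) * b.repr p.1 i := Iff.rfl

lemma diagOp_graph : (diagOp b μ).graph = diagGraph b μ := by
  refine Submodule.toLinearPMap_graph_eq _ fun p hp h0 => ?_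
  refine repr_ext b fun i => ?_
  rw [hp i, h0]; simp

lemma basis_mem_diagGraph (i : ι) : (b i, (μ i : 𝕜) • b i) ∈ diagGraph b μ := by
  intro j
  classical
  simp only [map_smul, lp.coeFn_smul, Pi.smul_apply, smul_eq_mul, b.repr_self, lp.single_apply,
    Pi.single_apply]
  split_ifs with h <;> simp [h]

lemma diagGraph_inner {p q : H × H} (hp : p ∈ diagGraph b μ) (hq : q ∈ diagGraph b μ) :
    ⟪p.2, q.1⟫_𝕜 = ⟪p.1, q.2⟫_𝕜 := by
  rw [← b.repr.inner_map_map, ← b.repr.inner_map_map, lp.inner_eq_tsum, lp.inner_eq_tsum]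
  refine tsum_congr fun i => ?_
  rw [hp i, hq i]
  simp only [RCLike.inner_apply, map_mul, RCLike.conj_ofReal]
  ring

/-- Membership is only a family of scalar conditions, one per basis vector. Hence any operator that
is symmetric against the eigenvectors is contained in the diagonal one. -/
lemma mem_diagGraph_of_inner {p : H × H}
    (h : ∀ i, ⟪(μ i : 𝕜) • b i, p.1⟫_𝕜 = ⟪b i, p.2⟫_𝕜) : p ∈ diagGraph b μ := by
  intro i
  rw [b.repr_apply_apply, b.repr_apply_apply, ← h i, inner_smul_left, RCLike.conj_ofReal]

lemma isClosed_diagGraph : IsClosed (diagGraph b μ : Set (H × H)) := by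
  have : (diagGraph b μ : Set (H × H)) =
      ⋂ i, {p : H × H | ⟪b i, p.2⟫_𝕜 = (μ i : 𝕜) * ⟪b i, p.1⟫_𝕜} := by
    ext p
    simp [mem_diagGraph, b.repr_apply_apply]
  rw [this]
  refine isClosed_iInter fun i => isClosed_eq ?_ ?_ <;> fun_prop

lemma mem_diagOp_domain {f : H} :
    f ∈ (diagOp b μ).domain ↔ Summable fun i => μ i ^ 2 * ‖b.repr f i‖ ^ 2 := by
  rw [LinearPMap.mem_domain_iff]
  simp only [diagOp_graph, mem_diagGraph]
  constructor
  · rintro ⟨h, hh⟩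
    refine (hasSum_norm_sq_repr b h).summable.congr fun i => ?_
    rw [hh i, norm_mul, mul_pow, RCLike.norm_ofReal, sq_abs]
  · intro hs
    refine exists_repr_eq b (hs.congr fun i => ?_)
    rw [norm_mul, mul_pow, RCLike.norm_ofReal, sq_abs]

/-! ### Operators between the finite span of an eigenbasis and the maximal diagonal operator -/

section Core

variable {b μ} {A : H →ₗ.[𝕜] H}

lemma dense_domain_of_basis_mem (hb : ∀ i, (b i, (μ i : 𝕜) • b i) ∈ A.graph) :
    Dense (A.domain : Set H) := by
  have h := b.dense_span
  rw [← Submodule.dense_iff_topologicalClosure_eq_top] at h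
  refine h.mono ?_
  rw [SetLike.coe_subset_coe, Submodule.span_le]
  rintro _ ⟨i, rfl⟩
  exact LinearPMap.mem_domain_of_mem_graph (hb i)

/-- The Fourier expansions of `p.1` and `p.2` converge along the same finite sets, and the
coefficients of the second are those of the first times `μ`. So the pair is a limit of linear
combinations of the pairs (b i, μ i b i), which lie in the graph of `A`. -/
lemma diagGraph_le_closure (hb : ∀ i, (b i, (μ i : 𝕜) • b i) ∈ A.graph) :
    diagGraph b μ ≤ A.graph.topologicalClosure := by
  intro p hp
  have h1 := b.hasSum_repr p.1
  have h2 := b.hasSum_repr p.2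
  have h3 : HasSum (fun i => b.repr p.1 i • (b i, (μ i : 𝕜) • b i)) p := by
    refine (h1.prodMk h2).congr_fun ?_
    intro i
    ext <;> simp [hp i, smul_smul, mul_comm]
  refine mem_closure_of_tendsto h3 (Eventually.of_forall fun s => ?_)
  exact Submodule.sum_mem _ fun i _ => Submodule.smul_mem _ _ (hb i)

lemma isClosable_of_le_diagGraph (hA : A.graph ≤ diagGraph b μ) : A.IsClosable := by
  have : A ≤ diagOp b μ := LinearPMap.le_of_le_graph (by rwa [diagOp_graph])
  refine LinearPMap.IsClosable.leIsClosable (LinearPMap.IsClosed.isClosable ?_) this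
  rw [LinearPMap.IsClosed, diagOp_graph]
  exact isClosed_diagGraph b μ

/-- The sandwich on which all statements about the closure rest: the upper bound is closed, and the
lower bound is dense in it. -/
lemma closure_eq_diagOp (hA : A.graph ≤ diagGraph b μ)
    (hb : ∀ i, (b i, (μ i : 𝕜) • b i) ∈ A.graph) : A.closure = diagOp b μ := by
  refine LinearPMap.eq_of_eq_graph ?_
  rw [← (isClosable_of_le_diagGraph hA).graph_closure_eq_closure_graph, diagOp_graph]
  exact le_antisymm (Submodule.topologicalClosure_minimal _ hA (isClosed_diagGraph b μ))
    (diagGraph_le_closure hb)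

lemma mem_eigenspace {z : 𝕜} {f : H} : f ∈ eigenspace A z ↔ (f, z • f) ∈ A.graph := Iff.rfl

lemma repr_eq_zero_of_mem_eigenspace (hA : A.graph ≤ diagGraph b μ) {z : 𝕜} {f : H}
    (hf : f ∈ eigenspace A z) {i : ι} (hi : z ≠ (μ i : 𝕜)) : b.repr f i = 0 := by
  have h := hA (mem_eigenspace.1 hf) i
  simp only [map_smul, lp.coeFn_smul, Pi.smul_apply, smul_eq_mul] at h
  rcases mul_eq_mul_right_iff.1 h with h | h
  · exact absurd h hi
  · exact h

lemma eigenspace_eq_bot (hA : A.graph ≤ diagGraph b μ) {z : 𝕜} (hz : ∀ i, z ≠ (μ i : 𝕜)) :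
    eigenspace A z = ⊥ := by
  rw [eq_bot_iff]
  intro f hf
  rw [Submodule.mem_bot]
  exact repr_ext b fun i => by simp [repr_eq_zero_of_mem_eigenspace hA hf (hz i)]

lemma basis_mem_eigenspace (hb : ∀ i, (b i, (μ i : 𝕜) • b i) ∈ A.graph) (i : ι) :
    b i ∈ eigenspace A (μ i : 𝕜) := hb i

lemma basis_ne_zero (b : HilbertBasis ι 𝕜 H) (i : ι) : b i ≠ 0 := b.orthonormal.ne_zero i

/-- Comparing coefficients kills every coordinate outside `F`, so the expansion of an eigenvector is
a finite sum and no closure of the span is needed. -/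
lemma eigenspace_eq_span (hA : A.graph ≤ diagGraph b μ)
    (hb : ∀ i, (b i, (μ i : 𝕜) • b i) ∈ A.graph) {c : ℝ} {F : Finset ι}
    (hF : ∀ i, i ∈ F ↔ μ i = c) :
    eigenspace A (c : 𝕜) = Submodule.span 𝕜 (b '' (F : Set ι)) := by
  apply le_antisymm
  · intro f hf
    have h1 := b.hasSum_repr f
    have h2 : HasSum (fun i => b.repr f i • b i) (∑ i ∈ F, b.repr f i • b i) := by
      refine hasSum_sum_of_ne_finset_zero fun i hi => ?_
      rw [repr_eq_zero_of_mem_eigenspace hA hf, zero_smul]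
      rw [hF] at hi
      exact fun h => hi (by exact_mod_cast h.symm)
    rw [h1.unique h2]
    exact Submodule.sum_mem _ fun i hi => Submodule.smul_mem _ _
      (Submodule.subset_span ⟨i, hi, rfl⟩)
  · rw [Submodule.span_le]
    rintro _ ⟨i, hi, rfl⟩
    rw [← (hF i).1 hi]
    exact basis_mem_eigenspace hb i

lemma setOf_eigenspace_ne_bot (hA : A.graph ≤ diagGraph b μ)
    (hb : ∀ i, (b i, (μ i : 𝕜) • b i) ∈ A.graph) :
    {z : 𝕜 | eigenspace A z ≠ ⊥} = {z : 𝕜 | ∃ i, z = (μ i : 𝕜)} := by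
  ext z
  constructor
  · intro h
    by_contra h'
    exact h (eigenspace_eq_bot hA fun i hi => h' ⟨i, hi⟩)
  · rintro ⟨i, rfl⟩ h
    have := basis_mem_eigenspace hb i
    rw [h, Submodule.mem_bot] at this
    exact basis_ne_zero b i this

lemma repr_sub_smul (hA : A.graph ≤ diagGraph b μ) (z : 𝕜) (f : A.domain) (i : ι) :
    b.repr (A f - z • (f : H)) i = ((μ i : 𝕜) - z) * b.repr (f : H) i := by
  have h := hA (A.mem_graph f) i
  simp only at h
  simp only [map_sub, map_smul, lp.coeFn_sub, lp.coeFn_smul, Pi.sub_apply, Pi.smul_apply,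
    smul_eq_mul, h, sub_mul]

lemma opSpectrum_eq (hA : A.graph ≤ diagGraph b μ)
    (hb : ∀ i, (b i, (μ i : 𝕜) • b i) ∈ A.graph)
    (hgap : ∀ z : 𝕜, (∀ i, z ≠ (μ i : 𝕜)) → ∃ c : ℝ, 0 < c ∧ ∀ i, c ≤ ‖(μ i : 𝕜) - z‖) :
    opSpectrum A = {z : 𝕜 | ∃ i, z = (μ i : 𝕜)} := by
  ext z
  constructor
  · intro h
    by_contra h'
    have hz : ∀ i, z ≠ (μ i : 𝕜) := fun i hi => h' ⟨i, hi⟩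
    obtain ⟨c, hc, hcz⟩ := hgap z hz
    refine h ⟨⟨c, hc, fun f => mul_norm_le_of_repr b hc.le fun i => ?_⟩, ?_⟩
    · rw [repr_sub_smul hA, norm_mul]
      exact mul_le_mul_of_nonneg_right (hcz i) (norm_nonneg _)
    -- `A - z` multiplies b i by the nonzero number μ i - z, so its range contains every b i and
    -- hence their dense span.
    · have hd := b.dense_span
      rw [← Submodule.dense_iff_topologicalClosure_eq_top] at hd
      have : (Submodule.span 𝕜 (Set.range b) : Set H) ⊆
          LinearMap.range (A.toFun - z • A.domain.subtype) := by
        rw [SetLike.coe_subset_coe, Submodule.span_le]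
        rintro _ ⟨i, rfl⟩
        obtain ⟨f, hf1, hf2⟩ := (LinearPMap.mem_graph_iff _).1 (hb i)
        refine ⟨((μ i : 𝕜) - z)⁻¹ • f, ?_⟩
        have hne : (μ i : 𝕜) - z ≠ 0 := sub_ne_zero.2 (hz i).symm
        have : (A.toFun - z • A.domain.subtype) f = ((μ i : 𝕜) - z) • b i := by
          simp only [LinearMap.sub_apply, LinearMap.smul_apply, Submodule.subtype_apply, sub_smul]
          have h1 : (f : H) = b i := hf1
          have h2 : A.toFun f = (μ i : 𝕜) • b i := hf2
          rw [h1, h2]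
        rw [map_smul, this, smul_smul, inv_mul_cancel₀ hne, one_smul]
      exact hd.mono this
  -- The unit vector b i is annihilated by `A - μ i`, which contradicts the lower bound with `c >
  -- 0`.
  · rintro ⟨i, rfl⟩ ⟨⟨c, hc, h⟩, -⟩
    obtain ⟨f, hf1, hf2⟩ := (LinearPMap.mem_graph_iff _).1 (hb i)
    have := h f
    simp only at hf1 hf2
    rw [hf2, hf1, sub_self, norm_zero, b.orthonormal.1 i] at this
    linarith

lemma isDiscreteSpectrum_of_diag (hA : A.graph ≤ diagGraph b μ)
    (hb : ∀ i, (b i, (μ i : 𝕜) • b i) ∈ A.graph)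
    (hfin : ∀ c : ℝ, {i | μ i = c}.Finite)
    (hsep : ∀ i j, |μ j - μ i| < 1 → μ j = μ i) :
    IsDiscreteSpectrum A {z : 𝕜 | ∃ i, z = (μ i : 𝕜)} := by
  rintro z ⟨i, rfl⟩
  refine ⟨⟨1, one_pos, ?_⟩, ?_, ?_⟩
  · rintro w ⟨j, rfl⟩ h
    rw [← RCLike.ofReal_sub, RCLike.norm_ofReal] at h
    rw [hsep i j h]
  · have : (μ i : 𝕜) ∈ {z : 𝕜 | eigenspace A z ≠ ⊥} := by
      rw [setOf_eigenspace_ne_bot hA hb]; exact ⟨i, rfl⟩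
    exact this
  · rw [eigenspace_eq_span hA hb (F := (hfin (μ i)).toFinset) (by simp)]
    exact FiniteDimensional.span_of_finite 𝕜 ((Finset.finite_toSet _).image _)

end Core

/-! ### The maximal diagonal operator: self-adjointness, resolvent, square root -/

section DiagOp

variable {b μ}

lemma dense_diagOp_domain : Dense ((diagOp b μ).domain : Set H) :=
  dense_domain_of_basis_mem (b := b) (μ := μ) fun i => by
    rw [diagOp_graph]; exact basis_mem_diagGraph b μ i

/-- An element of the adjoint graph need only be tested against the basis pairs, and that test is
already membership in the diagonal graph; the converse is symmetry. -/
lemma isSelfAdjoint_diagOp [CompleteSpace H] : IsSelfAdjoint (diagOp b μ) := by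
  rw [LinearPMap.isSelfAdjoint_def]
  refine LinearPMap.eq_of_eq_graph ?_
  rw [LinearPMap.adjoint_graph_eq_graph_adjoint dense_diagOp_domain, diagOp_graph]
  ext p
  rw [Submodule.mem_adjoint_iff]
  constructor
  · intro h
    refine mem_diagGraph_of_inner b μ fun i => ?_
    exact sub_eq_zero.1 (h _ _ (basis_mem_diagGraph b μ i))
  · intro hp x y hxy
    exact sub_eq_zero.2 (diagGraph_inner b μ hxy hp)

/-- Off the eigenvalues the resolvent is the diagonal operator with entries (μ i - z)⁻¹, bounded by
c⁻¹ where c is the distance provided by `hgap`. At an eigenvalue, injectivity fails on b i. -/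
lemma closedSpectrum_diagOp
    (hgap : ∀ z : 𝕜, (∀ i, z ≠ (μ i : 𝕜)) → ∃ c : ℝ, 0 < c ∧ ∀ i, c ≤ ‖(μ i : 𝕜) - z‖) :
    closedSpectrum (diagOp b μ) = {z : 𝕜 | ∃ i, z = (μ i : 𝕜)} := by
  ext z
  constructor
  · intro h
    by_contra h'
    have hz : ∀ i, z ≠ (μ i : 𝕜) := fun i hi => h' ⟨i, hi⟩
    have hz' : ∀ i, (μ i : 𝕜) - z ≠ 0 := fun i => sub_ne_zero.2 (hz i).symm
    obtain ⟨c, hc, hcz⟩ := hgap z hz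
    have hbd : ∀ h : H, ∀ i, ‖((μ i : 𝕜) - z)⁻¹ * b.repr h i‖ ≤ ‖(c⁻¹ : ℝ)‖ * ‖b.repr h i‖ := by
      intro h i
      rw [norm_mul, norm_inv, norm_inv, Real.norm_of_nonneg hc.le]
      gcongr
      exact hcz i
    have hex : ∀ h : H, ∃ g : H, ∀ i, b.repr g i = ((μ i : 𝕜) - z)⁻¹ * b.repr h i := by
      intro h
      refine exists_repr_eq b (Summable.of_nonneg_of_le (fun i => by positivity) (fun i => ?_)
        ((hasSum_norm_sq_repr b h).summable.mul_left (‖(c⁻¹ : ℝ)‖ ^ 2)))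
      rw [← mul_pow]
      exact pow_le_pow_left₀ (norm_nonneg _) (hbd h i) 2
    choose R hR using hex
    let R' : H →L[𝕜] H := LinearMap.mkContinuous
      { toFun := R
        map_add' := fun x y => repr_ext b fun i => by simp [hR, mul_add]
        map_smul' := fun a x => repr_ext b fun i => by simp [hR, mul_left_comm] } c⁻¹
      (fun h => by
        have := mul_norm_le_of_repr b hc.le (f := R h) (g := h) fun i => by
          rw [hR]
          have := hbd h i
          rw [norm_inv, Real.norm_of_nonneg hc.le] at this
          calc c * _ ≤ c * (c⁻¹ * ‖b.repr h i‖) := by gcongr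
            _ = _ := by field_simp
        rw [inv_mul_eq_div, le_div_iff₀' hc]
        exact this)
    have hR' : ∀ h, R' h = R h := fun _ => rfl
    refine h ⟨R', fun f => repr_ext b fun i => ?_, fun h => ?_⟩
    · rw [hR', hR, repr_sub_smul (A := diagOp b μ) (diagOp_graph b μ).le,
        inv_mul_cancel_left₀ (hz' i)]
    · have hg : (R h, h + z • R h) ∈ (diagOp b μ).graph := by
        rw [diagOp_graph]
        intro i
        simp only [map_add, map_smul, lp.coeFn_add, lp.coeFn_smul, Pi.add_apply, Pi.smul_apply,
          smul_eq_mul, hR]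
        have := hz' i
        field_simp
        ring
      obtain ⟨f, hf1, hf2⟩ := (LinearPMap.mem_graph_iff _).1 hg
      simp only at hf1 hf2
      exact ⟨f, by rw [hf1, hR'], by rw [hf2, hf1]; abel⟩
  · rintro ⟨i, rfl⟩ ⟨R, h, -⟩
    have hg : (b i, (μ i : 𝕜) • b i) ∈ (diagOp b μ).graph := by
      rw [diagOp_graph]; exact basis_mem_diagGraph b μ i
    obtain ⟨f, hf1, hf2⟩ := (LinearPMap.mem_graph_iff _).1 hg
    have := h f
    simp only at hf1 hf2
    rw [hf2, hf1, sub_self, map_zero] at this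
    exact basis_ne_zero b i this.symm

lemma isPosSqrt_diagOp [CompleteSpace H] (hμ : ∀ i, 0 ≤ μ i) :
    IsPosSqrt (diagOp b fun i => √(μ i)) (diagOp b μ) := by
  refine ⟨isSelfAdjoint_diagOp, fun f => ?_, fun f h => ?_⟩
  · have hf := (diagOp_graph b fun i => √(μ i)).le ((diagOp b fun i => √(μ i)).mem_graph f)
    simp only [mem_diagGraph] at hf
    rw [← b.repr.inner_map_map]
    refine HasSum.nonneg (fun i => ?_)
      (RCLike.hasSum_re 𝕜 (lp.hasSum_inner (b.repr (diagOp b (fun i => √(μ i)) f)) (b.repr f)))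
    rw [hf, ← smul_eq_mul, inner_smul_left, RCLike.conj_ofReal, RCLike.re_ofReal_mul,
      inner_self_eq_norm_sq]
    positivity
  · simp only [diagOp_graph, mem_diagGraph]
    have hs : ∀ i, (√(μ i) : 𝕜) * (√(μ i) : 𝕜) = (μ i : 𝕜) := fun i => by
      rw [← RCLike.ofReal_mul, Real.mul_self_sqrt (hμ i)]
    constructor
    · intro hfh
      -- The domain of the operator lies in that of its square root, because μ ≤ 1 + μ² lets the
      -- coefficients of `f` and `h` dominate those of `g`.
      obtain ⟨g, hg⟩ : ∃ g : H, ∀ i, b.repr g i = (√(μ i) : 𝕜) * b.repr f i := by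
        refine exists_repr_eq b (Summable.of_nonneg_of_le (fun i => by positivity) (fun i => ?_)
          ((hasSum_norm_sq_repr b f).summable.add (hasSum_norm_sq_repr b h).summable))
        rw [hfh i, norm_mul, norm_mul, RCLike.norm_ofReal, RCLike.norm_ofReal, mul_pow, mul_pow,
          sq_abs, sq_abs, Real.sq_sqrt (hμ i)]
        nlinarith [sq_nonneg (μ i - 1), sq_nonneg ‖b.repr f i‖,
          mul_nonneg (sq_nonneg (μ i - 1)) (sq_nonneg ‖b.repr f i‖),
          mul_nonneg (hμ i) (sq_nonneg ‖b.repr f i‖)]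
      exact ⟨g, hg, fun i => by rw [hfh i, hg i, ← mul_assoc, hs]⟩
    · rintro ⟨g, hg, hh⟩ i
      rw [hh i, hg i, ← mul_assoc, hs]

/-- A positive square root must act on each b i as multiplication by √(μ i). Symmetry then places it
inside the diagonal operator, and since it is closed and has all b i in its domain, the two
coincide. -/
lemma IsPosSqrt.eq_diagOp [CompleteSpace H] (hμ : ∀ i, 0 ≤ μ i) {S : H →ₗ.[𝕜] H}
    (hS : IsPosSqrt S (diagOp b μ)) : S = diagOp b fun i => √(μ i) := by
  obtain ⟨hsa, hpos, hsq⟩ := hS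
  have hd := hsa.dense_domain
  have hgr : S.graph = S.graph.adjoint := by
    rw [← LinearPMap.adjoint_graph_eq_graph_adjoint hd, LinearPMap.isSelfAdjoint_def.1 hsa]
  have hsymm : ∀ p ∈ S.graph, ∀ q ∈ S.graph, ⟪p.2, q.1⟫_𝕜 = ⟪p.1, q.2⟫_𝕜 := by
    intro p hp q hq
    rw [hgr, Submodule.mem_adjoint_iff] at hq
    exact sub_eq_zero.1 (hq p.1 p.2 hp)
  have hpos' : ∀ p ∈ S.graph, 0 ≤ RCLike.re ⟪p.2, p.1⟫_𝕜 := by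
    intro p hp
    obtain ⟨f, hf1, hf2⟩ := (LinearPMap.mem_graph_iff _).1 hp
    rw [← hf1, ← hf2]; exact hpos f
  have hb : ∀ i, (b i, (√(μ i) : 𝕜) • b i) ∈ S.graph := by
    intro i
    obtain ⟨g, h1, h2⟩ := (hsq (b i) ((μ i : 𝕜) • b i)).1
      (by rw [diagOp_graph]; exact basis_mem_diagGraph b μ i)
    suffices h : g = (√(μ i) : 𝕜) • b i by rwa [h] at h1
    rcases (hμ i).eq_or_lt with h0 | h0
    -- For μ i = 0 and g = S b i, symmetry gives ‖g‖² = ⟨b i, S g⟩ = 0.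
    · have := hsymm _ h1 _ h2
      simp only [← h0, RCLike.ofReal_zero, zero_smul, Real.sqrt_zero, inner_zero_right] at this ⊢
      exact inner_self_eq_zero.1 this
    · set r := √(μ i) with hr
      have hr0 : 0 < r := Real.sqrt_pos.2 h0
      have hrr : (r : 𝕜) * r = μ i := by rw [← RCLike.ofReal_mul, Real.mul_self_sqrt (hμ i)]
      -- Factor S² - r² = (S + r)(S - r): the vector (S - r) b i would be an eigenvector of S for -r
      -- < 0, which positivity forbids unless it is zero.
      have h3 : (g - (r : 𝕜) • b i, -((r : 𝕜) • (g - (r : 𝕜) • b i))) ∈ S.graph := by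
        have := S.graph.sub_mem h2 (S.graph.smul_mem (r : 𝕜) h1)
        convert! this using 1
        ext
        · rfl
        · simp only [smul_sub, smul_smul, hrr, Prod.snd_sub, Prod.smul_snd]; abel
      have h4 := hpos' _ h3
      simp only [inner_neg_left, inner_smul_left, RCLike.conj_ofReal, map_neg,
        RCLike.re_ofReal_mul, inner_self_eq_norm_sq] at h4
      have h5 : ‖g - (r : 𝕜) • b i‖ ^ 2 = 0 := by
        have := sq_nonneg ‖g - (r : 𝕜) • b i‖
        nlinarith
      exact sub_eq_zero.1 (norm_eq_zero.1 (pow_eq_zero_iff two_ne_zero |>.1 h5))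
  have hle : S.graph ≤ diagGraph b fun i => √(μ i) := fun p hp =>
    mem_diagGraph_of_inner b _ fun i => hsymm _ (hb i) _ hp
  rw [← closure_eq_diagOp hle hb]
  refine LinearPMap.eq_of_eq_graph ?_
  rw [← (isClosable_of_le_diagGraph hle).graph_closure_eq_closure_graph]
  exact (IsClosed.submodule_topologicalClosure_eq hsa.isClosed).symm

end DiagOp

end Diagonal

/-! ### The volume measure -/

section Volume

variable {n : ℕ}

lemma norm_sq_eq_sum (x : E n) : ‖x‖ ^ 2 = ∑ k, x k ^ 2 := by
  rw [EuclideanSpace.norm_sq_eq]; simp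

lemma mem_ball_iff {x : E n} : x ∈ ball n ↔ ‖x‖ ^ 2 < 1 := by
  rw [ball, mem_ball_zero_iff, sq_lt_one_iff₀ (norm_nonneg x)]

/-- The inverse of G is 1 - x xᵀ, a rank-one perturbation whose determinant is 1 - |x|² by the
matrix determinant lemma. -/
lemma det_G {x : E n} (hx : x ∈ ball n) : (G n x).det = (1 - ‖x‖ ^ 2)⁻¹ := by
  have h := congrArg Matrix.det (G_mul x hx)
  rw [Matrix.det_mul, Matrix.det_one, Matrix.vecMulVec_eq Unit, Matrix.det_one_sub_mul_comm,
    Matrix.det_unique (n := Unit)] at h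
  refine eq_inv_of_mul_eq_one_left ?_
  rw [norm_sq_eq_sum]
  simpa only [Matrix.sub_apply, Matrix.one_apply_eq, Matrix.mul_apply, Matrix.replicateRow_apply,
    Matrix.replicateCol_apply, sq] using h

lemma sqrt_det_G {x : E n} (hx : x ∈ ball n) : √(G n x).det = 1 / √(1 - ‖x‖ ^ 2) := by
  rw [det_G hx, Real.sqrt_inv, one_div]

lemma volG_eq_muBall : volG n = muBall n := by
  refine withDensity_congr_ae ?_
  filter_upwards [ae_restrict_mem isOpen_ball.measurableSet] with x hx
  rw [sqrt_det_G hx]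

/-- The density of the volume, extended by zero off the ball. -/
def ballDensity (n : ℕ) : E n → ℝ≥0∞ :=
  (ball n).indicator fun x => ENNReal.ofReal (1 / √(1 - ‖x‖ ^ 2))

lemma measurable_ballDensity : Measurable (ballDensity n) := by
  refine Measurable.indicator ?_ isOpen_ball.measurableSet
  fun_prop

lemma muBall_eq_withDensity : muBall n = volume.withDensity (ballDensity n) :=
  (withDensity_indicator isOpen_ball.measurableSet _).symm

/-- The density of the first coordinate in the slicing of the `(n+1)`-dimensional ball. -/
def sliceDensity (n : ℕ) : ℝ → ℝ≥0∞ :=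
  (Set.Ioo (-1) 1).indicator fun t => ENNReal.ofReal (√(1 - t ^ 2) ^ n * (1 / √(1 - t ^ 2)))

lemma measurable_sliceDensity : Measurable (sliceDensity n) := by
  refine Measurable.indicator ?_ measurableSet_Ioo
  fun_prop

/-- The weight `(1 - t²)^((n-1)/2)` on `(-1, 1)`, as a measure. -/
def sliceMeasure (n : ℕ) : Measure ℝ := volume.withDensity (sliceDensity n)

instance : SFinite (muBall n) := by rw [muBall_eq_withDensity]; infer_instance

instance : SFinite (sliceMeasure n) := by rw [sliceMeasure]; infer_instance

lemma sliceMeasure_eq : sliceMeasure n = (volume.restrict (Set.Ioo (-1) 1)).withDensity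
    fun t => ENNReal.ofReal (√(1 - t ^ 2) ^ n * (1 / √(1 - t ^ 2))) :=
  withDensity_indicator measurableSet_Ioo _

lemma one_sub_sq_pos {t : ℝ} (ht : t ∈ Set.Ioo (-1 : ℝ) 1) : 0 < 1 - t ^ 2 := by
  nlinarith [ht.1, ht.2]

lemma integrableOn_one_div_sqrt :
    IntegrableOn (fun t : ℝ => 1 / √(1 - t ^ 2)) (Set.Ioo (-1) 1) := by
  have h := Polynomial.Chebyshev.intervalIntegrable_sqrt_one_sub_sq_inv
  rw [intervalIntegrable_iff_integrableOn_Ioo_of_le (by norm_num)] at h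
  refine h.congr_fun (fun t _ => ?_) measurableSet_Ioo
  simp

instance : IsFiniteMeasure (sliceMeasure n) := by
  rw [sliceMeasure_eq]
  refine isFiniteMeasure_withDensity_ofReal ?_
  refine Integrable.hasFiniteIntegral ?_
  refine Integrable.mono' integrableOn_one_div_sqrt (by fun_prop) ?_
  filter_upwards [ae_restrict_mem measurableSet_Ioo] with t ht
  have h1 : √(1 - t ^ 2) ≤ 1 := Real.sqrt_le_one.2 (by nlinarith)
  rw [Real.norm_of_nonneg (by positivity)]
  exact mul_le_of_le_one_left (by positivity) (pow_le_one₀ (Real.sqrt_nonneg _) h1)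

/-- The vector with first coordinate `t` and remaining coordinates `y`. -/
def consE (t : ℝ) (y : E n) : E (n + 1) :=
  WithLp.toLp 2 (Fin.cons (α := fun _ => ℝ) t (WithLp.ofLp y))

@[simp] lemma consE_zero (t : ℝ) (y : E n) : consE t y 0 = t := rfl

@[simp] lemma consE_succ (t : ℝ) (y : E n) (i : Fin n) : consE t y i.succ = y i := rfl

lemma norm_consE_sq (t : ℝ) (y : E n) : ‖consE t y‖ ^ 2 = t ^ 2 + ‖y‖ ^ 2 := by
  rw [norm_sq_eq_sum, norm_sq_eq_sum, Fin.sum_univ_succ]; simp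

lemma measurePreserving_consE :
    MeasurePreserving (fun p : ℝ × E n => consE p.1 p.2) := by
  have h1 : MeasurePreserving (Prod.map id (WithLp.ofLp (p := 2)) : ℝ × E n → ℝ × (Fin n → ℝ)) :=
    (MeasurePreserving.id volume).prod (PiLp.volume_preserving_ofLp (Fin n))
  have h2 := (volume_preserving_piFinSuccAbove (fun _ : Fin (n + 1) => ℝ) 0).symm
  have h3 := PiLp.volume_preserving_toLp (Fin (n + 1))
  convert! h3.comp (h2.comp h1) using 1
  funext p
  simp only [Function.comp_apply, consE, Prod.map, id]
  congr 1
  funext i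
  refine Fin.cases ?_ (fun j => ?_) i <;> simp [MeasurableEquiv.piFinSuccAbove]

/-- The parametrization of the `(n+1)`-dimensional ball by its slices. -/
def slice (p : ℝ × E n) : E (n + 1) := consE p.1 (√(1 - p.1 ^ 2) • p.2)

lemma measurable_slice : Measurable (slice (n := n)) := by
  have h : slice (n := n) = (fun p : ℝ × E n => consE p.1 p.2) ∘
    fun p => (p.1, √(1 - p.1 ^ 2) • p.2) := rfl
  rw [h]
  exact measurePreserving_consE.measurable.comp (by fun_prop)

lemma lintegral_comp_smul' {c : ℝ} (hc : 0 < c) {f : E n → ℝ≥0∞} (hf : Measurable f) :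
    ∫⁻ y, f y = ENNReal.ofReal (c ^ n) * ∫⁻ y, f (c • y) := by
  have h := Measure.map_addHaar_smul (volume : Measure (E n)) hc.ne'
  have h2 : ∫⁻ y, f (c • y) = ∫⁻ y, f y ∂(Measure.map (c • ·) (volume : Measure (E n))) :=
    (lintegral_map hf (measurable_const_smul c)).symm
  rw [h2, h, lintegral_smul_measure, finrank_euclideanSpace, Fintype.card_fin, smul_eq_mul,
    ← mul_assoc, ← ENNReal.ofReal_mul (by positivity), abs_of_pos (by positivity),
    mul_inv_cancel₀ (by positivity), ENNReal.ofReal_one, one_mul]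

lemma ballDensity_consE_of_notMem {t : ℝ} (ht : t ∉ Set.Ioo (-1 : ℝ) 1) (y : E n) :
    ballDensity (n + 1) (consE t y) = 0 := by
  refine Set.indicator_of_notMem (fun h => ht ?_) _
  rw [mem_ball_iff, norm_consE_sq] at h
  rw [Set.mem_Ioo, ← abs_lt, ← sq_lt_one_iff_abs_lt_one]
  nlinarith [sq_nonneg ‖y‖]

lemma one_sub_norm_slice_sq {t : ℝ} (ht : t ∈ Set.Ioo (-1 : ℝ) 1) (y : E n) :
    1 - ‖slice (t, y)‖ ^ 2 = (1 - t ^ 2) * (1 - ‖y‖ ^ 2) := by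
  simp only [slice]
  rw [norm_consE_sq, norm_smul, mul_pow, Real.norm_of_nonneg (Real.sqrt_nonneg _),
    Real.sq_sqrt (one_sub_sq_pos ht).le]
  ring

/-- The Jacobian √(1 - t²)^n of the rescaling, together with the factorization of 1 - |x|² along a
slice, splits the density into a function of t times the density of the smaller ball. -/
lemma ballDensity_slice {t : ℝ} (ht : t ∈ Set.Ioo (-1 : ℝ) 1) (y : E n) :
    ENNReal.ofReal (√(1 - t ^ 2) ^ n) * ballDensity (n + 1) (slice (t, y)) =
      sliceDensity n t * ballDensity n y := by
  have h0 := one_sub_sq_pos ht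
  have h1 := one_sub_norm_slice_sq ht y
  have h2 : slice (t, y) ∈ ball (n + 1) ↔ y ∈ ball n := by
    rw [mem_ball_iff, mem_ball_iff, ← sub_pos, h1, mul_pos_iff_of_pos_left h0, sub_pos]
  by_cases hy : y ∈ ball n
  · simp only [ballDensity, sliceDensity]
    rw [Set.indicator_of_mem (h2.2 hy), Set.indicator_of_mem hy, Set.indicator_of_mem ht, h1,
      Real.sqrt_mul h0.le, ← ENNReal.ofReal_mul (by positivity),
      ← ENNReal.ofReal_mul (by positivity)]
    congr 1
    field_simp
  · simp only [ballDensity]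
    rw [Set.indicator_of_notMem (fun h => hy (h2.1 h)), Set.indicator_of_notMem hy, mul_zero,
      mul_zero]

lemma measurable_consE (t : ℝ) : Measurable (consE (n := n) t) :=
  measurePreserving_consE.measurable.comp (measurable_prodMk_left (x := t))

lemma lintegral_ballDensity_consE (t : ℝ) {f : E (n + 1) → ℝ≥0∞} (hf : Measurable f) :
    ∫⁻ y, ballDensity (n + 1) (consE t y) * f (consE t y) =
      sliceDensity n t * ∫⁻ y, f (slice (t, y)) ∂muBall n := by
  by_cases ht : t ∈ Set.Ioo (-1 : ℝ) 1
  · have hm2 : Measurable fun y : E n => f (slice (t, y)) :=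
      hf.comp (measurable_slice.comp (measurable_prodMk_left (x := t)))
    have hm3 : Measurable fun y : E n => ballDensity (n + 1) (slice (t, y)) * f (slice (t, y)) :=
      (measurable_ballDensity.comp (measurable_slice.comp (measurable_prodMk_left (x := t)))).mul
        hm2
    have hm : Measurable fun y : E n => ballDensity (n + 1) (consE t y) * f (consE t y) :=
      (measurable_ballDensity.comp (measurable_consE t)).mul (hf.comp (measurable_consE t))
    calc _ = ENNReal.ofReal (√(1 - t ^ 2) ^ n) *
          ∫⁻ y : E n, ballDensity (n + 1) (slice (t, y)) * f (slice (t, y)) :=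
          lintegral_comp_smul' (Real.sqrt_pos.2 (one_sub_sq_pos ht)) hm
      _ = ∫⁻ y : E n, sliceDensity n t * (ballDensity n y * f (slice (t, y))) := by
          rw [← lintegral_const_mul _ hm3]
          refine lintegral_congr fun y => ?_
          rw [← mul_assoc, ballDensity_slice ht, mul_assoc]
      _ = _ := by
          have hm4 : Measurable fun y : E n => ballDensity n y * f (slice (t, y)) :=
            measurable_ballDensity.mul hm2
          rw [lintegral_const_mul _ hm4, muBall_eq_withDensity,
            lintegral_withDensity_eq_lintegral_mul _ measurable_ballDensity hm2]
          rfl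
  · simp only [ballDensity_consE_of_notMem ht, zero_mul, lintegral_zero]
    rw [sliceDensity, Set.indicator_of_notMem ht, zero_mul]

/-- Fubini in the first coordinate followed by a rescaling of the remaining ones. This reduces
integrals over the ball to one-variable integrals, by induction on the dimension. -/
lemma muBall_succ :
    muBall (n + 1) = ((sliceMeasure n).prod (muBall n)).map slice := by
  refine Measure.ext_of_lintegral _ fun f hf => ?_
  have hfs : Measurable fun p : ℝ × E n => f (slice p) := hf.comp measurable_slice
  have hF : Measurable fun x => ballDensity (n + 1) x * f x := measurable_ballDensity.mul hf
  have h1 : ∫⁻ x, f x ∂muBall (n + 1) = ∫⁻ x, ballDensity (n + 1) x * f x := by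
    rw [muBall_eq_withDensity, lintegral_withDensity_eq_lintegral_mul _ measurable_ballDensity hf]
    rfl
  rw [h1, lintegral_map hf measurable_slice, lintegral_prod _ hfs.aemeasurable,
    ← measurePreserving_consE.lintegral_comp hF, Measure.volume_eq_prod,
    lintegral_prod (fun p : ℝ × E n => ballDensity (n + 1) (consE p.1 p.2) * f (consE p.1 p.2))
      (hF.comp measurePreserving_consE.measurable).aemeasurable, sliceMeasure,
    lintegral_withDensity_eq_lintegral_mul _ measurable_sliceDensity hfs.lintegral_prod_right']
  exact lintegral_congr fun t => lintegral_ballDensity_consE t hf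

lemma muBall_zero : muBall 0 = Measure.dirac 0 := by
  have h : ballDensity 0 = 1 := by
    funext x
    rw [Subsingleton.elim x 0]
    simp [ballDensity, mem_ball_iff]
  rw [muBall_eq_withDensity, h, withDensity_one]
  exact volume_euclideanSpace_eq_dirac (ι := Fin 0)

instance isFiniteMeasure_muBall : (n : ℕ) → IsFiniteMeasure (muBall n)
  | 0 => by rw [muBall_zero]; infer_instance
  | n + 1 => by
    have := isFiniteMeasure_muBall n
    rw [muBall_succ]; infer_instance

instance : IsFiniteMeasure (volG n) := by rw [volG_eq_muBall]; infer_instance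

lemma integral_sliceMeasure (f : ℝ → ℝ) : ∫ t, f t ∂sliceMeasure n =
    ∫ t in Set.Ioo (-1 : ℝ) 1, √(1 - t ^ 2) ^ n * (1 / √(1 - t ^ 2)) * f t := by
  rw [sliceMeasure_eq, integral_withDensity_eq_integral_toReal_smul (by fun_prop)
    (Eventually.of_forall fun _ => ENNReal.ofReal_lt_top)]
  refine integral_congr_ae (Eventually.of_forall fun t => ?_)
  simp only [smul_eq_mul]
  rw [ENNReal.toReal_ofReal (by positivity)]

end Volume

/-! ### The one-variable polynomials -/

section OneVariable

open Polynomial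

/-- The polynomial `p` has degree `m` and the parity of `m`, and it solves the Gegenbauer equation
`(1 - X²) p'' - (N + 1) X p' + m (m + N) p = 0`. -/
structure IsGegenbauer (N m : ℕ) (p : ℝ[X]) : Prop where
  ne_zero : p ≠ 0
  natDegree_eq : p.natDegree = m
  parity : ∀ j, p.coeff j ≠ 0 → Even (m - j)
  ode : (1 - X ^ 2) * derivative (derivative p) - C ((N : ℝ) + 1) * X * derivative p +
    C ((m : ℝ) * (m + N)) * p = 0

lemma integrableOn_slice_weight (N : ℕ) {f : ℝ → ℝ} (hf : Continuous f) :
    IntegrableOn (fun t : ℝ => √(1 - t ^ 2) ^ N * (1 / √(1 - t ^ 2)) * f t) (Set.Icc (-1) 1) := by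
  have h : IntegrableOn (fun t : ℝ => 1 / √(1 - t ^ 2)) (Set.Icc (-1) 1) := by
    rw [integrableOn_Icc_iff_integrableOn_Ioo]; exact integrableOn_one_div_sqrt
  have hc : ContinuousOn (fun t : ℝ => √(1 - t ^ 2) ^ N * f t) (Set.Icc (-1) 1) := by fun_prop
  refine (h.continuousOn_mul hc isCompact_Icc).congr_fun (fun t _ => ?_) measurableSet_Icc
  ring

lemma integrable_sliceMeasure {N : ℕ} {f : ℝ → ℝ} (hf : Continuous f) :
    Integrable f (sliceMeasure N) := by
  rw [sliceMeasure_eq, integrable_withDensity_iff_integrable_smul' (by fun_prop)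
    (Eventually.of_forall fun _ => ENNReal.ofReal_lt_top)]
  refine ((integrableOn_slice_weight N hf).mono_set Set.Ioo_subset_Icc_self).congr
    (Eventually.of_forall fun t => ?_)
  simp only [smul_eq_mul]
  rw [ENNReal.toReal_ofReal (by positivity)]

lemma IsGegenbauer.ode_eval {N m : ℕ} {p : ℝ[X]} (h : IsGegenbauer N m p) (t : ℝ) :
    (1 - t ^ 2) * (derivative (derivative p)).eval t - (N + 1) * t * (derivative p).eval t +
      m * (m + N) * p.eval t = 0 := by
  simpa using congrArg (eval t) h.ode

/-- Sturm-Liouville argument. The Wronskian `w` times (1 - t²)^((N+1)/2) has derivative equal to the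
weight times a nonzero multiple of `p q`, and it vanishes at ±1 because the exponent is positive
even for N = 0. -/
lemma IsGegenbauer.integral_mul_eq_zero {N m k : ℕ} {p q : ℝ[X]} (hp : IsGegenbauer N m p)
    (hq : IsGegenbauer N k q) (hmk : m ≠ k) :
    ∫ t, p.eval t * q.eval t ∂sliceMeasure N = 0 := by
  set w : ℝ → ℝ := fun t => (derivative p).eval t * q.eval t - p.eval t * (derivative q).eval t
    with hw
  set c : ℝ := (k : ℝ) * (k + N) - m * (m + N) with hc
  have hc0 : c ≠ 0 := by
    -- The function m ↦ m (m + N) is strictly increasing on ℕ, so different degrees have different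
    -- eigenvalues.
    have : (k : ℝ) * (k + N) ≠ m * (m + N) := by
      norm_cast
      rcases lt_or_gt_of_ne hmk with h | h
      · exact (Nat.mul_lt_mul_of_lt_of_le h (by omega) (by omega)).ne'
      · exact (Nat.mul_lt_mul_of_lt_of_le h (by omega) (by omega)).ne
    exact sub_ne_zero.2 this
  have hderiv : ∀ t ∈ Set.Ioo (-1 : ℝ) 1, HasDerivAt (fun t => √(1 - t ^ 2) ^ (N + 1) * w t)
      (√(1 - t ^ 2) ^ N * (1 / √(1 - t ^ 2)) * (c * (p.eval t * q.eval t))) t := by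
    intro t ht
    have h0 := one_sub_sq_pos ht
    have h1 : HasDerivAt (fun t : ℝ => 1 - t ^ 2) (-(2 * t)) t := by
      simpa using (hasDerivAt_pow 2 t).const_sub 1
    have h2 := (h1.sqrt h0.ne').pow (N + 1)
    have h3 : HasDerivAt w _ t := (((derivative p).hasDerivAt t).mul (q.hasDerivAt t)).sub
      ((p.hasDerivAt t).mul ((derivative q).hasDerivAt t))
    refine (h2.mul h3).congr_deriv ?_
    have hs : √(1 - t ^ 2) ≠ 0 := (Real.sqrt_pos.2 h0).ne'
    have e1 := hp.ode_eval t
    have e2 := hq.ode_eval t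
    have e3 : √(1 - t ^ 2) ^ 2 = 1 - t ^ 2 := Real.sq_sqrt h0.le
    simp only [hw, hc, Nat.add_sub_cancel, Pi.pow_apply]
    push_cast
    set r := √(1 - t ^ 2)
    field_simp
    rw [← e3] at e1 e2
    linear_combination (r ^ N) * (q.eval t * e1 - p.eval t * e2)
  have hint := integrableOn_slice_weight N (f := fun t => c * (p.eval t * q.eval t))
    (by fun_prop)
  have hcont : ContinuousOn (fun t => √(1 - t ^ 2) ^ (N + 1) * w t) (Set.Icc (-1) 1) := by
    simp only [hw]; fun_prop
  have h := intervalIntegral.integral_eq_sub_of_hasDerivAt_of_le (by norm_num) hcont hderiv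
    ((intervalIntegrable_iff_integrableOn_Icc_of_le (by norm_num)).2 hint)
  rw [intervalIntegral.integral_of_le (by norm_num), integral_Ioc_eq_integral_Ioo,
    ← integral_sliceMeasure, integral_const_mul] at h
  have h' : c * ∫ t, p.eval t * q.eval t ∂sliceMeasure N = 0 := by
    rw [h]; norm_num
  exact (mul_eq_zero.1 h').resolve_left hc0

/-- Off the finitely many roots of `p` both the density and p² are positive. Were the integral zero,
the interval (-1, 1) would be Lebesgue null. -/
lemma integral_sq_pos_of_ne_zero (N : ℕ) {p : ℝ[X]} (hp : p ≠ 0) :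
    0 < ∫ t, p.eval t * p.eval t ∂sliceMeasure N := by
  rw [integral_pos_iff_support_of_nonneg (fun t => mul_self_nonneg _)
    (integrable_sliceMeasure (p.continuous.mul p.continuous)), pos_iff_ne_zero, sliceMeasure, Ne,
    withDensity_apply_eq_zero measurable_sliceDensity]
  intro h
  have h1 : Set.Ioo (-1 : ℝ) 1 ⊆ ({t | sliceDensity N t ≠ 0} ∩
      Function.support fun t => p.eval t * p.eval t) ∪ (p.roots.toFinset : Set ℝ) := by
    intro t ht
    by_cases h0 : p.eval t = 0
    · right; simp [hp, h0]
    · left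
      refine ⟨?_, by simpa using h0⟩
      have := Real.sqrt_pos.2 (one_sub_sq_pos ht)
      simp only [sliceDensity, Set.mem_ofPred_eq, Set.indicator_of_mem ht]
      rw [Ne, ENNReal.ofReal_eq_zero, not_le]
      positivity
  have h2 := measure_mono (μ := volume) h1
  have h3 := h2.trans (measure_union_le _ _)
  rw [h, (Finset.finite_toSet _).measure_zero, Real.volume_Ioo] at h3
  norm_num at h3

lemma isGegenbauer_chebyshev (m : ℕ) : IsGegenbauer 0 m (Polynomial.Chebyshev.T ℝ m) := by
  have hdeg : (Polynomial.Chebyshev.T ℝ m).natDegree = m := by simp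
  have h0 : Polynomial.Chebyshev.T ℝ m ≠ 0 := by
    intro h
    have := Polynomial.Chebyshev.leadingCoeff_T (R := ℝ) m
    rw [h, leadingCoeff_zero] at this
    exact absurd this.symm (by positivity)
  refine ⟨h0, hdeg, fun j hj => ?_, ?_⟩
  · have hjm : j ≤ m := by
      by_contra hlt
      exact hj (coeff_eq_zero_of_natDegree_lt (by omega))
    -- Parity of the coefficients comes from T_m(-x) = (-1)^m T_m(x). The bound j ≤ m ensures that
    -- the difference m - j in ℕ is not truncated.
    have h : (Polynomial.Chebyshev.T ℝ m).comp (C (-1) * X) =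
        C ((-1) ^ m) * Polynomial.Chebyshev.T ℝ m := by
      refine Polynomial.funext fun x => ?_
      simp [Int.negOnePow_def]
    have h2 := congrArg (fun q => coeff q j) h
    simp only [comp_C_mul_X_coeff, coeff_C_mul] at h2
    have h3 := mul_right_cancel₀ hj ((mul_comm _ _).trans h2)
    rcases Nat.even_or_odd j with he | ho <;> rcases Nat.even_or_odd m with he' | ho'
    · exact (Nat.even_sub hjm).2 (by simp [he, he'])
    · rw [he.neg_one_pow, ho'.neg_one_pow] at h3; norm_num at h3
    · rw [ho.neg_one_pow, he'.neg_one_pow] at h3; norm_num at h3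
    · exact Nat.Odd.sub_odd ho' ho
  · have h := Polynomial.Chebyshev.one_sub_X_sq_mul_derivative_derivative_T_eq_poly_in_T
      (R := ℝ) m
    simp only [Function.iterate_succ, Function.iterate_zero, Function.comp_apply, id] at h
    rw [h]
    simp only [CharP.cast_eq_zero, zero_add, C_1, add_zero, C_mul, map_natCast]
    push_cast
    ring

/-- The coefficients of the Gegenbauer polynomials. -/
def gegenbauerCoeff (s : ℝ) (m k : ℕ) : ℝ :=
  (-1) ^ k * (ascPochhammer ℝ (m - k)).eval s /
    ((k.factorial : ℝ) * ((m - 2 * k).factorial : ℝ)) * 2 ^ (m - 2 * k)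

lemma gegenbauer_eq_sum (s : ℝ) (m : ℕ) : gegenbauer s m =
    ∑ k ∈ Finset.range (m / 2 + 1), C (gegenbauerCoeff s m k) * X ^ (m - 2 * k) := by
  refine Finset.sum_congr rfl fun k _ => ?_
  rw [mul_pow, ← mul_assoc, gegenbauerCoeff, C_mul (b := 2 ^ _), C_pow]
  rfl

lemma gegenbauer_coeff (s : ℝ) (m j : ℕ) : (gegenbauer s m).coeff j =
    ∑ k ∈ Finset.range (m / 2 + 1), if j = m - 2 * k then gegenbauerCoeff s m k else 0 := by
  simp [gegenbauer_eq_sum, coeff_X_pow]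

/-- The coefficient of X^(m-2k-2) in the Gegenbauer equation: the second derivative of the k-th term
meets the degree-preserving part of the next one. With p = m - 2(k+1), the latter has the factor (m
- p)(m + p + 2s) = 4(k+1)(m - (k+1) + s). -/
lemma gegenbauerCoeff_succ (s : ℝ) {m k : ℕ} (h : 2 * (k + 1) ≤ m) :
    gegenbauerCoeff s m k * ((m - 2 * k : ℕ) * ((m - 2 * k : ℕ) - 1)) +
      gegenbauerCoeff s m (k + 1) * (4 * (k + 1) * (m - (k + 1) + s)) = 0 := by
  obtain ⟨p, rfl⟩ := Nat.exists_eq_add_of_le h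
  have e1 : 2 * (k + 1) + p - k = (p + k + 1) + 1 := by omega
  have e2 : 2 * (k + 1) + p - 2 * k = p + 1 + 1 := by omega
  have e3 : 2 * (k + 1) + p - (k + 1) = p + k + 1 := by omega
  have e4 : 2 * (k + 1) + p - 2 * (k + 1) = p := by omega
  simp only [gegenbauerCoeff, e1, e2, e3, e4, ascPochhammer_succ_eval, Nat.factorial_succ]
  push_cast
  have h1 : (k.factorial : ℝ) ≠ 0 := by positivity
  have h2 : (p.factorial : ℝ) ≠ 0 := by positivity
  have h3 : ((k : ℝ) + 1) ≠ 0 := by positivity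
  have h4 : ((p : ℝ) + 1) ≠ 0 := by positivity
  have h5 : ((p : ℝ) + 1 + 1) ≠ 0 := by positivity
  field_simp
  ring

lemma gegenbauer_ode (s : ℝ) (m : ℕ) :
    (1 - X ^ 2) * derivative (derivative (gegenbauer s m)) -
      C (2 * s + 1) * X * derivative (gegenbauer s m) + C ((m : ℝ) * (m + 2 * s)) *
        gegenbauer s m = 0 := by
  -- The k-th term contributes `u k`, lowered by two degrees through the second derivative, and `v
  -- k`, of unchanged degree. The recursion says u k + v (k+1) = 0, so only v 0 and the last u
  -- remain.
  set u : ℕ → ℝ[X] := fun k =>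
    C (gegenbauerCoeff s m k * ((m - 2 * k : ℕ) * ((m - 2 * k : ℕ) - 1))) * X ^ (m - 2 * k - 2)
    with hu
  set v : ℕ → ℝ[X] := fun k =>
    C (gegenbauerCoeff s m k * (4 * k * (m - k + s))) * X ^ (m - 2 * k) with hv
  have hterm : ∀ k ∈ Finset.range (m / 2 + 1),
      (1 - X ^ 2) * derivative (derivative (C (gegenbauerCoeff s m k) * X ^ (m - 2 * k))) -
      C (2 * s + 1) * X * derivative (C (gegenbauerCoeff s m k) * X ^ (m - 2 * k)) +
      C ((m : ℝ) * (m + 2 * s)) * (C (gegenbauerCoeff s m k) * X ^ (m - 2 * k)) = u k + v k := by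
    intro k hk
    rw [Finset.mem_range] at hk
    obtain ⟨p, hp⟩ := Nat.exists_eq_add_of_le (show 2 * k ≤ m by omega)
    have e : m - 2 * k = p := by omega
    have em : (m : ℝ) = 2 * k + p := by rw [hp]; push_cast; ring
    simp only [hu, hv, e, em]
    refine Polynomial.funext fun x => ?_
    rcases p with _ | _ | p
    · simp; ring
    · simp; ring
    · simp only [derivative_C_mul, derivative_X_pow_succ, eval_add, eval_sub, eval_mul, eval_C,
        eval_pow, eval_X, eval_one]
      push_cast
      ring
  have hsum : ∑ k ∈ Finset.range (m / 2 + 1), (u k + v k) = 0 := by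
    rw [Finset.sum_add_distrib, Finset.sum_range_succ, Finset.sum_range_succ' v]
    -- The last exponent is 0 or 1, so its second derivative vanishes.
    have h1 : u (m / 2) = 0 := by
      rcases Nat.even_or_odd' m with ⟨r, hr | hr⟩
      · have : m - 2 * (m / 2) = 0 := by omega
        simp [hu, this]
      · have : m - 2 * (m / 2) = 1 := by omega
        simp [hu, this]
    have h2 : v 0 = 0 := by simp [hv]
    rw [h1, h2, add_zero, add_zero, ← Finset.sum_add_distrib]
    refine Finset.sum_eq_zero fun k hk => ?_
    rw [Finset.mem_range] at hk
    have := gegenbauerCoeff_succ s (m := m) (k := k) (by omega)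
    have e : m - 2 * k - 2 = m - 2 * (k + 1) := by omega
    simp only [hu, hv, e]
    rw [← add_mul, ← C_add]
    push_cast
    rw [this, C_0, zero_mul]
  rw [← hsum, ← Finset.sum_congr rfl hterm, gegenbauer_eq_sum, derivative_sum, derivative_sum,
    Finset.mul_sum, Finset.mul_sum, Finset.mul_sum, ← Finset.sum_sub_distrib,
    ← Finset.sum_add_distrib]

/-- Positivity of N makes the rising factorial, and with it the leading coefficient, nonzero. At N =
0 it would vanish for m > 0, which is why the last coordinate carries a Chebyshev polynomial. -/
lemma isGegenbauer_gegenbauer {N : ℕ} (hN : 0 < N) (m : ℕ) :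
    IsGegenbauer N m (gegenbauer ((N : ℝ) / 2) m) := by
  have hs : (0 : ℝ) < N / 2 := by positivity
  have htop : (gegenbauer ((N : ℝ) / 2) m).coeff m ≠ 0 := by
    rw [gegenbauer_coeff, Finset.sum_eq_single 0]
    · have := ascPochhammer_pos m ((N : ℝ) / 2) hs
      simp only [gegenbauerCoeff, mul_zero, Nat.sub_zero, if_true]
      positivity
    · intro k hk hk0
      rw [Finset.mem_range] at hk
      rw [if_neg (by omega)]
    · simp
  refine ⟨fun h => htop (by rw [h]; simp), ?_, fun j hj => ?_, ?_⟩
  · refine le_antisymm ?_ (le_natDegree_of_ne_zero htop)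
    rw [gegenbauer_eq_sum]
    refine natDegree_sum_le_of_forall_le _ _ fun k _ => ?_
    exact (natDegree_C_mul_X_pow_le _ _).trans (Nat.sub_le _ _)
  · rw [gegenbauer_coeff] at hj
    obtain ⟨k, hk, hk'⟩ := Finset.exists_ne_zero_of_sum_ne_zero hj
    rw [Finset.mem_range] at hk
    have : j = m - 2 * k := by
      by_contra h
      exact hk' (if_neg h)
    exact ⟨k, by omega⟩
  · have := gegenbauer_ode ((N : ℝ) / 2) m
    rwa [mul_div_cancel₀ _ (two_ne_zero' ℝ)] at this

lemma IsGegenbauer.C_mul {N m : ℕ} {p : ℝ[X]} (h : IsGegenbauer N m p) {a : ℝ} (ha : a ≠ 0) :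
    IsGegenbauer N m (C a * p) := by
  refine ⟨mul_ne_zero (C_ne_zero.2 ha) h.ne_zero, by rw [natDegree_C_mul ha, h.natDegree_eq],
    fun j hj => h.parity j fun h0 => hj (by rw [coeff_C_mul, h0, mul_zero]), ?_⟩
  have := congrArg (C a * ·) h.ode
  simp only [mul_zero] at this
  rw [← this]
  simp only [derivative_C_mul]
  ring

lemma isGegenbauer_monicGegenbauer {N : ℕ} (hN : 0 < N) (m : ℕ) :
    IsGegenbauer N m (monicGegenbauer ((N : ℝ) / 2) m) :=
  (isGegenbauer_gegenbauer hN m).C_mul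
    (inv_ne_zero (leadingCoeff_ne_zero.2 (isGegenbauer_gegenbauer hN m).ne_zero))

/-- Twice the Gegenbauer parameter. -/
def gegIndex {n : ℕ} (α : Fin n → ℕ) (j : Fin n) : ℕ :=
  (n - 1 - j) + 2 * ∑ k ∈ Finset.univ.filter (j < ·), α k

lemma gegParam_eq {n : ℕ} (α : Fin n → ℕ) (j : Fin n) :
    gegParam α j = (gegIndex α j : ℝ) / 2 := by
  have h : (n - 1 - j) + 1 + (j : ℕ) = n := by omega
  have h2 : ((n - 1 - j : ℕ) : ℝ) + 1 + (j : ℕ) = n := by exact_mod_cast h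
  simp only [gegParam, gegIndex]
  push_cast
  rw [← h2]
  ring

lemma isGegenbauer_factorPoly {n : ℕ} (α : Fin n → ℕ) (j : Fin n) :
    IsGegenbauer (gegIndex α j) (α j) (factorPoly α j) := by
  rw [factorPoly]
  split_ifs with h
  · have h0 : gegIndex α j = 0 := by
      have : Finset.univ.filter (j < ·) = ∅ := by
        ext k; simp only [Finset.mem_filter, Finset.mem_univ, true_and, Finset.notMem_empty,
          iff_false, not_lt, Fin.le_def]; omega
      simp only [gegIndex, this, Finset.sum_empty]; omega
    rw [h0]
    exact isGegenbauer_chebyshev _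
  · rw [gegParam_eq]
    refine isGegenbauer_monicGegenbauer ?_ _
    simp only [gegIndex]; omega

end OneVariable

/-! ### The orthogonal polynomials of the ball -/

section Orthogonal

variable {n : ℕ}

lemma measurable_phiRaw (α : Fin n → ℕ) : Measurable (phiRaw α) := by
  refine Finset.measurable_fun_prod _ fun j _ => ?_
  have h : Measurable fun x : E n => √(headRem j x) := by
    simp only [headRem]; fun_prop
  refine (h.pow_const _).mul ((factorPoly α j).continuous.measurable.comp ?_)
  exact Measurable.div (by fun_prop) h

lemma headRem_zero (x : E (n + 1)) : headRem 0 x = 1 := by simp [headRem]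

lemma filter_lt_succ (j : Fin n) : (Finset.univ.filter (· < j.succ) : Finset (Fin (n + 1))) =
    insert 0 ((Finset.univ.filter (· < j)).map (Fin.succEmb n)) := by
  ext k
  refine Fin.cases ?_ (fun i => ?_) k
  · simp
  · simp [Fin.succ_ne_zero]

lemma filter_succ_lt (j : Fin n) : (Finset.univ.filter (j.succ < ·) : Finset (Fin (n + 1))) =
    (Finset.univ.filter (j < ·)).map (Fin.succEmb n) := by
  ext k
  refine Fin.cases ?_ (fun i => ?_) k
  · simp
  · simp

lemma headRem_slice {t : ℝ} (ht : t ∈ Set.Ioo (-1 : ℝ) 1) (y : E n) (j : Fin n) :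
    headRem j.succ (slice (t, y)) = (1 - t ^ 2) * headRem j y := by
  rw [headRem, filter_lt_succ, Finset.sum_insert (by simp [Fin.succ_ne_zero]), Finset.sum_map]
  simp only [slice, headRem, consE_zero, Fin.coe_succEmb, consE_succ, PiLp.smul_apply, smul_eq_mul,
    mul_pow, Real.sq_sqrt (one_sub_sq_pos ht).le, ← Finset.mul_sum]
  ring

lemma gegIndex_succ (α : Fin (n + 1) → ℕ) (j : Fin n) :
    gegIndex α j.succ = gegIndex (Fin.tail α) j := by
  simp only [gegIndex, filter_succ_lt, Finset.sum_map, Fin.coe_succEmb, Fin.val_succ, Fin.tail]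
  congr 1
  omega

lemma gegIndex_zero (α : Fin (n + 1) → ℕ) :
    gegIndex α 0 = n + 2 * ∑ k, Fin.tail α k := by
  have : (Finset.univ.filter ((0 : Fin (n + 1)) < ·)) =
      (Finset.univ : Finset (Fin n)).map (Fin.succEmb n) := by
    ext k
    refine Fin.cases ?_ (fun i => ?_) k <;> simp
  simp only [gegIndex, this, Finset.sum_map, Fin.tail, Fin.coe_succEmb]
  simp

lemma factorPoly_succ (α : Fin (n + 1) → ℕ) (j : Fin n) :
    factorPoly α j.succ = factorPoly (Fin.tail α) j := by
  simp only [factorPoly, gegParam_eq, gegIndex_succ, Fin.val_succ, Fin.tail, add_left_inj]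

/-- On a slice every later w_j is multiplied by 1 - t², while the arguments x_j / √w_j do not
change. Each later factor therefore only gains √(1 - t²)^(α_j). -/
lemma phiRaw_slice (α : Fin (n + 1) → ℕ) {t : ℝ} (ht : t ∈ Set.Ioo (-1 : ℝ) 1) (y : E n) :
    phiRaw α (slice (t, y)) = (factorPoly α 0).eval t * √(1 - t ^ 2) ^ (∑ k, Fin.tail α k) *
      phiRaw (Fin.tail α) y := by
  have hc := (Real.sqrt_pos.2 (one_sub_sq_pos ht)).ne'
  rw [phiRaw, Fin.prod_univ_succ, phiRaw, headRem_zero, ← Finset.prod_pow_eq_pow_sum,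
    mul_assoc (Polynomial.eval t _), ← Finset.prod_mul_distrib]
  congr 1
  · simp [slice]
  · refine Finset.prod_congr rfl fun j _ => ?_
    rw [headRem_slice ht, Real.sqrt_mul (one_sub_sq_pos ht).le, factorPoly_succ, mul_pow, mul_assoc]
    congr 3
    simp only [slice, consE_succ, PiLp.smul_apply, smul_eq_mul]
    rw [mul_div_mul_left _ _ hc]

lemma ae_sliceMeasure_mem : ∀ᵐ t ∂sliceMeasure n, t ∈ Set.Ioo (-1 : ℝ) 1 := by
  rw [sliceMeasure_eq]
  exact (withDensity_absolutelyContinuous _ _).ae_le (ae_restrict_mem measurableSet_Ioo)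

lemma integral_phiRaw_succ (α β : Fin (n + 1) → ℕ) :
    ∫ x, phiRaw α x * phiRaw β x ∂muBall (n + 1) =
      (∫ t, (factorPoly α 0).eval t * √(1 - t ^ 2) ^ (∑ k, Fin.tail α k) *
        ((factorPoly β 0).eval t * √(1 - t ^ 2) ^ (∑ k, Fin.tail β k)) ∂sliceMeasure n) *
      ∫ y, phiRaw (Fin.tail α) y * phiRaw (Fin.tail β) y ∂muBall n := by
  have hm : Measurable fun x => phiRaw α x * phiRaw β x :=
    (measurable_phiRaw α).mul (measurable_phiRaw β)
  rw [muBall_succ, integral_map measurable_slice.aemeasurable hm.aestronglyMeasurable, ← integral_prod_mul]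
  refine integral_congr_ae ?_
  filter_upwards [Measure.quasiMeasurePreserving_fst.ae ae_sliceMeasure_mem] with p hp
  obtain ⟨t, y⟩ := p
  rw [phiRaw_slice α hp, phiRaw_slice β hp]
  ring

/-- The powers of √(1 - t²) gained on a slice raise the weight index by 2N; with N the length of the
tail, this is exactly the index of the first Gegenbauer factor (`gegIndex_zero`). -/
lemma integral_sliceMeasure_weight (N : ℕ) (f g : ℝ → ℝ) :
    ∫ t, f t * √(1 - t ^ 2) ^ N * (g t * √(1 - t ^ 2) ^ N) ∂sliceMeasure n =
      ∫ t, f t * g t ∂sliceMeasure (n + 2 * N) := by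
  rw [integral_sliceMeasure, integral_sliceMeasure]
  refine integral_congr_ae (Eventually.of_forall fun t => ?_)
  simp only []
  ring

/-- Induction on the dimension. If the tails differ, the integral over the smaller ball is zero. If
they agree, the first entries differ, and the two first factors solve the same Gegenbauer equation
with different degrees. -/
lemma integral_phiRaw_mul_eq_zero : ∀ {n : ℕ} {α β : Fin n → ℕ}, α ≠ β →
    ∫ x, phiRaw α x * phiRaw β x ∂muBall n = 0
  | 0, α, β, h => absurd (Subsingleton.elim α β) h
  | n + 1, α, β, h => by
    rw [integral_phiRaw_succ]
    by_cases ht : Fin.tail α = Fin.tail β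
    · have h0 : α 0 ≠ β 0 := fun h0 => h (by
        rw [← Fin.cons_self_tail α, ← Fin.cons_self_tail β, h0, ht])
      have hα := isGegenbauer_factorPoly α 0
      have hβ := isGegenbauer_factorPoly β 0
      rw [gegIndex_zero] at hα hβ
      rw [← ht] at hβ ⊢
      rw [integral_sliceMeasure_weight, hα.integral_mul_eq_zero hβ h0, zero_mul]
    · rw [integral_phiRaw_mul_eq_zero ht, mul_zero]

lemma integral_phiRaw_sq_pos : ∀ {n : ℕ} (α : Fin n → ℕ),
    0 < ∫ x, phiRaw α x * phiRaw α x ∂muBall n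
  | 0, α => by simp [muBall_zero, phiRaw]
  | n + 1, α => by
    rw [integral_phiRaw_succ, integral_sliceMeasure_weight]
    exact mul_pos (integral_sq_pos_of_ne_zero _ (isGegenbauer_factorPoly α 0).ne_zero)
      (integral_phiRaw_sq_pos _)

lemma integral_phi_mul (α β : Fin n → ℕ) :
    ∫ x, phi α x * phi β x ∂muBall n = if α = β then 1 else 0 := by
  simp only [phi, div_mul_div_comm, integral_div]
  split_ifs with h
  · subst h
    have := integral_phiRaw_sq_pos α
    simp only [sq]
    rw [Real.mul_self_sqrt this.le, div_self this.ne']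
  · rw [integral_phiRaw_mul_eq_zero h, zero_div]

open MvPolynomial in
/-- The polynomial `1 - ∑_{k < j} X_k²`. -/
def headRemPoly (j : Fin n) : MvPolynomial (Fin n) ℝ :=
  1 - ∑ k ∈ Finset.univ.filter (· < j), X k ^ 2

open MvPolynomial in
/-- The factors of the orthogonal polynomials, as polynomials. -/
def factorMv (α : Fin n → ℕ) (j : Fin n) : MvPolynomial (Fin n) ℝ :=
  ∑ i ∈ Finset.range (α j + 1),
    C ((factorPoly α j).coeff i) * X j ^ i * headRemPoly j ^ ((α j - i) / 2)

/-- The orthonormal polynomials, as polynomials. -/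
def phiPoly (α : Fin n → ℕ) : MvPolynomial (Fin n) ℝ :=
  MvPolynomial.C (√(∫ y, phiRaw α y ^ 2 ∂muBall n))⁻¹ * ∏ j, factorMv α j

lemma eval_headRemPoly (j : Fin n) (x : E n) :
    MvPolynomial.eval (fun i => x i) (headRemPoly j) = headRem j x := by
  simp [headRemPoly, headRem]

lemma headRem_pos {x : E n} (hx : x ∈ ball n) (j : Fin n) : 0 < headRem j x := by
  refine (sum_sq_lt hx).trans_le (sub_le_sub_left ?_ 1)
  exact Finset.sum_le_sum_of_subset_of_nonneg (Finset.filter_subset _ _) fun _ _ _ => sq_nonneg _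

lemma eval_factorMv (α : Fin n → ℕ) (j : Fin n) {x : E n} (hx : x ∈ ball n) :
    MvPolynomial.eval (fun i => x i) (factorMv α j) =
      √(headRem j x) ^ α j * (factorPoly α j).eval (x j / √(headRem j x)) := by
  have hp := isGegenbauer_factorPoly α j
  have hw := headRem_pos hx j
  have hs := (Real.sqrt_pos.2 hw).ne'
  rw [Polynomial.eval_eq_sum_range, hp.natDegree_eq, factorMv, map_sum, Finset.mul_sum]
  refine Finset.sum_congr rfl fun i hi => ?_
  rw [Finset.mem_range] at hi
  simp only [map_mul, map_pow, MvPolynomial.eval_C, MvPolynomial.eval_X, eval_headRemPoly]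
  by_cases h0 : (factorPoly α j).coeff i = 0
  · simp [h0]
  -- For a nonzero coefficient the difference α j - i is even. The halved exponent in `factorMv` is
  -- then exact, and the square roots combine to an integral power of w_j.
  · obtain ⟨r, hr⟩ := hp.parity i h0
    have e1 : α j = i + 2 * r := by omega
    have e2 : (α j - i) / 2 = r := by omega
    rw [e2, e1, pow_add, pow_mul, Real.sq_sqrt hw.le, div_pow]
    field_simp

/-- The terms bound the degree from above. From below, setting all variables but x_j to zero turns
w_j into 1 and recovers the one-variable polynomial of degree α j. -/
lemma totalDegree_factorMv (α : Fin n → ℕ) (j : Fin n) :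
    factorMv α j ≠ 0 ∧ (factorMv α j).totalDegree = α j := by
  have hp := isGegenbauer_factorPoly α j
  have hW : (headRemPoly j).totalDegree ≤ 2 := by
    refine (MvPolynomial.totalDegree_sub _ _).trans (max_le (by simp) ?_)
    refine MvPolynomial.totalDegree_finsetSum_le fun k _ => ?_
    exact (MvPolynomial.totalDegree_X_pow _ _).le
  have haev : MvPolynomial.aeval (fun k => if k = j then (Polynomial.X : Polynomial ℝ) else 0)
      (factorMv α j) = factorPoly α j := by
    conv_rhs => rw [(factorPoly α j).as_sum_range_C_mul_X_pow, hp.natDegree_eq]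
    rw [factorMv, map_sum]
    refine Finset.sum_congr rfl fun i _ => ?_
    have : MvPolynomial.aeval (fun k => if k = j then (Polynomial.X : Polynomial ℝ) else 0)
        (headRemPoly j) = 1 := by
      rw [headRemPoly, map_sub, map_one, map_sum, Finset.sum_eq_zero, sub_zero]
      intro k hk
      rw [Finset.mem_filter] at hk
      simp [hk.2.ne]
    simp [this]
  constructor
  · intro h
    rw [h, map_zero] at haev
    exact hp.ne_zero haev.symm
  · apply le_antisymm
    · refine MvPolynomial.totalDegree_finsetSum_le fun i hi => ?_
      rw [Finset.mem_range] at hi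
      refine (MvPolynomial.totalDegree_mul _ _).trans ?_
      have h1 : (MvPolynomial.C ((factorPoly α j).coeff i) * MvPolynomial.X j ^ i :
          MvPolynomial (Fin n) ℝ).totalDegree ≤ i := by
        refine (MvPolynomial.totalDegree_mul _ _).trans ?_
        rw [MvPolynomial.totalDegree_C, MvPolynomial.totalDegree_X_pow, zero_add]
      have h2 : (headRemPoly j ^ ((α j - i) / 2)).totalDegree ≤ ((α j - i) / 2) * 2 :=
        (MvPolynomial.totalDegree_pow _ _).trans (Nat.mul_le_mul_left _ hW)
      omega
    · have h := MvPolynomial.aeval_natDegree_le (factorMv α j) le_rfl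
        (fun k => if k = j then (Polynomial.X : Polynomial ℝ) else 0) (n := 1)
        (fun k => by split_ifs <;> simp)
      rw [haev, hp.natDegree_eq, mul_one] at h
      exact h

lemma totalDegree_prod_of_ne_zero {ι : Type*} (s : Finset ι) (f : ι → MvPolynomial (Fin n) ℝ)
    (hf : ∀ i, f i ≠ 0) : (∏ i ∈ s, f i).totalDegree = ∑ i ∈ s, (f i).totalDegree := by
  classical
  induction s using Finset.induction_on with
  | empty => simp
  | insert a s ha ih =>
    rw [Finset.prod_insert ha, Finset.sum_insert ha, MvPolynomial.totalDegree_mul_of_isDomain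
      (hf a) (Finset.prod_ne_zero_iff.2 fun i _ => hf i), ih]

lemma totalDegree_phiPoly (α : Fin n → ℕ) : (phiPoly α).totalDegree = ∑ i, α i := by
  have h0 : (√(∫ y, phiRaw α y ^ 2 ∂muBall n))⁻¹ ≠ 0 := by
    have := integral_phiRaw_sq_pos α
    simp only [← sq] at this
    exact inv_ne_zero (Real.sqrt_pos.2 this).ne'
  have h1 : ∏ j, factorMv α j ≠ 0 := Finset.prod_ne_zero_iff.2 fun i _ => (totalDegree_factorMv α i).1
  rw [phiPoly, MvPolynomial.totalDegree_mul_of_isDomain (MvPolynomial.C_ne_zero.2 h0) h1,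
    MvPolynomial.totalDegree_C, zero_add,
    totalDegree_prod_of_ne_zero _ _ fun i => (totalDegree_factorMv α i).1]
  exact Finset.sum_congr rfl fun i _ => (totalDegree_factorMv α i).2

lemma phi_eq_eval (α : Fin n → ℕ) {x : E n} (hx : x ∈ ball n) :
    phi α x = MvPolynomial.eval (fun i => x i) (phiPoly α) := by
  rw [phi, phiPoly, map_mul, map_prod, MvPolynomial.eval_C, phiRaw, div_eq_inv_mul]
  congr 1
  exact Finset.prod_congr rfl fun j _ => (eval_factorMv α j hx).symm

end Orthogonal

/-! ### The Laplace-Beltrami operator in coordinates and Green's formula -/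

section Green

variable {𝕜 : Type*} [RCLike 𝕜] {n : ℕ}

lemma one_sub_norm_sq_pos {x : E n} (hx : x ∈ ball n) : 0 < 1 - ‖x‖ ^ 2 :=
  sub_pos.2 (mem_ball_iff.1 hx)

lemma pd_smul {f : E n → ℝ} {u : E n → 𝕜} {x : E n} (hf : DifferentiableAt ℝ f x)
    (hu : DifferentiableAt ℝ u x) (i : Fin n) :
    pd i (fun y => f y • u y) x = f x • pd i u x + pd i f x • u x := by
  simp [pd, fderiv_fun_smul hf hu]

lemma pd_mul_fun {f u : E n → 𝕜} {x : E n} (hf : DifferentiableAt ℝ f x)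
    (hu : DifferentiableAt ℝ u x) (i : Fin n) :
    pd i (fun y => f y * u y) x = f x * pd i u x + pd i f x * u x := by
  simp [pd, fderiv_fun_mul hf hu, mul_comm]

lemma pd_sum {ι : Type*} {s : Finset ι} {u : ι → E n → 𝕜} {x : E n}
    (hu : ∀ j ∈ s, DifferentiableAt ℝ (u j) x) (i : Fin n) :
    pd i (fun y => ∑ j ∈ s, u j y) x = ∑ j ∈ s, pd i (u j) x := by
  simp [pd, fderiv_fun_sum hu]

lemma pd_sub {u v : E n → 𝕜} {x : E n} (hu : DifferentiableAt ℝ u x)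
    (hv : DifferentiableAt ℝ v x) (i : Fin n) :
    pd i (fun y => u y - v y) x = pd i u x - pd i v x := by
  simp [pd, fderiv_fun_sub hu hv]

lemma pd_coord (i j : Fin n) (x : E n) :
    pd i (fun y : E n => y j) x = if i = j then (1 : ℝ) else 0 := by
  have h : HasFDerivAt (fun y : E n => y j) (EuclideanSpace.proj (𝕜 := ℝ) j) x :=
    (EuclideanSpace.proj (𝕜 := ℝ) j).hasFDerivAt
  rw [pd, h.fderiv]
  simp [eq_comm]

lemma pd_comp_normSq {g : ℝ → ℝ} {g' : ℝ} {x : E n} (hg : HasDerivAt g g' (1 - ‖x‖ ^ 2))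
    (i : Fin n) : pd i (fun y : E n => g (1 - ‖y‖ ^ 2)) x = -(2 * x i * g') := by
  have h1 : HasFDerivAt (fun y : E n => 1 - ‖y‖ ^ 2) (-(2 • innerSL ℝ x)) x :=
    (hasStrictFDerivAt_norm_sq x).hasFDerivAt.const_sub 1
  have h2 := hg.comp_hasFDerivAt x h1
  rw [pd]
  have h3 : fderiv ℝ (fun y : E n => g (1 - ‖y‖ ^ 2)) x = g' • -(2 • innerSL ℝ x) := h2.fderiv
  rw [h3]
  simp [EuclideanSpace.inner_single_right]
  ring

lemma differentiableAt_coord_smul {u : E n → 𝕜} {x : E n} (hu : DifferentiableAt ℝ u x)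
    (i : Fin n) : DifferentiableAt ℝ (fun y => y i • u y) x := by
  have h : DifferentiableAt ℝ (fun y : E n => y i) x := by fun_prop
  exact h.smul hu

lemma contDiffAt_coord_smul {k : WithTop ℕ∞} {u : E n → 𝕜} {x : E n} (hu : ContDiffAt ℝ k u x)
    (i : Fin n) : ContDiffAt ℝ k (fun y => y i • u y) x := by
  have h : ContDiffAt ℝ k (fun y : E n => y i) x := by fun_prop
  exact h.smul hu

/-- The radial derivative `∑ x_j ∂_j u`. -/
def radial (u : E n → 𝕜) (x : E n) : 𝕜 := ∑ j, x j • pd j u x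

lemma grad_eq (u : E n → 𝕜) {x : E n} (hx : x ∈ ball n) (i : Fin n) :
    grad u x i = pd i u x - x i • radial u x := by
  simp only [grad, G_inv x hx, Matrix.sub_apply, Matrix.one_apply, Matrix.vecMulVec_apply, sub_smul,
    Finset.sum_sub_distrib, radial, Finset.smul_sum, smul_smul]
  congr 1
  simp

/-- The density times the gradient. -/
def flux (u : E n → 𝕜) (i : Fin n) (x : E n) : 𝕜 :=
  (1 / √(1 - ‖x‖ ^ 2)) • (pd i u x - x i • radial u x)

/-- Since x · (∇u - x Ru) = (1 - |x|²) Ru, the singular density leaves a factor √(1 - |x|²). This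
decay at the sphere replaces a boundary condition. -/
lemma sum_mul_flux (u : E n → 𝕜) {x : E n} (hx : x ∈ ball n) :
    ∑ i, x i • flux u i x = √(1 - ‖x‖ ^ 2) • radial u x := by
  have h0 := one_sub_norm_sq_pos hx
  have h : ∑ i, x i • flux u i x =
      (1 / √(1 - ‖x‖ ^ 2)) • ∑ i, x i • (pd i u x - x i • radial u x) := by
    rw [Finset.smul_sum]
    exact Finset.sum_congr rfl fun i _ => smul_comm _ _ _
  have h2 : ∑ i, x i • (pd i u x - x i • radial u x) = (1 - ‖x‖ ^ 2) • radial u x := by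
    simp only [smul_sub, Finset.sum_sub_distrib, smul_smul, ← Finset.sum_smul, ← sq,
      ← norm_sq_eq_sum, sub_smul, one_smul]
    rfl
  rw [h, h2, smul_smul]
  congr 1
  rw [one_div_mul_eq_div, Real.div_sqrt]

lemma contDiffAt_pd {k m : WithTop ℕ∞} {u : E n → 𝕜} {x : E n} (hu : ContDiffAt ℝ m u x)
    (hkm : k + 1 ≤ m) (i : Fin n) : ContDiffAt ℝ k (pd i u) x :=
  (hu.fderiv_right hkm).clm_apply contDiffAt_const

lemma contDiffAt_radial {k m : WithTop ℕ∞} {u : E n → 𝕜} {x : E n} (hu : ContDiffAt ℝ m u x)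
    (hkm : k + 1 ≤ m) : ContDiffAt ℝ k (radial u) x := by
  refine ContDiffAt.sum fun j _ => contDiffAt_coord_smul (contDiffAt_pd hu hkm j) j

lemma contDiffAt_flux {u : E n → 𝕜} {x : E n} (hu : ContDiffAt ℝ 2 u x) (hx : x ∈ ball n)
    (i : Fin n) : ContDiffAt ℝ 1 (flux u i) x := by
  have h0 := one_sub_norm_sq_pos hx
  have h1 : ContDiffAt ℝ 1 (fun y : E n => 1 - ‖y‖ ^ 2) x :=
    contDiffAt_const.sub (contDiff_norm_sq ℝ).contDiffAt
  have h2 : ContDiffAt ℝ 1 (fun y : E n => 1 / √(1 - ‖y‖ ^ 2)) x :=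
    contDiffAt_const.div (h1.sqrt h0.ne') (Real.sqrt_pos.2 h0).ne'
  have h3 : ContDiffAt ℝ 1 (radial u) x := contDiffAt_radial hu (by norm_num)
  have h4 : ContDiffAt ℝ 1 (pd i u) x := contDiffAt_pd hu (by norm_num) i
  exact h2.smul (h4.sub (contDiffAt_coord_smul h3 i))

lemma laplaceBeltrami_eq_flux (u : E n → 𝕜) {x : E n} (hx : x ∈ ball n) :
    laplaceBeltrami u x = √(1 - ‖x‖ ^ 2) • ∑ i, pd i (flux u i) x := by
  rw [laplaceBeltrami, sqrt_det_G hx, one_div_one_div]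
  congr 1
  refine Finset.sum_congr rfl fun i _ => pd_congr (fun y hy => ?_) hx i
  rw [sqrt_det_G hy, grad_eq u hy, flux]

lemma IsC2b.contDiffAt {u : E n → 𝕜} (hu : IsC2b u) {x : E n} (hx : x ∈ ball n) :
    ContDiffAt ℝ 2 u x := hu.contDiffOn.contDiffAt (isOpen_ball.mem_nhds hx)

lemma pd_radial {u : E n → 𝕜} {x : E n} (hu : ContDiffAt ℝ 2 u x) (i : Fin n) :
    pd i (radial u) x = pd i u x + ∑ j, x j • pd i (pd j u) x := by
  have hd : ∀ j, DifferentiableAt ℝ (pd j u) x := fun j =>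
    (contDiffAt_pd (k := 1) hu (by norm_num) j).differentiableAt (by norm_num)
  have h : pd i (radial u) x = ∑ j, pd i (fun y : E n => y j • pd j u y) x :=
    pd_sum (fun j _ => differentiableAt_coord_smul (hd j) j) i
  rw [h, Finset.sum_congr rfl fun j _ => pd_smul (by fun_prop) (hd j) i, Finset.sum_add_distrib,
    add_comm]
  simp [pd_coord]

/-- Differentiating the density produces x_i / (1 - |x|²); paired with the gradient, this
singularity cancels against the factor 1 - |x|² of its radial component. What remains has polynomial
coefficients, so Δ maps polynomials to polynomials and bounded C² functions to bounded ones. -/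
lemma laplaceBeltrami_eq {u : E n → 𝕜} {x : E n} (hu : ContDiffAt ℝ 2 u x) (hx : x ∈ ball n) :
    laplaceBeltrami u x = ∑ i, pd i (pd i u) x - ∑ i, ∑ j, (x i * x j) • pd i (pd j u) x -
      (n : ℝ) • radial u x := by
  have h0 := one_sub_norm_sq_pos hx
  have hs := (Real.sqrt_pos.2 h0).ne'
  have hd : ∀ j, DifferentiableAt ℝ (pd j u) x := fun j =>
    (contDiffAt_pd (k := 1) hu (by norm_num) j).differentiableAt (by norm_num)
  have hR : DifferentiableAt ℝ (radial u) x :=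
    (contDiffAt_radial (k := 1) hu (by norm_num)).differentiableAt (by norm_num)
  have hw : HasDerivAt (fun t : ℝ => 1 / √t) (-(1 / (2 * ((1 - ‖x‖ ^ 2) * √(1 - ‖x‖ ^ 2)))))
      (1 - ‖x‖ ^ 2) := by
    have := ((hasDerivAt_id' (1 - ‖x‖ ^ 2)).sqrt h0.ne').inv hs
    simp only [one_div] at this ⊢
    refine this.congr_deriv ?_
    rw [Real.sq_sqrt h0.le]
    field_simp
  have hwd : DifferentiableAt ℝ (fun y : E n => 1 / √(1 - ‖y‖ ^ 2)) x := by
    have h1 : DifferentiableAt ℝ (fun y : E n => 1 - ‖y‖ ^ 2) x :=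
      (hasStrictFDerivAt_norm_sq x).hasFDerivAt.differentiableAt.const_sub 1
    exact (hw.comp_hasFDerivAt x h1.hasFDerivAt).differentiableAt
  have hpd : ∀ i, √(1 - ‖x‖ ^ 2) • pd i (flux u i) x = pd i (pd i u) x - radial u x -
      x i • (pd i u x + ∑ j, x j • pd i (pd j u) x) +
      (1 / (1 - ‖x‖ ^ 2)) • x i • (pd i u x - x i • radial u x) := by
    intro i
    have h1 : pd i (flux u i) x = _ := pd_smul hwd
      ((hd i).fun_sub (differentiableAt_coord_smul hR i)) i
    rw [h1, pd_comp_normSq hw,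
      pd_sub (hd i) (differentiableAt_coord_smul hR i),
      pd_smul (by fun_prop) hR, pd_coord, if_pos rfl, one_smul, pd_radial hu]
    rw [smul_add, smul_smul, smul_smul, smul_smul]
    have e1 : √(1 - ‖x‖ ^ 2) * (1 / √(1 - ‖x‖ ^ 2)) = 1 := mul_one_div_cancel hs
    have e2 : √(1 - ‖x‖ ^ 2) * -(2 * x i * -(1 / (2 * ((1 - ‖x‖ ^ 2) * √(1 - ‖x‖ ^ 2))))) =
        1 / (1 - ‖x‖ ^ 2) * x i := by
      field_simp
    rw [e1, e2, one_smul]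
    abel
  have h2 : ∑ i, x i • (pd i u x - x i • radial u x) = (1 - ‖x‖ ^ 2) • radial u x := by
    simp only [smul_sub, Finset.sum_sub_distrib, smul_smul, ← Finset.sum_smul, ← sq,
      ← norm_sq_eq_sum, sub_smul, one_smul]
    rfl
  have h3 : ∑ i, x i • (pd i u x + ∑ j, x j • pd i (pd j u) x) =
      radial u x + ∑ i, ∑ j, (x i * x j) • pd i (pd j u) x := by
    simp only [smul_add, Finset.sum_add_distrib, Finset.smul_sum, smul_smul]
    rfl
  rw [laplaceBeltrami_eq_flux u hx, Finset.smul_sum, Finset.sum_congr rfl fun i _ => hpd i,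
    Finset.sum_add_distrib, Finset.sum_sub_distrib, Finset.sum_sub_distrib, ← Finset.smul_sum, h2,
    h3, smul_smul, one_div_mul_cancel h0.ne', one_smul, Finset.sum_const, Finset.card_univ,
    Fintype.card_fin, Nat.cast_smul_eq_nsmul]
  abel

lemma aestronglyMeasurable_of_continuousOn {F : Type*} [NormedAddCommGroup F] {f : E n → F}
    (hf : ContinuousOn f (ball n)) : AEStronglyMeasurable f (muBall n) :=
  (hf.aestronglyMeasurable isOpen_ball.measurableSet).mono_ac
    (withDensity_absolutelyContinuous _ _)

lemma ae_mem_ball' : ∀ᵐ x ∂muBall n, x ∈ ball n := by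
  rw [← volG_eq_muBall]; exact ae_mem_ball

lemma continuousOn_of_contDiffAt {F : Type*} [NormedAddCommGroup F] [NormedSpace ℝ F]
    {f : E n → F} (hf : ∀ x ∈ ball n, ContDiffAt ℝ 0 f x) : ContinuousOn f (ball n) :=
  fun x hx => (hf x hx).continuousAt.continuousWithinAt

lemma IsC2b.continuousOn_laplaceBeltrami {u : E n → 𝕜} (hu : IsC2b u) :
    ContinuousOn (laplaceBeltrami u) (ball n) := by
  have h : ∀ x ∈ ball n, laplaceBeltrami u x =
      √(1 - ‖x‖ ^ 2) • ∑ i, pd i (flux u i) x := fun x hx => laplaceBeltrami_eq_flux u hx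
  refine ContinuousOn.congr (ContinuousOn.smul (by fun_prop) ?_) h
  refine continuousOn_of_contDiffAt fun x hx => ContDiffAt.sum fun i _ => ?_
  exact contDiffAt_pd (contDiffAt_flux (hu.contDiffAt hx) hx i) (by norm_num) i

lemma abs_coord_le_one {x : E n} (hx : x ∈ ball n) (i : Fin n) : |x i| ≤ 1 := by
  have h := PiLp.norm_apply_le x i
  have h2 := mem_ball_zero_iff.1 hx
  rw [Real.norm_eq_abs] at h
  linarith

lemma IsC2b.exists_bound {u : E n → 𝕜} (hu : IsC2b u) : ∃ C : ℝ, 0 ≤ C ∧ ∀ x ∈ ball n,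
    ‖u x‖ ≤ C ∧ (∀ i, ‖pd i u x‖ ≤ C) ∧ ‖radial u x‖ ≤ C ∧ ‖laplaceBeltrami u x‖ ≤ C := by
  obtain ⟨C, hC⟩ := hu.bdd
  have hC0 : 0 ≤ C := (norm_nonneg _).trans (hC 0 (by simp [ball])).1
  have hR : ∀ x ∈ ball n, ‖radial u x‖ ≤ n * C := by
    intro x hx
    refine (norm_sum_le _ _).trans ?_
    refine (Finset.sum_le_sum (g := fun _ => C) fun j _ => ?_).trans (by simp)
    rw [norm_smul]
    exact (mul_le_of_le_one_left (norm_nonneg _) (abs_coord_le_one hx j)).trans ((hC x hx).2.1 j)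
  have hn : (0 : ℝ) ≤ n := Nat.cast_nonneg n
  refine ⟨C + n * C + (n * C + n * (n * C) + n * (n * C)), by positivity, fun x hx =>
    ⟨(hC x hx).1.trans ?_, fun i => ((hC x hx).2.1 i).trans ?_, (hR x hx).trans ?_, ?_⟩⟩
  · have : 0 ≤ n * C + (n * C + n * (n * C) + n * (n * C)) := by positivity
    linarith
  · have : 0 ≤ n * C + (n * C + n * (n * C) + n * (n * C)) := by positivity
    linarith
  · have : 0 ≤ C + (n * C + n * (n * C) + n * (n * C)) := by positivity
    linarith
  · rw [laplaceBeltrami_eq (hu.contDiffAt hx) hx]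
    have h1 : ‖∑ i, pd i (pd i u) x‖ ≤ n * C := by
      refine (norm_sum_le _ _).trans ?_
      exact (Finset.sum_le_sum (g := fun _ => C) fun j _ => (hC x hx).2.2 j j).trans (by simp)
    have h2 : ‖∑ i, ∑ j, (x i * x j) • pd i (pd j u) x‖ ≤ n * (n * C) := by
      refine (norm_sum_le _ _).trans ?_
      refine (Finset.sum_le_sum (g := fun _ => n * C) fun i _ => ?_).trans (by simp)
      refine (norm_sum_le _ _).trans ?_
      refine (Finset.sum_le_sum (g := fun _ => C) fun j _ => ?_).trans (by simp)
      rw [norm_smul, Real.norm_eq_abs, abs_mul]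
      refine (mul_le_of_le_one_left (norm_nonneg _) ?_).trans ((hC x hx).2.2 i j)
      exact mul_le_one₀ (abs_coord_le_one hx i) (abs_nonneg _) (abs_coord_le_one hx j)
    have h3 : ‖(n : ℝ) • radial u x‖ ≤ n * (n * C) := by
      rw [norm_smul, Real.norm_of_nonneg hn]
      exact mul_le_mul_of_nonneg_left (hR x hx) hn
    have h4 : 0 ≤ C + n * C := by positivity
    refine (norm_sub_le_of_le (norm_sub_le_of_le h1 h2) h3).trans ?_
    linarith

lemma integral_pd_eq_zero {f : E n → 𝕜} (hf : ContDiff ℝ 1 f) (hc : HasCompactSupport f)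
    (i : Fin n) : ∫ x, pd i f x = 0 := by
  have h1 : Continuous (pd i f) := (hf.continuous_fderiv (by norm_num)).clm_apply continuous_const
  have h2 : HasCompactSupport (pd i f) := hc.fderiv_apply (𝕜 := ℝ) _
  have h := integral_mul_fderiv_eq_neg_fderiv_mul_of_integrable (μ := volume) (𝕜 := 𝕜)
    (f := fun _ : E n => (1 : 𝕜)) (g := f) (v := EuclideanSpace.single i 1) (by simp)
    (by simpa using! h1.integrable_of_hasCompactSupport h2)
    (by simpa using hf.continuous.integrable_of_hasCompactSupport hc)
    (fun _ _ => differentiableAt_const _) (fun x _ => (hf.differentiable (by norm_num)) x)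
  simpa [pd] using h

end Green

/-! ### Cutoff functions and Green's formula without boundary conditions -/

section Green

variable {𝕜 : Type*} [RCLike 𝕜] {n : ℕ}

lemma integral_muBall (f : E n → 𝕜) :
    ∫ x, f x ∂muBall n = ∫ x in ball n, (1 / √(1 - ‖x‖ ^ 2)) • f x := by
  rw [muBall, integral_withDensity_eq_integral_toReal_smul (by fun_prop)
    (Eventually.of_forall fun _ => ENNReal.ofReal_lt_top)]
  refine integral_congr_ae (Eventually.of_forall fun x => ?_)
  simp only []
  rw [ENNReal.toReal_ofReal (by positivity)]

/-- A smooth cutoff function, equal to `1` where `k (1 - |x|²) ≥ 2` and to `0` where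
`k (1 - |x|²) ≤ 1`. -/
def cutoff (k : ℕ) (x : E n) : ℝ := Real.smoothTransition (k * (1 - ‖x‖ ^ 2) - 1)

/-- The function `t ↦ t h'(t)`, for `h` the profile of the cutoff functions. -/
def cutoffSlope (t : ℝ) : ℝ := t * deriv Real.smoothTransition (t - 1)

lemma contDiff_cutoff (k : ℕ) : ContDiff ℝ ∞ (cutoff (n := n) k) :=
  Real.smoothTransition.contDiff.comp
    ((contDiff_const.mul (contDiff_const.sub (contDiff_norm_sq ℝ))).sub contDiff_const)

lemma cutoff_eq_zero_of_le {k : ℕ} {x : E n} (h : k * (1 - ‖x‖ ^ 2) ≤ 1) : cutoff k x = 0 :=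
  Real.smoothTransition.zero_of_nonpos (by linarith)

lemma cutoff_eventually_zero (k : ℕ) {x : E n} (hx : x ∉ ball n) :
    ∀ᶠ y in 𝓝 x, cutoff k y = 0 := by
  have hc : Continuous fun y : E n => (k : ℝ) * (1 - ‖y‖ ^ 2) := by fun_prop
  have h : (k : ℝ) * (1 - ‖x‖ ^ 2) < 1 := by
    rw [mem_ball_iff, not_lt] at hx
    have : (k : ℝ) * (1 - ‖x‖ ^ 2) ≤ 0 :=
      mul_nonpos_of_nonneg_of_nonpos (Nat.cast_nonneg k) (by linarith)
    linarith
  filter_upwards [hc.continuousAt.eventually_lt_const h] with y hy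
  exact cutoff_eq_zero_of_le hy.le

lemma cutoffSlope_eq_zero {t : ℝ} (ht : t ∉ Set.Icc (1 : ℝ) 2) : cutoffSlope t = 0 := by
  have h : deriv Real.smoothTransition (t - 1) = 0 := by
    rw [Set.mem_Icc, not_and_or, not_le, not_le] at ht
    rcases ht with ht | ht
    · have : Real.smoothTransition =ᶠ[𝓝 (t - 1)] fun _ => 0 := by
        filter_upwards [Iio_mem_nhds (show t - 1 < 0 by linarith)] with s hs
        exact Real.smoothTransition.zero_of_nonpos (le_of_lt hs)
      rw [this.deriv_eq]; simp
    · have : Real.smoothTransition =ᶠ[𝓝 (t - 1)] fun _ => 1 := by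
        filter_upwards [Ioi_mem_nhds (show 1 < t - 1 by linarith)] with s hs
        exact Real.smoothTransition.one_of_one_le (le_of_lt hs)
      rw [this.deriv_eq]; simp
  rw [cutoffSlope, h, mul_zero]

lemma continuous_cutoffSlope : Continuous cutoffSlope := by
  have h : Continuous (deriv Real.smoothTransition) :=
    Real.smoothTransition.contDiff (n := 1) |>.continuous_deriv (by norm_num)
  exact continuous_id.mul (h.comp (by fun_prop))

/-- The derivative of the k-th cutoff grows like k, but only where k (1 - |x|²) is between 1 and 2.
Multiplied by 1 - |x|² it stays bounded uniformly in k, as dominated convergence requires. -/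
lemma exists_cutoffSlope_bound : ∃ M : ℝ, ∀ t, ‖cutoffSlope t‖ ≤ M :=
  continuous_cutoffSlope.bounded_above_of_compact_support
    (HasCompactSupport.intro isCompact_Icc fun _ ht => cutoffSlope_eq_zero ht)

lemma pd_cutoff (k : ℕ) (x : E n) (i : Fin n) : pd i (cutoff (n := n) k) x =
    -(2 * x i * (k * deriv Real.smoothTransition (k * (1 - ‖x‖ ^ 2) - 1))) := by
  have h1 : HasDerivAt Real.smoothTransition
      (deriv Real.smoothTransition (k * (1 - ‖x‖ ^ 2) - 1)) (k * (1 - ‖x‖ ^ 2) - 1) :=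
    ((Real.smoothTransition.contDiff (n := 1)).differentiable (by norm_num) _).hasDerivAt
  have h2 : HasDerivAt (fun t : ℝ => k * t - 1) k (1 - ‖x‖ ^ 2) := by
    simpa using ((hasDerivAt_id (1 - ‖x‖ ^ 2)).const_mul (k : ℝ)).sub_const 1
  have h3 := h1.comp (1 - ‖x‖ ^ 2) h2
  have h4 : pd i (cutoff (n := n) k) x = _ := pd_comp_normSq h3 i
  rw [h4]
  ring

variable {w u : E n → 𝕜}

lemma contDiff_cutoff_flux (hw : ContDiffOn ℝ 1 w (ball n)) (hu : IsC2b u) (k : ℕ) (i : Fin n) :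
    ContDiff ℝ 1 fun x => cutoff k x • (w x * flux u i x) := by
  rw [contDiff_iff_contDiffAt]
  intro x
  by_cases hx : x ∈ ball n
  · have h1 : ContDiffAt ℝ 1 (cutoff (n := n) k) x :=
      ((contDiff_cutoff k).of_le (by exact_mod_cast le_top)).contDiffAt
    have h2 : ContDiffAt ℝ 1 w x := hw.contDiffAt (isOpen_ball.mem_nhds hx)
    exact h1.smul (h2.mul (contDiffAt_flux (hu.contDiffAt hx) hx i))
  · refine contDiffAt_const (c := (0 : 𝕜)) |>.congr_of_eventuallyEq ?_
    filter_upwards [cutoff_eventually_zero k hx] with y hy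
    rw [hy, zero_smul]

/-- The cutoff is a radial function, so its gradient meets the flux only through the radial
component. By `sum_mul_flux` that term carries the factor k (1 - |x|²) and becomes the bounded
`cutoffSlope`. -/
lemma sum_pd_cutoff_flux (hw : ContDiffOn ℝ 1 w (ball n)) (hu : IsC2b u) (k : ℕ) {x : E n}
    (hx : x ∈ ball n) : ∑ i, pd i (fun x => cutoff k x • (w x * flux u i x)) x =
      (1 / √(1 - ‖x‖ ^ 2)) • (cutoff k x • (w x * laplaceBeltrami u x +
        ∑ i, pd i w x * grad u x i) -
        (2 * cutoffSlope (k * (1 - ‖x‖ ^ 2))) • (w x * radial u x)) := by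
  have h0 := one_sub_norm_sq_pos hx
  have hs := (Real.sqrt_pos.2 h0).ne'
  have hc : DifferentiableAt ℝ (cutoff (n := n) k) x :=
    (contDiff_cutoff k).differentiable (by simp) x
  have hwd : DifferentiableAt ℝ w x :=
    (hw.contDiffAt (isOpen_ball.mem_nhds hx)).differentiableAt (by norm_num)
  have hf : ∀ i, DifferentiableAt ℝ (flux u i) x := fun i =>
    (contDiffAt_flux (hu.contDiffAt hx) hx i).differentiableAt (by norm_num)
  have hpd : ∀ i, pd i (fun x => cutoff k x • (w x * flux u i x)) x =
      cutoff k x • (w x * pd i (flux u i) x) +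
      cutoff k x • (1 / √(1 - ‖x‖ ^ 2)) • (pd i w x * grad u x i) -
      (2 * k * deriv Real.smoothTransition (k * (1 - ‖x‖ ^ 2) - 1)) •
        (w x * x i • flux u i x) := by
    intro i
    rw [pd_smul hc (hwd.fun_mul (hf i)), pd_mul_fun hwd (hf i), pd_cutoff, smul_add]
    have e1 : flux u i x = (1 / √(1 - ‖x‖ ^ 2)) • grad u x i := by rw [grad_eq u hx, flux]
    have e2 : pd i w x * flux u i x = (1 / √(1 - ‖x‖ ^ 2)) • (pd i w x * grad u x i) := by
      rw [e1, mul_smul_comm]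
    have e5 : w x * x i • flux u i x = x i • (w x * flux u i x) := mul_smul_comm _ _ _
    rw [e2, neg_smul, ← sub_eq_add_neg, e5,
      smul_smul (2 * k * deriv Real.smoothTransition (k * (1 - ‖x‖ ^ 2) - 1))]
    congr 2
    ring
  have e3 : laplaceBeltrami u x = √(1 - ‖x‖ ^ 2) • ∑ i, pd i (flux u i) x :=
    laplaceBeltrami_eq_flux u hx
  have e4 : ∑ i, pd i (flux u i) x = (1 / √(1 - ‖x‖ ^ 2)) • laplaceBeltrami u x := by
    rw [e3, smul_smul, one_div_mul_cancel hs, one_smul]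
  rw [Finset.sum_congr rfl fun i _ => hpd i, Finset.sum_sub_distrib, Finset.sum_add_distrib,
    ← Finset.smul_sum, ← Finset.smul_sum, ← Finset.smul_sum, ← Finset.smul_sum, ← Finset.mul_sum,
    ← Finset.mul_sum, sum_mul_flux u hx, e4, smul_sub, smul_add, mul_smul_comm, mul_smul_comm,
    smul_add, smul_smul, smul_smul, smul_smul, smul_smul, smul_smul, smul_smul, cutoffSlope]
  congr 2
  · rw [mul_comm]
  · rw [mul_comm]
  · rw [one_div_mul_eq_div, eq_div_iff hs, mul_assoc, Real.mul_self_sqrt h0.le]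
    ring

lemma integral_cutoff_eq_zero (hw : ContDiffOn ℝ 1 w (ball n)) (hu : IsC2b u) (k : ℕ) :
    ∫ x, (cutoff k x • (w x * laplaceBeltrami u x + ∑ i, pd i w x * grad u x i) -
        (2 * cutoffSlope (k * (1 - ‖x‖ ^ 2))) • (w x * radial u x)) ∂muBall n = 0 := by
  have hc : ∀ i, HasCompactSupport fun x => cutoff k x • (w x * flux u i x) := fun i => by
    refine HasCompactSupport.intro (isCompact_closedBall (0 : E n) 1) fun x hx => ?_
    have hx' : x ∉ ball n := fun h => hx (Metric.ball_subset_closedBall h)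
    rw [(cutoff_eventually_zero k hx').self_of_nhds, zero_smul]
  have hd := contDiff_cutoff_flux hw hu k
  have hint : ∀ i, Integrable (pd i fun x => cutoff k x • (w x * flux u i x)) volume := fun i =>
    (((hd i).continuous_fderiv (by norm_num)).clm_apply
      continuous_const).integrable_of_hasCompactSupport ((hc i).fderiv_apply (𝕜 := ℝ) _)
  have h1 : ∫ x, ∑ i, pd i (fun x => cutoff k x • (w x * flux u i x)) x = 0 := by
    rw [integral_finsetSum _ fun i _ => hint i]
    exact Finset.sum_eq_zero fun i _ => integral_pd_eq_zero (hd i) (hc i) i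
  have h2 : ∫ x in ball n, ∑ i, pd i (fun x => cutoff k x • (w x * flux u i x)) x =
      ∫ x, ∑ i, pd i (fun x => cutoff k x • (w x * flux u i x)) x := by
    refine setIntegral_eq_integral_of_forall_compl_eq_zero fun x hx => ?_
    refine Finset.sum_eq_zero fun i _ => ?_
    have : (fun x => cutoff k x • (w x * flux u i x)) =ᶠ[𝓝 x] fun _ => 0 := by
      filter_upwards [cutoff_eventually_zero k hx] with y hy
      rw [hy, zero_smul]
    simp [pd, this.fderiv_eq]
  rw [integral_muBall, ← h1, ← h2]
  exact setIntegral_congr_fun isOpen_ball.measurableSet fun x hx =>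
    (sum_pd_cutoff_flux hw hu k hx).symm

lemma continuousOn_pd (hw : ContDiffOn ℝ 1 w (ball n)) (i : Fin n) :
    ContinuousOn (pd i w) (ball n) :=
  continuousOn_of_contDiffAt fun _ hx =>
    contDiffAt_pd (hw.contDiffAt (isOpen_ball.mem_nhds hx)) (by norm_num) i

lemma continuousOn_radial (hw : ContDiffOn ℝ 1 w (ball n)) : ContinuousOn (radial w) (ball n) :=
  continuousOn_finsetSum _ fun j _ => ContinuousOn.smul (by fun_prop) (continuousOn_pd hw j)

lemma continuousOn_grad (hw : ContDiffOn ℝ 1 w (ball n)) (i : Fin n) :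
    ContinuousOn (fun x => grad w x i) (ball n) := by
  refine ContinuousOn.congr (f := fun x => pd i w x - x i • radial w x) ?_
    fun x hx => grad_eq w hx i
  exact (continuousOn_pd hw i).sub (ContinuousOn.smul (by fun_prop) (continuousOn_radial hw))

lemma integrable_mul_of_bound {f g : E n → 𝕜} (hf : Integrable f (muBall n))
    (hg : ContinuousOn g (ball n)) {C : ℝ} (hC : ∀ x ∈ ball n, ‖g x‖ ≤ C) :
    Integrable (fun x => f x * g x) (muBall n) :=
  hf.mul_bdd (c := C) (aestronglyMeasurable_of_continuousOn hg)
    (by filter_upwards [ae_mem_ball'] with x hx using hC x hx)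

/-- **Green's formula** for a bounded `C²` function and a `C¹` function without any condition at
the boundary of the ball. -/
lemma integral_mul_laplaceBeltrami (hw : ContDiffOn ℝ 1 w (ball n)) (hu : IsC2b u)
    (hwi : Integrable w (muBall n))
    (hgi : Integrable (fun x => ∑ i, pd i w x * grad u x i) (muBall n)) :
    ∫ x, w x * laplaceBeltrami u x ∂muBall n =
      -∫ x, ∑ i, pd i w x * grad u x i ∂muBall n := by
  obtain ⟨C, hC0, hC⟩ := hu.exists_bound
  obtain ⟨M, hM⟩ := exists_cutoffSlope_bound
  have hM0 : 0 ≤ M := (norm_nonneg _).trans (hM 0)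
  have hu1 : ContDiffOn ℝ 1 u (ball n) := hu.contDiffOn.of_le (by norm_num)
  have hli : Integrable (fun x => w x * laplaceBeltrami u x) (muBall n) :=
    integrable_mul_of_bound hwi hu.continuousOn_laplaceBeltrami fun x hx => (hC x hx).2.2.2
  have hri : Integrable (fun x => w x * radial u x) (muBall n) :=
    integrable_mul_of_bound hwi (continuousOn_radial hu1) fun x hx => (hC x hx).2.2.1
  have hAi := hli.add hgi
  rw [eq_neg_iff_add_eq_zero, ← integral_add hli hgi]
  have hcc : ∀ k : ℕ, Continuous fun x : E n => cutoff k x := fun k =>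
    (contDiff_cutoff k).continuous
  refine tendsto_nhds_unique (tendsto_integral_of_dominated_convergence
    (F := fun k x => cutoff k x • (w x * laplaceBeltrami u x + ∑ i, pd i w x * grad u x i) -
        (2 * cutoffSlope (k * (1 - ‖x‖ ^ 2))) • (w x * radial u x))
    (fun x => ‖w x * laplaceBeltrami u x + ∑ i, pd i w x * grad u x i‖ +
      2 * M * ‖w x * radial u x‖) (fun k => ?_)
    (hAi.norm.add (hri.norm.const_mul (2 * M))) (fun k => ?_) ?_) ?_
  · refine ((hcc k).aestronglyMeasurable.smul hAi.aestronglyMeasurable).sub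
      (AEStronglyMeasurable.smul ?_ hri.aestronglyMeasurable)
    exact (continuous_const.mul (continuous_cutoffSlope.comp (by fun_prop))).aestronglyMeasurable
  · refine Eventually.of_forall fun x => norm_sub_le_of_le ?_ ?_
    · rw [norm_smul]
      refine mul_le_of_le_one_left (norm_nonneg _) ?_
      rw [cutoff, Real.norm_of_nonneg (Real.smoothTransition.nonneg _)]
      exact Real.smoothTransition.le_one _
    · rw [norm_smul, norm_mul, Real.norm_ofNat]
      gcongr
      exact hM _
  · filter_upwards [ae_mem_ball'] with x hx
    have h0 := one_sub_norm_sq_pos hx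
    -- At a fixed point of the ball, as soon as k (1 - |x|²) > 2 the cutoff equals 1 and its slope
    -- term is 0, so the sequence is eventually constant.
    refine tendsto_const_nhds.congr' ?_
    have : Tendsto (fun k : ℕ => (k : ℝ) * (1 - ‖x‖ ^ 2)) atTop atTop :=
      tendsto_natCast_atTop_atTop.atTop_mul_const h0
    filter_upwards [this.eventually_gt_atTop 2] with k hk
    rw [cutoffSlope_eq_zero fun h => absurd h.2 (not_le.2 hk), mul_zero, zero_smul, sub_zero, cutoff,
      Real.smoothTransition.one_of_one_le (by linarith), one_smul]
  · simp only [integral_cutoff_eq_zero hw hu]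
    exact tendsto_const_nhds

end Green

/-! ### Symmetry of the Laplace-Beltrami operator -/

section Symmetry

variable {𝕜 : Type*} [RCLike 𝕜] {n : ℕ}

lemma integrable_of_bound {f : E n → 𝕜} (hf : ContinuousOn f (ball n)) {C : ℝ}
    (hC : ∀ x ∈ ball n, ‖f x‖ ≤ C) : Integrable f (muBall n) :=
  Integrable.of_bound (aestronglyMeasurable_of_continuousOn hf) C
    (by filter_upwards [ae_mem_ball'] with x hx using hC x hx)

lemma IsC2b.contDiffOn_one {u : E n → 𝕜} (hu : IsC2b u) : ContDiffOn ℝ 1 u (ball n) :=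
  hu.contDiffOn.of_le (by norm_num)

lemma IsC2b.exists_grad_bound {u : E n → 𝕜} (hu : IsC2b u) :
    ∃ C : ℝ, 0 ≤ C ∧ ∀ x ∈ ball n, ∀ i, ‖grad u x i‖ ≤ C := by
  obtain ⟨C, hC0, hC⟩ := hu.exists_bound
  refine ⟨C + C, by positivity, fun x hx i => ?_⟩
  rw [grad_eq u hx]
  refine norm_sub_le_of_le ((hC x hx).2.1 i) ?_
  rw [norm_smul]
  exact (mul_le_of_le_one_left (norm_nonneg _) (abs_coord_le_one hx i)).trans (hC x hx).2.2.1

lemma IsC2b.integrable {u : E n → 𝕜} (hu : IsC2b u) : Integrable u (muBall n) := by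
  obtain ⟨C, -, hC⟩ := hu.exists_bound
  exact integrable_of_bound hu.contDiffOn.continuousOn fun x hx => (hC x hx).1

lemma IsC2b.integrable_pd_mul_grad {w u : E n → 𝕜} (hw : IsC2b w) (hu : IsC2b u) :
    Integrable (fun x => ∑ i, pd i w x * grad u x i) (muBall n) := by
  obtain ⟨C, hC0, hC⟩ := hw.exists_bound
  obtain ⟨D, hD0, hD⟩ := hu.exists_grad_bound
  refine integrable_finsetSum _ fun i _ => integrable_of_bound (C := C * D)
    ((continuousOn_pd hw.contDiffOn_one i).mul (continuousOn_grad hu.contDiffOn_one i))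
    fun x hx => ?_
  rw [norm_mul]
  exact mul_le_mul ((hC x hx).2.1 i) (hD x hx i) (norm_nonneg _) hC0

lemma sum_pd_mul_grad (w u : E n → 𝕜) {x : E n} (hx : x ∈ ball n) :
    ∑ i, pd i w x * grad u x i = ∑ i, pd i w x * pd i u x - radial w x * radial u x := by
  have h : ∀ i, pd i w x * grad u x i = pd i w x * pd i u x - (x i • pd i w x) * radial u x := by
    intro i
    rw [grad_eq u hx, mul_sub, mul_smul_comm, smul_mul_assoc]
  rw [Finset.sum_congr rfl fun i _ => h i, Finset.sum_sub_distrib, ← Finset.sum_mul]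
  rfl

lemma sum_pd_mul_grad_comm (w u : E n → 𝕜) {x : E n} (hx : x ∈ ball n) :
    ∑ i, pd i w x * grad u x i = ∑ i, pd i u x * grad w x i := by
  rw [sum_pd_mul_grad w u hx, sum_pd_mul_grad u w hx]
  simp only [mul_comm]

lemma integral_mul_laplaceBeltrami_comm {w u : E n → 𝕜} (hw : IsC2b w) (hu : IsC2b u) :
    ∫ x, w x * laplaceBeltrami u x ∂muBall n = ∫ x, u x * laplaceBeltrami w x ∂muBall n := by
  rw [integral_mul_laplaceBeltrami hw.contDiffOn_one hu hw.integrable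
    (hw.integrable_pd_mul_grad hu), integral_mul_laplaceBeltrami hu.contDiffOn_one hw
    hu.integrable (hu.integrable_pd_mul_grad hw)]
  congr 1
  refine integral_congr_ae ?_
  filter_upwards [ae_mem_ball'] with x hx using sum_pd_mul_grad_comm w u hx

end Symmetry

/-! ### Polynomials on the ball -/

section PolynomialFunctions

open MvPolynomial

variable {𝕜 : Type*} [RCLike 𝕜] {n : ℕ}

/-- The function on the ambient space defined by a real polynomial. -/
def polyFun (𝕜 : Type*) [RCLike 𝕜] (p : MvPolynomial (Fin n) ℝ) (x : E n) : 𝕜 :=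
  ((eval (fun i => x i) p : ℝ) : 𝕜)

lemma polyFun_real (p : MvPolynomial (Fin n) ℝ) (x : E n) :
    polyFun ℝ p x = eval (fun i => x i) p := rfl

lemma polyFun_eq_ofReal (p : MvPolynomial (Fin n) ℝ) (x : E n) :
    polyFun 𝕜 p x = ((polyFun ℝ p x : ℝ) : 𝕜) := rfl

lemma polyFun_add (p q : MvPolynomial (Fin n) ℝ) (x : E n) :
    polyFun 𝕜 (p + q) x = polyFun 𝕜 p x + polyFun 𝕜 q x := by simp [polyFun]

lemma contDiff_polyFun_real (p : MvPolynomial (Fin n) ℝ) {m : WithTop ℕ∞} :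
    ContDiff ℝ m (polyFun ℝ p) := by
  induction p using MvPolynomial.induction_on with
  | C a =>
    have : polyFun ℝ (C a) = fun _ : E n => a := by funext x; simp [polyFun]
    rw [this]; exact contDiff_const
  | add p q hp hq =>
    have : polyFun ℝ (p + q) = fun x : E n => polyFun ℝ p x + polyFun ℝ q x := by
      funext x; simp [polyFun]
    rw [this]; exact hp.add hq
  | mul_X p i hp =>
    have : polyFun ℝ (p * X i) = fun x : E n => polyFun ℝ p x * x i := by
      funext x; simp [polyFun]
    rw [this]; exact hp.mul (by fun_prop)

lemma contDiff_polyFun (p : MvPolynomial (Fin n) ℝ) {m : WithTop ℕ∞} :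
    ContDiff ℝ m (polyFun 𝕜 p) :=
  (RCLike.ofRealCLM (K := 𝕜)).contDiff.comp (contDiff_polyFun_real p)

lemma pd_ofReal {f : E n → ℝ} {x : E n} (hf : DifferentiableAt ℝ f x) (i : Fin n) :
    pd i (fun y => (f y : 𝕜)) x = ((pd i f x : ℝ) : 𝕜) := by
  have h := (RCLike.ofRealCLM (K := 𝕜)).hasFDerivAt.comp x hf.hasFDerivAt
  have h2 : fderiv ℝ (fun y => (f y : 𝕜)) x = _ := h.fderiv
  rw [pd, h2]
  simp [pd]

lemma pd_polyFun_real (p : MvPolynomial (Fin n) ℝ) (i : Fin n) (x : E n) :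
    pd i (polyFun ℝ p) x = polyFun ℝ (pderiv i p) x := by
  have hd : ∀ p : MvPolynomial (Fin n) ℝ, DifferentiableAt ℝ (polyFun ℝ p) x := fun p =>
    (contDiff_polyFun_real p (m := 1)).differentiable (by norm_num) x
  induction p using MvPolynomial.induction_on with
  | C a =>
    have : polyFun ℝ (C a) = fun _ : E n => a := by funext x; simp [polyFun]
    rw [this]; simp [pd, polyFun]
  | add p q hp hq =>
    have : polyFun ℝ (p + q) = fun x : E n => polyFun ℝ p x + polyFun ℝ q x := by
      funext x; simp [polyFun]
    rw [this, pd_add (hd p) (hd q), hp, hq]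
    simp [polyFun]
  | mul_X p j hp =>
    have : polyFun ℝ (p * X j) = fun x : E n => polyFun ℝ p x * x j := by
      funext x; simp [polyFun]
    rw [this, pd_mul_fun (hd p) (by fun_prop), hp, pd_coord, polyFun, Derivation.leibniz, pderiv_X]
    rcases eq_or_ne i j with rfl | h
    · simp [polyFun, mul_comm]
    · simp [polyFun, h, h.symm, mul_comm]

lemma pd_polyFun (p : MvPolynomial (Fin n) ℝ) (i : Fin n) :
    pd i (polyFun 𝕜 p) = polyFun 𝕜 (pderiv i p) := by
  funext x
  rw [polyFun_eq_ofReal, ← pd_polyFun_real]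
  exact pd_ofReal ((contDiff_polyFun_real p (m := 1)).differentiable (by norm_num) x) i

lemma exists_bound_polyFun (p : MvPolynomial (Fin n) ℝ) :
    ∃ C : ℝ, 0 ≤ C ∧ ∀ x ∈ ball n, ‖polyFun 𝕜 p x‖ ≤ C := by
  obtain ⟨C, hC⟩ := (isCompact_closedBall (0 : E n) 1).exists_bound_of_continuousOn
    (contDiff_polyFun (𝕜 := 𝕜) p (m := 0)).continuous.continuousOn
  refine ⟨C, (norm_nonneg _).trans (hC 0 (by simp)), fun x hx =>
    hC x (Metric.ball_subset_closedBall hx)⟩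

lemma isC2b_polyFun (p : MvPolynomial (Fin n) ℝ) : IsC2b (polyFun 𝕜 p) := by
  refine ⟨(contDiff_polyFun p).contDiffOn, ?_⟩
  simp only [pd_polyFun]
  choose C h0 hC using fun p : MvPolynomial (Fin n) ℝ => exists_bound_polyFun (𝕜 := 𝕜) p
  have h1 : 0 ≤ ∑ i, C (pderiv i p) := Finset.sum_nonneg fun i _ => h0 _
  have h2 : 0 ≤ ∑ i, ∑ j, C (pderiv i (pderiv j p)) :=
    Finset.sum_nonneg fun i _ => Finset.sum_nonneg fun j _ => h0 _
  have h3 := h0 p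
  refine ⟨C p + ∑ i, C (pderiv i p) + ∑ i, ∑ j, C (pderiv i (pderiv j p)), fun x hx =>
    ⟨(hC p x hx).trans (by linarith), fun i => (hC _ x hx).trans ?_, fun i j =>
    (hC _ x hx).trans ?_⟩⟩
  · have := Finset.single_le_sum (f := fun i => C (pderiv i p)) (fun i _ => h0 _)
      (Finset.mem_univ i)
    linarith
  · have e1 := Finset.single_le_sum (f := fun j => C (pderiv i (pderiv j p))) (fun j _ => h0 _)
      (Finset.mem_univ j)
    have e2 := Finset.single_le_sum (f := fun i => ∑ j, C (pderiv i (pderiv j p)))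
      (fun i _ => Finset.sum_nonneg fun j _ => h0 _) (Finset.mem_univ i)
    linarith

/-- The Laplace-Beltrami operator on polynomials. -/
def lapPoly (n : ℕ) : MvPolynomial (Fin n) ℝ →ₗ[ℝ] MvPolynomial (Fin n) ℝ :=
  ∑ i, (pderiv i).toLinearMap ∘ₗ (pderiv i).toLinearMap -
    ∑ i, ∑ j, LinearMap.mulLeft ℝ (X i * X j) ∘ₗ (pderiv i).toLinearMap ∘ₗ (pderiv j).toLinearMap -
    (n : ℝ) • ∑ j, LinearMap.mulLeft ℝ (X j) ∘ₗ (pderiv j).toLinearMap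

lemma lapPoly_apply (p : MvPolynomial (Fin n) ℝ) : lapPoly n p = ∑ i, pderiv i (pderiv i p) -
    ∑ i, ∑ j, X i * X j * pderiv i (pderiv j p) - (n : ℝ) • ∑ j, X j * pderiv j p := by
  simp [lapPoly, LinearMap.sum_apply, mul_assoc]

lemma laplaceBeltrami_polyFun (p : MvPolynomial (Fin n) ℝ) {x : E n} (hx : x ∈ ball n) :
    laplaceBeltrami (polyFun 𝕜 p) x = polyFun 𝕜 (lapPoly n p) x := by
  rw [laplaceBeltrami_eq (contDiff_polyFun p).contDiffAt hx, lapPoly_apply]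
  simp only [pd_polyFun, radial, polyFun, map_sub, map_sum, map_mul, eval_X, smul_eval,
    RCLike.real_smul_eq_coe_mul]

/-- Euler's identity, once and twice, turns the degree-preserving terms on a homogeneous polynomial
of degree d into the scalar -(d(d - 1) + n d) = -d(d + n - 1). Only the flat Laplacian, which lowers
the degree by two, is left. -/
lemma lapPoly_monomial (d : Fin n →₀ ℕ) (c : ℝ) :
    lapPoly n (monomial d c) + C (lam n d.degree) * monomial d c =
      ∑ i, pderiv i (pderiv i (monomial d c)) := by
  have hm : (monomial d c).IsHomogeneous d.degree := isHomogeneous_monomial c rfl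
  have h1 := hm.sum_X_mul_pderiv
  have h2 : ∑ i, ∑ j, X i * X j * pderiv i (pderiv j (monomial d c)) =
      (d.degree - 1) • (d.degree • monomial d c) := by
    rw [Finset.sum_comm, ← h1, Finset.smul_sum]
    refine Finset.sum_congr rfl fun j _ => ?_
    rw [← mul_smul_comm, ← (hm.pderiv (i := j)).sum_X_mul_pderiv, Finset.mul_sum]
    exact Finset.sum_congr rfl fun i _ => by ring
  rw [lapPoly_apply, h1, h2, lam]
  -- The difference d - 1 is a truncated one, so degree zero is treated apart.
  rcases d.degree with _ | k
  · simp
  · simp only [Nat.add_sub_cancel, nsmul_eq_mul, smul_eq_C_mul, map_mul, map_add, map_sub, map_one,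
      map_natCast]
    push_cast
    ring

lemma totalDegree_lapPoly_add {p : MvPolynomial (Fin n) ℝ} {s : ℕ} (hp : p.totalDegree ≤ s + 1) :
    (lapPoly n p + C (lam n (s + 1)) * p).totalDegree ≤ s := by
  have hsum : lapPoly n p + C (lam n (s + 1)) * p = ∑ d ∈ p.support,
      (lapPoly n (monomial d (coeff d p)) + C (lam n (s + 1)) * monomial d (coeff d p)) := by
    conv_lhs => rw [p.as_sum]
    rw [map_sum, Finset.mul_sum, ← Finset.sum_add_distrib]
  rw [hsum]
  refine totalDegree_finsetSum_le fun d hd => ?_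
  have hdeg : d.degree ≤ s + 1 := by
    refine le_trans ?_ hp
    rw [Finsupp.degree_eq_sum]
    have := le_totalDegree hd
    rwa [Finsupp.sum_fintype _ _ (fun _ => rfl)] at this
  have hm : (monomial d (coeff d p)).IsHomogeneous d.degree := isHomogeneous_monomial _ rfl
  have e : lapPoly n (monomial d (coeff d p)) + C (lam n (s + 1)) * monomial d (coeff d p) =
      ∑ i, pderiv i (pderiv i (monomial d (coeff d p))) +
        C (lam n (s + 1) - lam n d.degree) * monomial d (coeff d p) := by
    rw [← lapPoly_monomial, C_sub]; ring
  rw [e]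
  refine (totalDegree_add _ _).trans (max_le ?_ ?_)
  · refine totalDegree_finsetSum_le fun i _ => ?_
    exact (hm.pderiv.pderiv.totalDegree_le).trans (by omega)
  · rcases Nat.eq_or_lt_of_le hdeg with h | h
    · simp [h]
    · refine (totalDegree_mul _ _).trans ?_
      rw [totalDegree_C, zero_add]
      exact hm.totalDegree_le.trans (by omega)

lemma lapPoly_of_totalDegree_eq_zero {p : MvPolynomial (Fin n) ℝ} (hp : p.totalDegree = 0) :
    lapPoly n p = 0 := by
  rw [totalDegree_eq_zero_iff_eq_C.1 hp, lapPoly_apply]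
  simp

lemma totalDegree_lapPoly_le {p : MvPolynomial (Fin n) ℝ} {s : ℕ} (hp : p.totalDegree ≤ s) :
    (lapPoly n p).totalDegree ≤ s := by
  rcases s with _ | s
  · rw [lapPoly_of_totalDegree_eq_zero (Nat.le_zero.1 hp)]; simp
  · have h : lapPoly n p = (lapPoly n p + C (lam n (s + 1)) * p) - C (lam n (s + 1)) * p := by ring
    rw [h]
    refine (totalDegree_sub _ _).trans (max_le ((totalDegree_lapPoly_add hp).trans (by omega)) ?_)
    refine (totalDegree_mul _ _).trans ?_
    rw [totalDegree_C, zero_add]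
    exact hp

lemma integrable_polyFun_mul (p q : MvPolynomial (Fin n) ℝ) :
    Integrable (fun x => polyFun ℝ p x * polyFun ℝ q x) (muBall n) := by
  have h : (fun x : E n => polyFun ℝ p x * polyFun ℝ q x) = polyFun ℝ (p * q) := by
    funext x; simp [polyFun]
  rw [h]
  obtain ⟨C, -, hC⟩ := exists_bound_polyFun (𝕜 := ℝ) (p * q)
  refine Integrable.of_bound
    (aestronglyMeasurable_of_continuousOn (contDiff_polyFun _ (m := 0)).continuous.continuousOn) C ?_
  filter_upwards [ae_mem_ball'] with x hx using hC x hx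

/-- The inner product with a polynomial, as a linear functional on polynomials. -/
def polyInner (p : MvPolynomial (Fin n) ℝ) : MvPolynomial (Fin n) ℝ →ₗ[ℝ] ℝ where
  toFun q := ∫ x, polyFun ℝ p x * polyFun ℝ q x ∂muBall n
  map_add' q r := by
    rw [← integral_add (integrable_polyFun_mul p q) (integrable_polyFun_mul p r)]
    simp only [polyFun_add, mul_add]
  map_smul' c q := by
    rw [RingHom.id_apply, smul_eq_mul, ← integral_const_mul]
    refine integral_congr_ae (Eventually.of_forall fun x => ?_)
    simp [polyFun, mul_left_comm]

lemma polyInner_apply (p q : MvPolynomial (Fin n) ℝ) :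
    polyInner p q = ∫ x, polyFun ℝ p x * polyFun ℝ q x ∂muBall n := rfl

lemma polyInner_comm (p q : MvPolynomial (Fin n) ℝ) : polyInner p q = polyInner q p := by
  simp only [polyInner_apply, mul_comm]

lemma polyInner_phiPoly (α β : Fin n → ℕ) :
    polyInner (phiPoly α) (phiPoly β) = if α = β then 1 else 0 := by
  rw [← integral_phi_mul, polyInner_apply]
  refine integral_congr_ae ?_
  filter_upwards [ae_mem_ball'] with x hx
  rw [phi_eq_eval α hx, phi_eq_eval β hx, polyFun_real, polyFun_real]

/-- The φ_α with |α| ≤ s are orthonormal, hence independent, and their indices are those of the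
monomials of degree at most s. A dimension count makes them a basis. -/
lemma mem_span_phiPoly {s : ℕ} {p : MvPolynomial (Fin n) ℝ} (hp : p.totalDegree ≤ s) :
    p ∈ Submodule.span ℝ (phiPoly '' {α : Fin n → ℕ | ∑ i, α i ≤ s}) := by
  let S : Set (Fin n →₀ ℕ) := {d | (d.sum fun _ e => e) ≤ s}
  have hS : ∀ d, d ∈ S ↔ ∑ i, d i ≤ s := fun d => by
    change (d.sum fun _ e => e) ≤ s ↔ _
    rw [Finsupp.sum_fintype _ _ (fun _ => rfl)]
  let b : Module.Basis S ℝ (restrictTotalDegree (Fin n) ℝ s) := basisRestrictSupport ℝ S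
  have hfd : Module.Finite ℝ (restrictTotalDegree (Fin n) ℝ s) := inferInstance
  have : Finite S := Module.Finite.finite_basis b
  have : Fintype S := Fintype.ofFinite S
  let v : S → restrictTotalDegree (Fin n) ℝ s := fun d => ⟨phiPoly (d : Fin n →₀ ℕ), by
    rw [mem_restrictTotalDegree, totalDegree_phiPoly]; exact (hS _).1 d.2⟩
  have hli : LinearIndependent ℝ v := by
    refine LinearIndependent.of_comp (Submodule.subtype _) ?_
    rw [Fintype.linearIndependent_iff]
    intro g hg d
    have h := congrArg (polyInner (phiPoly (d : Fin n →₀ ℕ))) hg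
    rw [map_zero, map_sum, Finset.sum_eq_single d] at h
    · simpa [v, polyInner_phiPoly] using h
    · intro d' _ hd'
      have : ¬((d : Fin n →₀ ℕ) : Fin n → ℕ) = (d' : Fin n →₀ ℕ) := fun h =>
        hd' (Subtype.ext (DFunLike.coe_injective h).symm)
      simp [v, polyInner_phiPoly, this]
    · simp
  have htop := hli.span_eq_top_of_card_eq_finrank' (Module.finrank_eq_card_basis b).symm
  have hmem : (⟨p, (mem_restrictTotalDegree _ _ _).2 hp⟩ : restrictTotalDegree (Fin n) ℝ s) ∈
      Submodule.span ℝ (Set.range v) := by rw [htop]; trivial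
  have h2 := Submodule.mem_map_of_mem (f := Submodule.subtype _) hmem
  rw [Submodule.map_span] at h2
  refine Submodule.span_mono ?_ h2
  rintro _ ⟨_, ⟨d, rfl⟩, rfl⟩
  exact ⟨_, (hS _).1 d.2, rfl⟩

lemma polyInner_phiPoly_eq_zero {α : Fin n → ℕ} {s : ℕ} (hs : s < ∑ i, α i)
    {p : MvPolynomial (Fin n) ℝ} (hp : p.totalDegree ≤ s) : polyInner (phiPoly α) p = 0 := by
  have h : Submodule.span ℝ (phiPoly '' {α : Fin n → ℕ | ∑ i, α i ≤ s}) ≤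
      LinearMap.ker (polyInner (phiPoly α)) := by
    rw [Submodule.span_le]
    rintro _ ⟨β, hβ, rfl⟩
    rw [SetLike.mem_coe, LinearMap.mem_ker, polyInner_phiPoly, if_neg]
    rintro rfl
    exact absurd hs (not_lt.2 hβ)
  exact h (mem_span_phiPoly hp)

lemma polyInner_lapPoly (p q : MvPolynomial (Fin n) ℝ) :
    polyInner p (lapPoly n q) = polyInner q (lapPoly n p) := by
  have h := integral_mul_laplaceBeltrami_comm (isC2b_polyFun (𝕜 := ℝ) p) (isC2b_polyFun q)
  rw [polyInner_apply, polyInner_apply]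
  refine (integral_congr_ae ?_).trans (h.trans (integral_congr_ae ?_)) <;>
  · filter_upwards [ae_mem_ball'] with x hx
    rw [laplaceBeltrami_polyFun _ hx]

/-- The defect q = Δφ_α + λφ_α has degree below |α|, because the leading parts cancel. Since Δ is
symmetric and does not raise degrees, q is orthogonal to every polynomial of degree below |α|, hence
to itself. -/
lemma eval_lapPoly_phiPoly (α : Fin n → ℕ) : ∀ᵐ x ∂muBall n,
    polyFun ℝ (lapPoly n (phiPoly α)) x = -(lam n (∑ i, α i) * polyFun ℝ (phiPoly α) x) := by
  set q := lapPoly n (phiPoly α) + C (lam n (∑ i, α i)) * phiPoly α with hq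
  have hdeg := totalDegree_phiPoly α
  have hq0 : polyInner q q = 0 := by
    -- For |α| = 0 there is no lower degree; the polynomial is constant and λ_0 = 0.
    rcases hs : ∑ i, α i with _ | s
    · have : q = 0 := by
        rw [hq, hs, lapPoly_of_totalDegree_eq_zero (hdeg.trans hs)]
        simp [lam]
      rw [this, map_zero]
    · have hqd : q.totalDegree ≤ s := by
        rw [hq, hs]; exact totalDegree_lapPoly_add (by rw [hdeg, hs])
      have h : Submodule.span ℝ (phiPoly '' {β : Fin n → ℕ | ∑ i, β i ≤ s}) ≤
          LinearMap.ker (polyInner q) := by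
        rw [Submodule.span_le]
        rintro _ ⟨β, hβ, rfl⟩
        have hlt : s < ∑ i, α i := by omega
        have hdβ : (phiPoly β).totalDegree ≤ s := by rw [totalDegree_phiPoly]; exact hβ
        rw [SetLike.mem_coe, LinearMap.mem_ker, polyInner_comm, hq, map_add, polyInner_lapPoly,
          polyInner_phiPoly_eq_zero hlt (totalDegree_lapPoly_le hdβ), ← smul_eq_C_mul, map_smul,
          polyInner_comm, polyInner_phiPoly_eq_zero hlt hdβ, smul_zero, add_zero]
      exact h (mem_span_phiPoly hqd)
  rw [polyInner_apply, integral_eq_zero_iff_of_nonneg (fun x => mul_self_nonneg _)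
    (integrable_polyFun_mul q q)] at hq0
  filter_upwards [hq0] with x hx
  have hx' : polyFun ℝ q x = 0 := by simpa using hx
  rw [hq, polyFun_add] at hx'
  rw [eq_neg_iff_add_eq_zero, ← hx']
  simp [polyFun]

end PolynomialFunctions

/-! ### The operator in the Hilbert basis of polynomials -/

section Basis

variable {𝕜 : Type*} [RCLike 𝕜] {n : ℕ}

lemma pd_conj (u : E n → 𝕜) (i : Fin n) :
    pd i (fun y => conj (u y)) = fun x => conj (pd i u x) := by
  funext x
  have h := (RCLike.conjCLE (K := 𝕜)).comp_fderiv (f := u) (x := x)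
  have h2 : fderiv ℝ (fun y => conj (u y)) x = _ := h
  rw [pd, h2]
  rfl

/-- The coefficients of Δ are real. This passes from the bilinear Green formula to the hermitian
inner product. -/
lemma laplaceBeltrami_conj (u : E n → 𝕜) (x : E n) :
    laplaceBeltrami (fun y => conj (u y)) x = conj (laplaceBeltrami u x) := by
  have h : ∀ i, (fun y => √(G n y).det • grad (fun y => conj (u y)) y i) =
      fun y => conj (√(G n y).det • grad u y i) := by
    intro i
    funext y
    simp only [grad, pd_conj, RCLike.real_smul_eq_coe_mul, map_mul, map_sum, RCLike.conj_ofReal]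
  simp only [laplaceBeltrami, h, pd_conj]
  simp only [RCLike.real_smul_eq_coe_mul, map_mul, map_sum, RCLike.conj_ofReal]

lemma IsC2b.conj {u : E n → 𝕜} (hu : IsC2b u) : IsC2b fun y => conj (u y) := by
  refine ⟨(RCLike.conjCLE (K := 𝕜)).contDiff.comp_contDiffOn hu.contDiffOn, ?_⟩
  obtain ⟨C, hC⟩ := hu.bdd
  refine ⟨C, fun x hx => ?_⟩
  simpa only [pd_conj, RCLike.norm_conj] using hC x hx

lemma memLp_of_bound {f : E n → 𝕜} (hf : ContinuousOn f (ball n)) {C : ℝ}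
    (hC : ∀ x ∈ ball n, ‖f x‖ ≤ C) {p : ℝ≥0∞} : MemLp f p (volG n) := by
  rw [volG_eq_muBall]
  exact MemLp.of_bound (aestronglyMeasurable_of_continuousOn hf) C
    (by filter_upwards [ae_mem_ball'] with x hx using hC x hx)

lemma IsC2b.memLp {u : E n → 𝕜} (hu : IsC2b u) : MemLp u 2 (volG n) := by
  obtain ⟨C, -, hC⟩ := hu.exists_bound
  exact memLp_of_bound hu.contDiffOn.continuousOn fun x hx => (hC x hx).1

lemma IsC2b.memLp_laplaceBeltrami {u : E n → 𝕜} (hu : IsC2b u) :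
    MemLp (laplaceBeltrami u) 2 (volG n) := by
  obtain ⟨C, -, hC⟩ := hu.exists_bound
  exact memLp_of_bound hu.continuousOn_laplaceBeltrami fun x hx => (hC x hx).2.2.2

lemma negLaplaceGraph_inner {p q : L2 𝕜 n × L2 𝕜 n} (hp : p ∈ negLaplaceGraph 𝕜 n)
    (hq : q ∈ negLaplaceGraph 𝕜 n) : ⟪p.2, q.1⟫_𝕜 = ⟪p.1, q.2⟫_𝕜 := by
  obtain ⟨u, hu, hp1, hp2⟩ := hp
  obtain ⟨v, hv, hq1, hq2⟩ := hq
  have h := integral_mul_laplaceBeltrami_comm hv hu.conj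
  rw [← volG_eq_muBall] at h
  rw [L2.inner_def, L2.inner_def]
  have h1 : ∫ x, ⟪p.2 x, q.1 x⟫_𝕜 ∂volG n =
      -∫ x, v x * laplaceBeltrami (fun y => (starRingEnd 𝕜) (u y)) x ∂volG n := by
    rw [← integral_neg]
    refine integral_congr_ae ?_
    filter_upwards [hp2, hq1] with x e1 e2
    rw [e1, e2, RCLike.inner_apply, laplaceBeltrami_conj, map_neg, mul_neg]
  have h2 : ∫ x, ⟪p.1 x, q.2 x⟫_𝕜 ∂volG n =
      -∫ x, (starRingEnd 𝕜) (u x) * laplaceBeltrami v x ∂volG n := by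
    rw [← integral_neg]
    refine integral_congr_ae ?_
    filter_upwards [hp1, hq2] with x e1 e2
    rw [e1, e2, RCLike.inner_apply, neg_mul, mul_comm]
  rw [h1, h2, h]

/-- The class of a real polynomial in the space of square integrable functions. -/
def polyL2 (𝕜 : Type*) [RCLike 𝕜] (p : MvPolynomial (Fin n) ℝ) : L2 𝕜 n :=
  (isC2b_polyFun (𝕜 := 𝕜) p).memLp.toLp _

lemma coeFn_polyL2 (p : MvPolynomial (Fin n) ℝ) : polyL2 𝕜 p =ᵐ[volG n] polyFun 𝕜 p :=
  MemLp.coeFn_toLp _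

lemma polyL2_add (p q : MvPolynomial (Fin n) ℝ) :
    polyL2 𝕜 (p + q) = polyL2 𝕜 p + polyL2 𝕜 q := by
  refine Lp.ext ?_
  filter_upwards [coeFn_polyL2 (𝕜 := 𝕜) (p + q), coeFn_polyL2 (𝕜 := 𝕜) p,
    coeFn_polyL2 (𝕜 := 𝕜) q, Lp.coeFn_add (polyL2 𝕜 p) (polyL2 𝕜 q)] with x h1 h2 h3 h4
  rw [h1, h4, Pi.add_apply, h2, h3, polyFun_add]

lemma polyL2_smul (c : ℝ) (p : MvPolynomial (Fin n) ℝ) :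
    polyL2 𝕜 (c • p) = (c : 𝕜) • polyL2 𝕜 p := by
  refine Lp.ext ?_
  filter_upwards [coeFn_polyL2 (𝕜 := 𝕜) (c • p), coeFn_polyL2 (𝕜 := 𝕜) p,
    Lp.coeFn_smul (c : 𝕜) (polyL2 𝕜 p)] with x h1 h2 h3
  rw [h1, h3, Pi.smul_apply, h2]
  simp [polyFun]

lemma polyL2_zero : polyL2 𝕜 (0 : MvPolynomial (Fin n) ℝ) = 0 := by
  simpa using polyL2_smul (𝕜 := 𝕜) 0 (0 : MvPolynomial (Fin n) ℝ)

lemma inner_polyL2 (p q : MvPolynomial (Fin n) ℝ) :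
    ⟪polyL2 𝕜 p, polyL2 𝕜 q⟫_𝕜 = ((polyInner p q : ℝ) : 𝕜) := by
  rw [L2.inner_def, polyInner_apply, ← integral_ofReal, ← volG_eq_muBall]
  refine integral_congr_ae ?_
  filter_upwards [coeFn_polyL2 (𝕜 := 𝕜) p, coeFn_polyL2 (𝕜 := 𝕜) q] with x h1 h2
  rw [h1, h2, RCLike.inner_apply, polyFun_eq_ofReal (𝕜 := 𝕜) p x,
    polyFun_eq_ofReal (𝕜 := 𝕜) q x, RCLike.conj_ofReal,
    RCLike.ofReal_mul, mul_comm]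

lemma orthonormal_polyL2_phiPoly :
    Orthonormal 𝕜 fun α : Fin n → ℕ => polyL2 𝕜 (phiPoly α) := by
  classical
  rw [orthonormal_iff_ite]
  intro α β
  rw [inner_polyL2, polyInner_phiPoly]
  split_ifs <;> simp

lemma polyL2_mem_span (p : MvPolynomial (Fin n) ℝ) :
    polyL2 𝕜 p ∈ Submodule.span 𝕜 (Set.range fun α : Fin n → ℕ => polyL2 𝕜 (phiPoly α)) := by
  obtain ⟨s, hs⟩ : ∃ s, p.totalDegree ≤ s := ⟨_, le_rfl⟩
  have h := mem_span_phiPoly hs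
  clear hs
  induction h using Submodule.span_induction with
  | mem _ h => obtain ⟨α, -, rfl⟩ := h; exact Submodule.subset_span ⟨α, rfl⟩
  | zero => rw [polyL2_zero]; exact Submodule.zero_mem _
  | add p q _ _ h1 h2 => rw [polyL2_add]; exact Submodule.add_mem _ h1 h2
  | smul c p _ h => rw [polyL2_smul]; exact Submodule.smul_mem _ _ h

/-- Stone-Weierstrass on the compact closed ball: the algebra generated by the coordinates separates
points. -/
lemma exists_polyFun_near (f : C(E n, ℝ)) {ε : ℝ} (hε : 0 < ε) :
    ∃ p : MvPolynomial (Fin n) ℝ, ∀ x ∈ ball n, |polyFun ℝ p x - f x| < ε := by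
  let c : Fin n → C(E n, ℝ) := fun i => ⟨fun x => x i, by fun_prop⟩
  have hc : ∀ (p : MvPolynomial (Fin n) ℝ) (x : E n),
      (MvPolynomial.aeval c p : C(E n, ℝ)) x = polyFun ℝ p x := by
    intro p x
    induction p using MvPolynomial.induction_on with
    | C a => simp [polyFun]
    | add p q hp hq => rw [map_add, ContinuousMap.add_apply, hp, hq, polyFun_add]
    | mul_X p i hp =>
      rw [map_mul, ContinuousMap.mul_apply, hp, MvPolynomial.aeval_X]
      simp [polyFun, c]
  have hsep : (MvPolynomial.aeval c : MvPolynomial (Fin n) ℝ →ₐ[ℝ] _).range.SeparatesPoints := by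
    intro x y hxy
    obtain ⟨i, hi⟩ : ∃ i, x i ≠ y i := by
      by_contra! h
      exact hxy (PiLp.ext h)
    refine ⟨c i, ⟨c i, ⟨MvPolynomial.X i, by simp⟩, rfl⟩, hi⟩
  obtain ⟨_, ⟨p, rfl⟩, hp⟩ :=
    ContinuousMap.exists_mem_subalgebra_near_continuous_of_isCompact_of_separatesPoints hsep f
      (isCompact_closedBall (0 : E n) 1) hε
  refine ⟨p, fun x hx => ?_⟩
  have := hp x (Metric.ball_subset_closedBall hx)
  rwa [← hc]

lemma dense_span_polyL2 :
    ⊤ ≤ (Submodule.span 𝕜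
      (Set.range fun α : Fin n → ℕ => polyL2 𝕜 (phiPoly α))).topologicalClosure := by
  set S := Submodule.span 𝕜 (Set.range fun α : Fin n → ℕ => polyL2 𝕜 (phiPoly α)) with hS
  have hd := BoundedContinuousFunction.toLp_denseRange (p := 2) 𝕜 (volG n) 𝕜 (by simp)
  have hsub : Set.range (BoundedContinuousFunction.toLp 2 (volG n) 𝕜 :
      BoundedContinuousFunction (E n) 𝕜 →L[𝕜] L2 𝕜 n) ⊆ S.topologicalClosure := by
    rintro _ ⟨g, rfl⟩
    rw [Submodule.topologicalClosure_coe, Metric.mem_closure_iff]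
    intro ε hε
    set m : ℝ := ((measureUnivNNReal (volG n) ^ (2 : ℝ≥0∞).toReal⁻¹ : NNReal) : ℝ) with hm
    -- Real and imaginary parts are approximated within δ, so the pointwise error is at most 2δ and
    -- the L² error at most 2δm, with m the square root of the total mass; m + 1 keeps the
    -- denominator positive. For real scalars `RCLike.I` is 0 and the second polynomial is harmless.
    set δ : ℝ := ε / (2 * (m + 1)) with hδ
    have hm0 : 0 ≤ m := NNReal.coe_nonneg _
    have hδ0 : 0 < δ := by positivity
    obtain ⟨p, hp⟩ := exists_polyFun_near
      ⟨fun x => RCLike.re (g x), RCLike.continuous_re.comp g.continuous⟩ hδ0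
    obtain ⟨q, hq⟩ := exists_polyFun_near
      ⟨fun x => RCLike.im (g x), RCLike.continuous_im.comp g.continuous⟩ hδ0
    refine ⟨polyL2 𝕜 p + (RCLike.I : 𝕜) • polyL2 𝕜 q, Submodule.add_mem _ (polyL2_mem_span p)
      (Submodule.smul_mem _ _ (polyL2_mem_span q)), ?_⟩
    rw [dist_eq_norm]
    have hb : ∀ᵐ x ∂volG n, ‖(BoundedContinuousFunction.toLp 2 (volG n) 𝕜 g -
        (polyL2 𝕜 p + (RCLike.I : 𝕜) • polyL2 𝕜 q) : L2 𝕜 n) x‖ ≤ 2 * δ := by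
      filter_upwards [ae_mem_ball, Lp.coeFn_sub (BoundedContinuousFunction.toLp 2 (volG n) 𝕜 g)
        (polyL2 𝕜 p + (RCLike.I : 𝕜) • polyL2 𝕜 q), Lp.coeFn_add (polyL2 𝕜 p)
        ((RCLike.I : 𝕜) • polyL2 𝕜 q), Lp.coeFn_smul (RCLike.I : 𝕜) (polyL2 𝕜 q),
        coeFn_polyL2 (𝕜 := 𝕜) p, coeFn_polyL2 (𝕜 := 𝕜) q,
        BoundedContinuousFunction.coeFn_toLp (p := 2) (volG n) 𝕜 g] with x hx h1 h2 h3 h4 h5 h6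
      rw [h1, Pi.sub_apply, h2, Pi.add_apply, h3, Pi.smul_apply, h4, h5, h6, smul_eq_mul]
      have e : g x - (polyFun 𝕜 p x + RCLike.I * polyFun 𝕜 q x) =
          -(((polyFun ℝ p x - RCLike.re (g x) : ℝ) : 𝕜) +
            RCLike.I * ((polyFun ℝ q x - RCLike.im (g x) : ℝ) : 𝕜)) := by
        conv_lhs => rw [← RCLike.re_add_im (g x)]
        rw [polyFun_eq_ofReal p, polyFun_eq_ofReal q]
        push_cast
        ring
      rw [e, norm_neg, two_mul]
      refine norm_add_le_of_le ?_ ?_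
      · rw [RCLike.norm_ofReal]; exact (hp x hx).le
      · rw [norm_mul, RCLike.norm_ofReal]
        refine (mul_le_of_le_one_left (abs_nonneg _)
          (by rw [RCLike.norm_I]; split_ifs <;> norm_num)).trans (hq x hx).le
    have hn := Lp.norm_le_of_ae_bound (by positivity) hb
    refine hn.trans_lt ?_
    rw [← NNReal.coe_rpow, ← hm, hδ]
    have : m * (2 * (ε / (2 * (m + 1)))) = ε * (m / (m + 1)) := by field_simp
    rw [this]
    exact mul_lt_of_lt_one_right hε ((div_lt_one (by positivity)).2 (by linarith))
  intro f _
  exact closure_minimal hsub (Submodule.isClosed_topologicalClosure S) (hd f)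

/-- The orthonormal polynomials as a Hilbert basis. -/
def phiBasis (𝕜 : Type*) [RCLike 𝕜] (n : ℕ) : HilbertBasis (Fin n → ℕ) 𝕜 (L2 𝕜 n) :=
  HilbertBasis.mk orthonormal_polyL2_phiPoly dense_span_polyL2

lemma phiBasis_apply (α : Fin n → ℕ) : phiBasis 𝕜 n α = polyL2 𝕜 (phiPoly α) := by
  rw [phiBasis, HilbertBasis.coe_mk]

lemma coeFn_phiBasis (α : Fin n → ℕ) :
    phiBasis 𝕜 n α =ᵐ[volG n] fun x => (phi α x : 𝕜) := by
  rw [phiBasis_apply]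
  filter_upwards [coeFn_polyL2 (𝕜 := 𝕜) (phiPoly α), ae_mem_ball] with x h1 hx
  rw [h1, phi_eq_eval α hx, polyFun]

lemma fourierCoeff_eq_repr (α : Fin n → ℕ) (u : L2 𝕜 n) :
    fourierCoeff α u = (phiBasis 𝕜 n).repr u α := by
  rw [HilbertBasis.repr_apply_apply, L2.inner_def, fourierCoeff, ← volG_eq_muBall]
  refine integral_congr_ae ?_
  filter_upwards [coeFn_phiBasis (𝕜 := 𝕜) α] with x h
  rw [h, RCLike.inner_apply, RCLike.conj_ofReal]

/-- The eigenvalue that belongs to a multi-index. -/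
def eigval (α : Fin n → ℕ) : ℝ := lam n (∑ i, α i)

lemma phiBasis_mem_negLaplaceGraph (α : Fin n → ℕ) :
    (phiBasis 𝕜 n α, (eigval α : 𝕜) • phiBasis 𝕜 n α) ∈ negLaplaceGraph 𝕜 n := by
  rw [phiBasis_apply]
  refine ⟨polyFun 𝕜 (phiPoly α), isC2b_polyFun _, coeFn_polyL2 _, ?_⟩
  have h := eval_lapPoly_phiPoly α
  rw [← volG_eq_muBall] at h
  filter_upwards [Lp.coeFn_smul (eigval α : 𝕜) (polyL2 𝕜 (phiPoly α)),
    coeFn_polyL2 (𝕜 := 𝕜) (phiPoly α), ae_mem_ball, h] with x h1 h2 hx h3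
  rw [h1, Pi.smul_apply, h2, laplaceBeltrami_polyFun _ hx, polyFun_eq_ofReal (lapPoly n _), h3,
    polyFun_eq_ofReal, eigval]
  push_cast
  rw [neg_neg, smul_eq_mul]

/-- Symmetry of L against its own eigenvectors: the coefficients of -Δu are λ times those of u. -/
lemma negLaplaceGraph_le_diagGraph : negLaplaceGraph 𝕜 n ≤ diagGraph (phiBasis 𝕜 n) eigval :=
  fun _ hp => mem_diagGraph_of_inner _ _ fun α =>
    negLaplaceGraph_inner (phiBasis_mem_negLaplaceGraph α) hp

/-- Well-definedness of L on classes. If u vanishes almost everywhere then so do all Fourier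
coefficients of -Δu, so `toLinearPMap` acts on a genuine graph and not by its default value. -/
lemma negLaplace_graph : (negLaplace 𝕜 n).graph = negLaplaceGraph 𝕜 n := by
  refine Submodule.toLinearPMap_graph_eq _ fun p hp h0 => ?_
  have h := negLaplaceGraph_le_diagGraph hp
  refine repr_ext (phiBasis 𝕜 n) fun i => ?_
  rw [h i, h0]; simp

lemma graph_le_diagGraph : (negLaplace 𝕜 n).graph ≤ diagGraph (phiBasis 𝕜 n) eigval := by
  rw [negLaplace_graph]; exact negLaplaceGraph_le_diagGraph

lemma phiBasis_mem_graph (α : Fin n → ℕ) :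
    (phiBasis 𝕜 n α, (eigval α : 𝕜) • phiBasis 𝕜 n α) ∈ (negLaplace 𝕜 n).graph := by
  rw [negLaplace_graph]; exact phiBasis_mem_negLaplaceGraph α

end Basis

/-! ### The eigenvalues -/

section Eigenvalues

variable {n : ℕ}

lemma mem_multiIndices {s : ℕ} {α : Fin n → ℕ} : α ∈ multiIndices n s ↔ ∑ i, α i = s := by
  simp [multiIndices]

/-- For n ≥ 1 the eigenvalues are natural numbers. Integrality gives the separation by 1 and the
inequality λ ≤ λ². -/
lemma lam_eq_natCast (hn : 1 ≤ n) (s : ℕ) : lam n s = ((s * (s + (n - 1)) : ℕ) : ℝ) := by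
  rw [lam]; push_cast [hn]; ring

lemma lam_nonneg (hn : 1 ≤ n) (s : ℕ) : 0 ≤ lam n s := by
  rw [lam_eq_natCast hn]; positivity

lemma le_lam (hn : 1 ≤ n) (s : ℕ) : (s : ℝ) ≤ lam n s := by
  rw [lam_eq_natCast hn]
  have : s ≤ s * (s + (n - 1)) := by
    rcases s with _ | s
    · simp
    · exact Nat.le_mul_of_pos_right _ (by omega)
  exact_mod_cast this

lemma lam_strictMono (hn : 1 ≤ n) : StrictMono (lam n) := by
  intro s t h
  rw [lam_eq_natCast hn, lam_eq_natCast hn]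
  have : s * (s + (n - 1)) < t * (t + (n - 1)) :=
    Nat.mul_lt_mul_of_lt_of_le h (by omega) (by omega)
  exact_mod_cast this

lemma lam_eq_of_abs_sub_lt (hn : 1 ≤ n) {s t : ℕ} (h : |lam n t - lam n s| < 1) :
    lam n t = lam n s := by
  rw [lam_eq_natCast hn, lam_eq_natCast hn] at h ⊢
  have h2 : |((t * (t + (n - 1)) : ℕ) : ℤ) - ((s * (s + (n - 1)) : ℕ) : ℤ)| < 1 := by
    exact_mod_cast h
  rw [Int.abs_lt_one_iff, sub_eq_zero] at h2
  exact_mod_cast h2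

lemma exists_sum_eq (hn : 1 ≤ n) (s : ℕ) : ∃ α : Fin n → ℕ, ∑ i, α i = s :=
  ⟨Pi.single ⟨0, hn⟩ s, by simp⟩

lemma setOf_eigval (𝕜 : Type*) [RCLike 𝕜] (hn : 1 ≤ n) :
    {z : 𝕜 | ∃ α : Fin n → ℕ, z = (eigval α : 𝕜)} = {z : 𝕜 | ∃ s : ℕ, z = (lam n s : 𝕜)} := by
  ext z
  constructor
  · rintro ⟨α, rfl⟩; exact ⟨_, rfl⟩
  · rintro ⟨s, rfl⟩
    obtain ⟨α, hα⟩ := exists_sum_eq hn s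
    exact ⟨α, by rw [eigval, hα]⟩

lemma eigval_eq_lam_iff (hn : 1 ≤ n) {s : ℕ} (α : Fin n → ℕ) :
    α ∈ multiIndices n s ↔ eigval α = lam n s := by
  rw [mem_multiIndices, eigval, (lam_strictMono hn).injective.eq_iff]

lemma finite_eigval_eq (hn : 1 ≤ n) (c : ℝ) : {α : Fin n → ℕ | eigval α = c}.Finite := by
  by_cases h : ∃ s, lam n s = c
  · obtain ⟨s, rfl⟩ := h
    refine (multiIndices n s).finite_toSet.subset fun α hα => ?_
    exact (eigval_eq_lam_iff hn α).2 hα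
  · convert! Set.finite_empty
    ext α
    simp only [Set.mem_ofPred_eq, Set.mem_empty_iff_false, iff_false]
    exact fun hα => h ⟨_, hα⟩

/-- Since λ_s tends to infinity, the distance from `z` to the eigenvalues is attained, hence
positive. -/
lemma exists_eigval_gap {𝕜 : Type*} [RCLike 𝕜] (hn : 1 ≤ n) (z : 𝕜)
    (hz : ∀ α : Fin n → ℕ, z ≠ (eigval α : 𝕜)) :
    ∃ c : ℝ, 0 < c ∧ ∀ α : Fin n → ℕ, c ≤ ‖(eigval α : 𝕜) - z‖ := by
  have ht : Tendsto (fun s : ℕ => ‖(lam n s : 𝕜) - z‖) (cocompact ℕ) atTop := by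
    rw [cocompact_eq_cofinite, Nat.cofinite_eq_atTop]
    refine tendsto_atTop_mono (fun s => ?_)
      (tendsto_atTop_add_const_right atTop (-‖z‖) tendsto_natCast_atTop_atTop)
    have h1 := norm_sub_norm_le (lam n s : 𝕜) z
    rw [RCLike.norm_ofReal, abs_of_nonneg (lam_nonneg hn s)] at h1
    have := le_lam hn s
    linarith
  obtain ⟨s, hs⟩ := (continuous_of_discreteTopology
    (f := fun s : ℕ => ‖(lam n s : 𝕜) - z‖)).exists_forall_le ht
  refine ⟨_, ?_, fun α => hs _⟩
  obtain ⟨α, hα⟩ := exists_sum_eq hn s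
  have := hz α
  rw [eigval, hα] at this
  exact norm_pos_iff.2 (sub_ne_zero.2 this.symm)

/-- Nonnegative terms may be regrouped by |α|, whose fibres are finite and on which λ is constant.
The function `g` is the square for the domain of the closure and the identity for the form domain.
-/
lemma summable_lam_iff {f : (Fin n → ℕ) → ℝ} (hf : ∀ α, 0 ≤ f α) (g : ℝ → ℝ)
    (hg : ∀ s, 0 ≤ g (lam n s)) :
    (Summable fun s : ℕ => g (lam n s) * ∑ α ∈ multiIndices n s, f α) ↔
      Summable fun α : Fin n → ℕ => g (eigval α) * f α := by
  rw [← (Equiv.sigmaFiberEquiv fun α : Fin n → ℕ => ∑ i, α i).summable_iff,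
    summable_sigma_of_nonneg (f := (fun α : Fin n → ℕ => g (eigval α) * f α) ∘
      Equiv.sigmaFiberEquiv fun α : Fin n → ℕ => ∑ i, α i)
      fun _ => mul_nonneg (hg _) (hf _)]
  have hfin : ∀ s : ℕ, Finite {α : Fin n → ℕ // ∑ i, α i = s} := fun s =>
    Set.Finite.to_subtype ((multiIndices n s).finite_toSet.subset fun α hα =>
      mem_multiIndices.2 hα)
  have h1 : ∀ s : ℕ, Summable fun α : {α : Fin n → ℕ // ∑ i, α i = s} =>
      g (eigval α.1) * f α.1 := fun s => by
    have := hfin s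
    exact Summable.of_finite
  have h2 : ∀ s : ℕ, ∑' α : {α : Fin n → ℕ // ∑ i, α i = s}, g (eigval α.1) * f α.1 =
      g (lam n s) * ∑ α ∈ multiIndices n s, f α := by
    intro s
    have e : ∑' α : {α : Fin n → ℕ // ∑ i, α i = s}, g (eigval α.1) * f α.1 =
        ∑' α : {α : Fin n → ℕ // α ∈ multiIndices n s}, g (eigval α.1) * f α.1 :=
      ((Equiv.subtypeEquivRight fun α => mem_multiIndices).tsum_eq
        (fun α : {α : Fin n → ℕ // ∑ i, α i = s} => g (eigval α.1) * f α.1)).symm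
    rw [e, Finset.tsum_subtype (multiIndices n s) fun α => g (eigval α) * f α, Finset.mul_sum]
    refine Finset.sum_congr rfl fun α hα => ?_
    rw [eigval, mem_multiIndices.1 hα]
  constructor
  · intro h
    exact ⟨h1, h.congr fun s => (h2 s).symm⟩
  · rintro ⟨-, h⟩
    exact h.congr fun s => h2 s

end Eigenvalues

/-! ### The Dirichlet form -/

section Dirichlet

variable {𝕜 : Type*} [RCLike 𝕜] {n : ℕ}

/-- Cauchy-Schwarz with |x| < 1, that is, positivity of the inverse metric 1 - x xᵀ. -/
lemma norm_sq_sum_smul_le {x : E n} (hx : x ∈ ball n) (a : Fin n → 𝕜) :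
    ‖∑ i, x i • a i‖ ^ 2 ≤ ∑ i, ‖a i‖ ^ 2 := by
  have h1 : ‖∑ i, x i • a i‖ ≤ ∑ i, |x i| * ‖a i‖ :=
    (norm_sum_le _ _).trans_eq (Finset.sum_congr rfl fun i _ => by rw [norm_smul, Real.norm_eq_abs])
  have h2 := Finset.sum_mul_sq_le_sq_mul_sq Finset.univ (fun i => |x i|) fun i => ‖a i‖
  simp only [sq_abs] at h2
  have h3 : 0 ≤ ∑ i, ‖a i‖ ^ 2 := Finset.sum_nonneg fun i _ => sq_nonneg _
  have h4 := sum_sq_lt hx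
  calc ‖∑ i, x i • a i‖ ^ 2 ≤ (∑ i, |x i| * ‖a i‖) ^ 2 := by gcongr
    _ ≤ _ := h2
    _ ≤ _ := mul_le_of_le_one_left h3 (by linarith)

lemma norm_mul_sub_sq {c : 𝕜} (hc : ‖c‖ = 1) (a b : 𝕜) :
    ‖c * a - b‖ ^ 2 = ‖a‖ ^ 2 + ‖b‖ ^ 2 - 2 * RCLike.re (c * (a * conj b)) := by
  have h := norm_sub_sq (𝕜 := 𝕜) b (c * a)
  rw [RCLike.inner_apply, norm_mul, hc, one_mul, mul_assoc] at h
  rw [norm_sub_rev, h]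
  ring

/-- Positivity of the inverse metric is applied to c a - b, with the unimodular c chosen so that the
mixed term becomes its own modulus. -/
lemma two_mul_norm_form_le {x : E n} (hx : x ∈ ball n) (a b : Fin n → 𝕜) :
    2 * ‖∑ i, a i * conj (b i) - (∑ i, x i • a i) * conj (∑ i, x i • b i)‖ ≤
      (∑ i, ‖a i‖ ^ 2 - ‖∑ i, x i • a i‖ ^ 2) + (∑ i, ‖b i‖ ^ 2 - ‖∑ i, x i • b i‖ ^ 2) := by
  obtain ⟨c, hc, hB⟩ := RCLike.exists_norm_eq_mul_self
    (∑ i, a i * conj (b i) - (∑ i, x i • a i) * conj (∑ i, x i • b i))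
  have h := norm_sq_sum_smul_le hx fun i => c * a i - b i
  have e : ∑ i, x i • (c * a i - b i) = c * ∑ i, x i • a i - ∑ i, x i • b i := by
    simp only [smul_sub, Finset.sum_sub_distrib, Finset.mul_sum, mul_smul_comm]
  rw [e, norm_mul_sub_sq hc] at h
  simp only [norm_mul_sub_sq hc, Finset.sum_sub_distrib, Finset.sum_add_distrib,
    ← Finset.mul_sum, ← map_sum] at h
  have h2 := congrArg RCLike.re hB
  rw [RCLike.ofReal_re, mul_sub, map_sub] at h2
  linarith

/-- The hermitian form `⟨grad w, grad u⟩_g`. -/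
def gradInner (w u : E n → 𝕜) (x : E n) : 𝕜 := ∑ i, pd i w x * grad (fun y => conj (u y)) x i

lemma radial_conj (u : E n → 𝕜) (x : E n) :
    radial (fun y => conj (u y)) x = conj (radial u x) := by
  simp only [radial, pd_conj, map_sum]
  refine Finset.sum_congr rfl fun i _ => ?_
  rw [RCLike.real_smul_eq_coe_mul, RCLike.real_smul_eq_coe_mul, map_mul, RCLike.conj_ofReal]

lemma gradInner_eq (w u : E n → 𝕜) {x : E n} (hx : x ∈ ball n) :
    gradInner w u x = ∑ i, pd i w x * conj (pd i u x) - radial w x * conj (radial u x) := by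
  rw [gradInner, sum_pd_mul_grad _ _ hx, radial_conj]
  simp only [pd_conj]

/-- Lowering the index with G undoes the inverse metric in the gradient, so the length is the
pairing of the gradient with the plain derivatives. -/
lemma gradNormSq_eq (u : E n → 𝕜) {x : E n} (hx : x ∈ ball n) :
    gradNormSq u x = ∑ i, ‖pd i u x‖ ^ 2 - ‖radial u x‖ ^ 2 := by
  have hG : ∀ i, ∑ j, G n x i j • grad u x j = pd i u x := by
    intro i
    have h : G n x * (G n x)⁻¹ = 1 := by rw [G_inv x hx]; exact G_mul x hx
    simp only [grad, Finset.smul_sum, smul_smul]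
    rw [Finset.sum_comm]
    simp only [← Finset.sum_smul, ← Matrix.mul_apply, h, Matrix.one_apply, ite_smul, one_smul,
      zero_smul, Finset.sum_ite_eq, Finset.mem_univ, if_true]
  have h1 : ∀ i, ∑ j, G n x i j • (conj (grad u x i) * grad u x j) =
      pd i u x * conj (pd i u x) - (x i • pd i u x) * conj (radial u x) := by
    intro i
    simp only [← mul_smul_comm, ← Finset.mul_sum, hG]
    rw [grad_eq u hx, map_sub, RCLike.real_smul_eq_coe_mul, RCLike.real_smul_eq_coe_mul, map_mul,
      RCLike.conj_ofReal]
    ring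
  rw [gradNormSq, Finset.sum_congr rfl fun i _ => h1 i, Finset.sum_sub_distrib, ← Finset.sum_mul,
    map_sub, map_sum, ← radial]
  simp only [RCLike.mul_conj, ← RCLike.ofReal_pow, RCLike.ofReal_re]

lemma gradNormSq_nonneg (u : E n → 𝕜) {x : E n} (hx : x ∈ ball n) : 0 ≤ gradNormSq u x := by
  rw [gradNormSq_eq u hx, sub_nonneg]
  exact norm_sq_sum_smul_le hx _

lemma re_gradInner_self (u : E n → 𝕜) {x : E n} (hx : x ∈ ball n) :
    RCLike.re (gradInner u u x) = gradNormSq u x := by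
  rw [gradInner_eq u u hx, gradNormSq_eq u hx, map_sub, map_sum]
  simp only [RCLike.mul_conj, ← RCLike.ofReal_pow, RCLike.ofReal_re]

lemma two_mul_norm_gradInner_le (w u : E n → 𝕜) {x : E n} (hx : x ∈ ball n) :
    2 * ‖gradInner w u x‖ ≤ gradNormSq w x + gradNormSq u x := by
  rw [gradInner_eq w u hx, gradNormSq_eq w hx, gradNormSq_eq u hx]
  exact two_mul_norm_form_le hx _ _

lemma aestronglyMeasurable_gradNormSq {w : E n → 𝕜} (hw : ContDiffOn ℝ 1 w (ball n)) :
    AEStronglyMeasurable (gradNormSq w) (volG n) := by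
  rw [volG_eq_muBall]
  refine aestronglyMeasurable_of_continuousOn (ContinuousOn.congr
    (f := fun x => ∑ i, ‖pd i w x‖ ^ 2 - ‖radial w x‖ ^ 2) ?_ fun x hx => gradNormSq_eq w hx)
  exact (continuousOn_finsetSum _ fun i _ => (continuousOn_pd hw i).norm.pow 2).sub
    ((continuousOn_radial hw).norm.pow 2)

lemma aestronglyMeasurable_gradInner {w u : E n → 𝕜} (hw : ContDiffOn ℝ 1 w (ball n))
    (hu : IsC2b u) : AEStronglyMeasurable (gradInner w u) (volG n) := by
  rw [volG_eq_muBall]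
  exact aestronglyMeasurable_of_continuousOn (continuousOn_finsetSum _ fun i _ =>
    (continuousOn_pd hw i).mul (continuousOn_grad hu.conj.contDiffOn_one i))

lemma IsC2b.integrable_gradInner {w u : E n → 𝕜} (hw : IsC2b w) (hu : IsC2b u) :
    Integrable (gradInner w u) (volG n) := by
  rw [volG_eq_muBall]; exact hw.integrable_pd_mul_grad hu.conj

lemma IsC2b.integrable_gradNormSq {u : E n → 𝕜} (hu : IsC2b u) :
    Integrable (gradNormSq u) (volG n) :=
  (hu.integrable_gradInner hu).re.congr (by
    filter_upwards [ae_mem_ball] with x hx using re_gradInner_self u hx)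

lemma integrable_gradInner {w u : E n → 𝕜} (hw : ContDiffOn ℝ 1 w (ball n))
    (hq : Integrable (gradNormSq w) (volG n)) (hu : IsC2b u) :
    Integrable (gradInner w u) (volG n) := by
  refine (hq.add hu.integrable_gradNormSq).mono' (aestronglyMeasurable_gradInner hw hu) ?_
  filter_upwards [ae_mem_ball] with x hx
  have := two_mul_norm_gradInner_le w u hx
  rw [Pi.add_apply]
  linarith [norm_nonneg (gradInner w u x)]

/-- Green's formula in terms of inner products of classes. -/
lemma inner_eq_integral_gradInner {w u : E n → 𝕜} {W A : L2 𝕜 n} (hw : ContDiffOn ℝ 1 w (ball n))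
    (hq : Integrable (gradNormSq w) (volG n)) (hW : W =ᵐ[volG n] w) (hu : IsC2b u)
    (hA : A =ᵐ[volG n] fun x => -laplaceBeltrami u x) :
    ⟪A, W⟫_𝕜 = ∫ x, gradInner w u x ∂volG n := by
  have hwi : Integrable w (volG n) :=
    ((Lp.memLp W).ae_eq hW).integrable (by norm_num)
  have hgi := integrable_gradInner hw hq hu
  rw [volG_eq_muBall] at hwi hgi
  have h := integral_mul_laplaceBeltrami hw hu.conj hwi hgi
  have e : ⟪A, W⟫_𝕜 = -∫ x, w x * laplaceBeltrami (fun y => conj (u y)) x ∂volG n := by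
    rw [L2.inner_def, ← integral_neg]
    refine integral_congr_ae ?_
    filter_upwards [hW, hA] with x h1 h2
    rw [h1, h2, RCLike.inner_apply, laplaceBeltrami_conj, map_neg, mul_neg]
  rw [e, volG_eq_muBall, h, neg_neg]
  rfl

lemma IsC2b.re_inner_eq_integral_gradNormSq {u : E n → 𝕜} (hu : IsC2b u) {U A : L2 𝕜 n}
    (hU : U =ᵐ[volG n] u) (hA : A =ᵐ[volG n] fun x => -laplaceBeltrami u x) :
    RCLike.re ⟪A, U⟫_𝕜 = ∫ x, gradNormSq u x ∂volG n := by
  rw [inner_eq_integral_gradInner hu.contDiffOn_one hu.integrable_gradNormSq hU hu hA,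
    ← integral_re (hu.integrable_gradInner hu)]
  refine integral_congr_ae ?_
  filter_upwards [ae_mem_ball] with x hx using re_gradInner_self u hx

/-- The Bessel inequality for the Dirichlet form. -/
lemma sum_eigval_mul_le {w : E n → 𝕜} {W : L2 𝕜 n} (hw : ContDiffOn ℝ 1 w (ball n))
    (hq : Integrable (gradNormSq w) (volG n)) (hW : W =ᵐ[volG n] w)
    (F : Finset (Fin n → ℕ)) :
    ∑ α ∈ F, eigval α * ‖(phiBasis 𝕜 n).repr W α‖ ^ 2 ≤ ∫ x, gradNormSq w x ∂volG n := by
  set c : (Fin n → ℕ) → 𝕜 := fun α => (phiBasis 𝕜 n).repr W α with hc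
  set P : L2 𝕜 n := ∑ α ∈ F, c α • phiBasis 𝕜 n α with hP
  set A : L2 𝕜 n := ∑ α ∈ F, c α • (eigval α : 𝕜) • phiBasis 𝕜 n α with hA
  have hPA : (P, A) ∈ negLaplaceGraph 𝕜 n := by
    have h := Submodule.sum_mem (negLaplaceGraph 𝕜 n) (t := F)
      (f := fun α => c α • (phiBasis 𝕜 n α, (eigval α : 𝕜) • phiBasis 𝕜 n α))
      fun α _ => Submodule.smul_mem _ _ (phiBasis_mem_negLaplaceGraph α)
    have e : (P, A) = ∑ α ∈ F, c α • (phiBasis 𝕜 n α, (eigval α : 𝕜) • phiBasis 𝕜 n α) :=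
      Prod.ext (by rw [Prod.fst_sum]; rfl) (by rw [Prod.snd_sum]; rfl)
    rwa [e]
  have hinner : ∀ V : L2 𝕜 n, (∀ α ∈ F, ⟪phiBasis 𝕜 n α, V⟫_𝕜 = c α) →
      RCLike.re ⟪A, V⟫_𝕜 = ∑ α ∈ F, eigval α * ‖c α‖ ^ 2 := by
    intro V hV
    rw [hA, sum_inner, map_sum]
    refine Finset.sum_congr rfl fun α hα => ?_
    rw [inner_smul_left, inner_smul_left, hV α hα, RCLike.conj_ofReal, mul_left_comm,
      RCLike.conj_mul, ← RCLike.ofReal_pow, ← RCLike.ofReal_mul, RCLike.ofReal_re]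
  -- The class `W` and its projection `P` have the same coefficients on `F`. The mixed energy of w
  -- with the representative u of `P` and the energy of u itself are therefore the same sum Σ, and
  -- integrating 2 Re⟨grad w, grad u⟩ ≤ |grad w|² + |grad u|² yields 2Σ ≤ ∫|grad w|² + Σ.
  have h1 := hinner W fun α _ => (HilbertBasis.repr_apply_apply _ _ _).symm
  have h2 := hinner P fun α hα => (phiBasis 𝕜 n).orthonormal.inner_right_sum c hα
  obtain ⟨u, hu, hPu, hAu⟩ := hPA
  rw [hu.re_inner_eq_integral_gradNormSq hPu hAu] at h2
  rw [inner_eq_integral_gradInner hw hq hW hu hAu,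
    ← integral_re (integrable_gradInner hw hq hu)] at h1
  have h3 : ∫ x, 2 * RCLike.re (gradInner w u x) ∂volG n ≤
      ∫ x, gradNormSq w x + gradNormSq u x ∂volG n := by
    refine integral_mono_ae ((integrable_gradInner hw hq hu).re.const_mul 2)
      (hq.add hu.integrable_gradNormSq) ?_
    filter_upwards [ae_mem_ball] with x hx
    have := two_mul_norm_gradInner_le w u hx
    have := RCLike.re_le_norm (gradInner w u x)
    linarith
  rw [integral_const_mul, integral_add hq hu.integrable_gradNormSq] at h3
  linarith

/-- The Parseval identity for the Dirichlet form of bounded `C²` functions. -/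
lemma IsC2b.hasSum_eigval_mul {u : E n → 𝕜} (hu : IsC2b u) {U : L2 𝕜 n}
    (hU : U =ᵐ[volG n] u) :
    HasSum (fun α => eigval α * ‖(phiBasis 𝕜 n).repr U α‖ ^ 2)
      (∫ x, gradNormSq u x ∂volG n) := by
  set A : L2 𝕜 n := -hu.memLp_laplaceBeltrami.toLp _ with hA
  have hAu : A =ᵐ[volG n] fun x => -laplaceBeltrami u x := by
    filter_upwards [Lp.coeFn_neg (hu.memLp_laplaceBeltrami.toLp _),
      hu.memLp_laplaceBeltrami.coeFn_toLp] with x h1 h2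
    rw [hA, h1, Pi.neg_apply, h2]
  have hd : (U, A) ∈ diagGraph (phiBasis 𝕜 n) eigval :=
    negLaplaceGraph_le_diagGraph ⟨u, hu, hU, hAu⟩
  rw [← hu.re_inner_eq_integral_gradNormSq hU hAu]
  refine (RCLike.hasSum_re 𝕜 ((phiBasis 𝕜 n).hasSum_inner_mul_inner A U)).congr_fun fun α => ?_
  have e := hd α
  simp only [HilbertBasis.repr_apply_apply] at e ⊢
  have e2 : ⟪A, phiBasis 𝕜 n α⟫_𝕜 * ⟪phiBasis 𝕜 n α, U⟫_𝕜 =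
      ((eigval α * ‖⟪phiBasis 𝕜 n α, U⟫_𝕜‖ ^ 2 : ℝ) : 𝕜) := by
    rw [← inner_conj_symm A, e, map_mul, RCLike.conj_ofReal, mul_assoc, RCLike.conj_mul]
    push_cast
    rfl
  rw [e2, RCLike.ofReal_re]

end Dirichlet

/-! ### The Sobolev space in terms of Fourier coefficients -/

section Sobolev

variable {𝕜 : Type*} [RCLike 𝕜] {n : ℕ}

lemma lintegral_enorm_sq_rpow (f : E n → 𝕜) :
    (∫⁻ x, ‖f x‖ₑ ^ 2 ∂volG n) ^ (1 / 2 : ℝ) = eLpNorm f 2 (volG n) := by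
  rw [eLpNorm_eq_lintegral_rpow_enorm_toReal (by norm_num) (by norm_num)]
  simp

lemma h1Norm_eq (f : E n → 𝕜) : h1Norm f = eLpNorm f 2 (volG n) +
    (∫⁻ x, ENNReal.ofReal (gradNormSq f x) ∂volG n) ^ (1 / 2 : ℝ) := by
  rw [h1Norm, lintegral_enorm_sq_rpow]

lemma gradNormSq_ae_nonneg (f : E n → 𝕜) : 0 ≤ᵐ[volG n] gradNormSq f := by
  filter_upwards [ae_mem_ball] with x hx using gradNormSq_nonneg f hx

lemma integrable_gradNormSq {w : E n → 𝕜} (hw : ContDiffOn ℝ 1 w (ball n)) (h : h1Norm w < ⊤) :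
    Integrable (gradNormSq w) (volG n) := by
  rw [h1Norm_eq] at h
  have h2 := (ENNReal.rpow_lt_top_iff_of_pos (by norm_num)).1 (ENNReal.add_lt_top.1 h).2
  exact ⟨aestronglyMeasurable_gradNormSq hw,
    (hasFiniteIntegral_iff_ofReal (gradNormSq_ae_nonneg w)).2 h2⟩

lemma memLp_of_h1Norm {w : E n → 𝕜} (hw : ContDiffOn ℝ 1 w (ball n)) (h : h1Norm w < ⊤) :
    MemLp w 2 (volG n) := by
  refine ⟨?_, ?_⟩
  · rw [volG_eq_muBall]; exact aestronglyMeasurable_of_continuousOn hw.continuousOn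
  · rw [h1Norm_eq] at h
    exact (ENNReal.add_lt_top.1 h).1

lemma integral_gradNormSq_le_one {w : E n → 𝕜} (hw : ContDiffOn ℝ 1 w (ball n))
    (h : h1Norm w < 1) : ∫ x, gradNormSq w x ∂volG n ≤ 1 := by
  rw [h1Norm_eq] at h
  have h2 : ∫⁻ x, ENNReal.ofReal (gradNormSq w x) ∂volG n ≤ 1 := by
    by_contra! h1
    exact absurd (ENNReal.one_lt_rpow h1 (by norm_num : (0 : ℝ) < 1 / 2))
      (not_lt.2 (le_add_self.trans_lt h).le)
  rw [integral_eq_lintegral_of_nonneg_ae (gradNormSq_ae_nonneg w)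
    (aestronglyMeasurable_gradNormSq hw)]
  exact ENNReal.toReal_le_of_le_ofReal zero_le_one (by rwa [ENNReal.ofReal_one])

lemma norm_add_sq_le_two_mul (a b : 𝕜) : ‖a + b‖ ^ 2 ≤ 2 * ‖a‖ ^ 2 + 2 * ‖b‖ ^ 2 := by
  have h := norm_add_le a b
  nlinarith [norm_nonneg (a + b), sq_nonneg (‖a‖ - ‖b‖), norm_nonneg a, norm_nonneg b]

/-- The Cauchy condition bounds the energy of w_k - w_N, so Bessel bounds all finite sums for W k -
W N uniformly in k. The coefficients converge, the bound passes to u - W N, and W N is summable by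
Bessel again. -/
lemma MemH1.summable (hn : 1 ≤ n) {u : L2 𝕜 n} (hu : MemH1 u) :
    Summable fun α => eigval α * ‖(phiBasis 𝕜 n).repr u α‖ ^ 2 := by
  obtain ⟨w, hw, hlim, hC⟩ := hu
  obtain ⟨N, hN⟩ := hC 1 one_pos
  have hw1 : ∀ k, ContDiffOn ℝ 1 (w k) (ball n) := fun k => (hw k).1.of_le (by simp)
  have hwL : ∀ k, MemLp (w k) 2 (volG n) := fun k => memLp_of_h1Norm (hw1 k) (hw k).2
  have hpos : ∀ α : Fin n → ℕ, 0 ≤ eigval α := fun α => lam_nonneg hn _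
  set W : ℕ → L2 𝕜 n := fun k => (hwL k).toLp _ with hW
  have hWlim : Tendsto W atTop (𝓝 u) := by
    rw [Lp.tendsto_Lp_iff_tendsto_eLpNorm']
    refine hlim.congr fun k => eLpNorm_congr_ae ?_
    filter_upwards [(hwL k).coeFn_toLp] with x hx
    rw [Pi.sub_apply, hx]
  have hrepr : ∀ (V : L2 𝕜 n) (Vk : ℕ → L2 𝕜 n), Tendsto Vk atTop (𝓝 V) → ∀ α,
      Tendsto (fun k => (phiBasis 𝕜 n).repr (Vk k) α) atTop (𝓝 ((phiBasis 𝕜 n).repr V α)) := by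
    intro V Vk h α
    simp only [HilbertBasis.repr_apply_apply]
    exact tendsto_const_nhds.inner h
  have hd : ∀ k ≥ N, ∀ F : Finset (Fin n → ℕ),
      ∑ α ∈ F, eigval α * ‖(phiBasis 𝕜 n).repr (W k - W N) α‖ ^ 2 ≤ 1 := by
    intro k hk F
    have h1 := hN k hk N le_rfl
    have h2 : ContDiffOn ℝ 1 (fun x => w k x - w N x) (ball n) := (hw1 k).sub (hw1 N)
    refine (sum_eigval_mul_le h2 (integrable_gradNormSq h2 (h1.trans ENNReal.one_lt_top)) ?_
      F).trans (integral_gradNormSq_le_one h2 h1)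
    filter_upwards [Lp.coeFn_sub (W k) (W N), (hwL k).coeFn_toLp, (hwL N).coeFn_toLp]
      with x e1 e2 e3
    rw [e1, Pi.sub_apply, e2, e3]
  have hs1 : Summable fun α => eigval α * ‖(phiBasis 𝕜 n).repr (u - W N) α‖ ^ 2 := by
    refine summable_of_sum_le (c := 1) (fun α => mul_nonneg (hpos α) (sq_nonneg _)) fun F => ?_
    refine le_of_tendsto (tendsto_finsetSum F fun α _ =>
      ((hrepr _ _ (hWlim.sub_const (W N)) α).norm.pow 2).const_mul (eigval α)) ?_
    filter_upwards [eventually_ge_atTop N] with k hk using hd k hk F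
  have hs2 : Summable fun α => eigval α * ‖(phiBasis 𝕜 n).repr (W N) α‖ ^ 2 :=
    summable_of_sum_le (fun α => mul_nonneg (hpos α) (sq_nonneg _))
      (sum_eigval_mul_le (hw1 N) (integrable_gradNormSq (hw1 N) (hw N).2) (hwL N).coeFn_toLp)
  refine Summable.of_nonneg_of_le (fun α => mul_nonneg (hpos α) (sq_nonneg _)) (fun α => ?_)
    ((hs1.mul_left 2).add (hs2.mul_left 2))
  have e : (phiBasis 𝕜 n).repr u α =
      (phiBasis 𝕜 n).repr (u - W N) α + (phiBasis 𝕜 n).repr (W N) α := by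
    rw [map_sub, lp.coeFn_sub, Pi.sub_apply, sub_add_cancel]
  rw [e]
  have := mul_le_mul_of_nonneg_left (norm_add_sq_le_two_mul ((phiBasis 𝕜 n).repr (u - W N) α)
    ((phiBasis 𝕜 n).repr (W N) α)) (hpos α)
  linarith

lemma norm_le_of_sum_repr_le {V : L2 𝕜 n} {δ : ℝ} (hδ : 0 ≤ δ)
    (h : ∀ F : Finset (Fin n → ℕ), ∑ α ∈ F, ‖(phiBasis 𝕜 n).repr V α‖ ^ 2 ≤ δ ^ 2) : ‖V‖ ≤ δ :=
  le_of_sq_le_sq (hasSum_le_of_sum_le (hasSum_norm_sq_repr (phiBasis 𝕜 n) V) h) hδ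

lemma IsC2b.h1Norm_le {v : E n → 𝕜} (hv : IsC2b v) {V : L2 𝕜 n} (hV : V =ᵐ[volG n] v) {δ : ℝ}
    (hδ : 0 ≤ δ)
    (h1 : ∀ F : Finset (Fin n → ℕ), ∑ α ∈ F, ‖(phiBasis 𝕜 n).repr V α‖ ^ 2 ≤ δ ^ 2)
    (h2 : ∀ F : Finset (Fin n → ℕ), ∑ α ∈ F, eigval α * ‖(phiBasis 𝕜 n).repr V α‖ ^ 2 ≤ δ ^ 2) :
    h1Norm v ≤ ENNReal.ofReal δ + ENNReal.ofReal δ := by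
  rw [h1Norm_eq]
  refine add_le_add ?_ ?_
  · rw [← eLpNorm_congr_ae hV, ← ENNReal.ofReal_toReal (Lp.eLpNorm_ne_top V), ← Lp.norm_def]
    exact ENNReal.ofReal_le_ofReal (norm_le_of_sum_repr_le hδ h1)
  · rw [← ofReal_integral_eq_lintegral_ofReal hv.integrable_gradNormSq (gradNormSq_ae_nonneg v),
      ENNReal.ofReal_rpow_of_nonneg (integral_nonneg_of_ae (gradNormSq_ae_nonneg v)) (by norm_num),
      ← Real.sqrt_eq_rpow]
    exact ENNReal.ofReal_le_ofReal
      (Real.sqrt_le_iff.2 ⟨hδ, hasSum_le_of_sum_le (hv.hasSum_eigval_mul hV) h2⟩)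

lemma isC2b_sum {ι : Type*} (F : Finset ι) {f : ι → E n → 𝕜} (hf : ∀ i, IsC2b (f i)) :
    IsC2b fun x => ∑ i ∈ F, f i x := by
  classical
  induction F using Finset.induction_on with
  | empty => simpa using isC2b_zero
  | insert i F hi ih => simpa [Finset.sum_insert hi] using (hf i).add ih

/-- The partial Fourier sum over a finite set of multi-indices. -/
def partialSum (u : L2 𝕜 n) (F : Finset (Fin n → ℕ)) : L2 𝕜 n :=
  ∑ α ∈ F, (phiBasis 𝕜 n).repr u α • phiBasis 𝕜 n α

/-- The partial Fourier sum over a finite set of multi-indices as a polynomial function. -/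
def partialSumFun (u : L2 𝕜 n) (F : Finset (Fin n → ℕ)) (x : E n) : 𝕜 :=
  ∑ α ∈ F, (phiBasis 𝕜 n).repr u α * polyFun 𝕜 (phiPoly α) x

lemma coeFn_partialSum (u : L2 𝕜 n) (F : Finset (Fin n → ℕ)) :
    partialSum u F =ᵐ[volG n] partialSumFun u F := by
  classical
  unfold partialSum partialSumFun
  induction F using Finset.induction_on with
  | empty => simp only [Finset.sum_empty]; exact Lp.coeFn_zero 𝕜 2 (volG n)
  | insert i F hi ih =>
    simp only [Finset.sum_insert hi]
    filter_upwards [ih, Lp.coeFn_add ((phiBasis 𝕜 n).repr u i • phiBasis 𝕜 n i)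
      (∑ α ∈ F, (phiBasis 𝕜 n).repr u α • phiBasis 𝕜 n α),
      Lp.coeFn_smul ((phiBasis 𝕜 n).repr u i) (phiBasis 𝕜 n i),
      coeFn_polyL2 (𝕜 := 𝕜) (phiPoly i)] with x h1 h2 h3 h4
    rw [h2, Pi.add_apply, h1, h3, Pi.smul_apply, phiBasis_apply, h4, smul_eq_mul]

lemma isC2b_partialSumFun (u : L2 𝕜 n) (F : Finset (Fin n → ℕ)) : IsC2b (partialSumFun u F) :=
  isC2b_sum F fun α => (isC2b_polyFun (phiPoly α)).mul _

lemma contDiff_partialSumFun (u : L2 𝕜 n) (F : Finset (Fin n → ℕ)) :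
    ContDiff ℝ ∞ (partialSumFun u F) :=
  ContDiff.sum fun α _ => contDiff_const.mul (contDiff_polyFun (phiPoly α))

lemma repr_partialSum [DecidableEq (Fin n → ℕ)] (u : L2 𝕜 n) (F : Finset (Fin n → ℕ))
    (α : Fin n → ℕ) : (phiBasis 𝕜 n).repr (partialSum u F) α =
      if α ∈ F then (phiBasis 𝕜 n).repr u α else 0 := by
  rw [HilbertBasis.repr_apply_apply, partialSum]
  split_ifs with h
  · exact (phiBasis 𝕜 n).orthonormal.inner_right_sum _ h
  · rw [inner_sum]
    refine Finset.sum_eq_zero fun β hβ => ?_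
    rw [inner_smul_right, (phiBasis 𝕜 n).orthonormal.2 fun e : α = β => h (e ▸ hβ), mul_zero]

/-- Partial Fourier sums are polynomials, hence admissible, and Parseval for the norm and for the
energy reduces their convergence to tails of a numerical series. -/
lemma memH1_of_summable (hn : 1 ≤ n) {u : L2 𝕜 n}
    (hu : Summable fun α => eigval α * ‖(phiBasis 𝕜 n).repr u α‖ ^ 2) : MemH1 u := by
  classical
  -- The weight λ + 1 dominates both 1 and λ, so a single choice of finite sets `F k` controls the
  -- L² norm and the energy together.
  set f : (Fin n → ℕ) → ℝ := fun α => (eigval α + 1) * ‖(phiBasis 𝕜 n).repr u α‖ ^ 2 with hf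
  have hpos : ∀ α : Fin n → ℕ, 0 ≤ eigval α := fun α => lam_nonneg hn _
  have hfs : Summable f :=
    (hu.add (hasSum_norm_sq_repr (phiBasis 𝕜 n) u).summable).congr fun α => by rw [hf]; ring
  have hf0 : ∀ α, 0 ≤ f α := fun α => mul_nonneg (add_nonneg (hpos α) zero_le_one) (sq_nonneg _)
  set δ : ℕ → ℝ := fun k => 1 / ((k : ℝ) + 1) with hδ
  have hδ0 : ∀ k, 0 < δ k := fun k => Nat.one_div_pos_of_nat
  have hδl : Tendsto δ atTop (𝓝 0) := tendsto_one_div_add_atTop_nhds_zero_nat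
  have hF : ∀ k, ∃ F : Finset (Fin n → ℕ), ∀ t, Disjoint t F → ∑ α ∈ t, f α ≤ δ k ^ 2 := by
    intro k
    obtain ⟨F, hF⟩ := summable_iff_vanishing_norm.1 hfs (δ k ^ 2) (pow_pos (hδ0 k) 2)
    exact ⟨F, fun t ht => (le_abs_self _).trans (hF t ht).le⟩
  choose F hF using hF
  have hcut : ∀ k (t : Finset (Fin n → ℕ)), ∑ α ∈ t, (if α ∈ F k then 0 else f α) ≤ δ k ^ 2 := by
    intro k t
    rw [Finset.sum_ite, Finset.sum_const_zero, zero_add]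
    refine hF k _ (Finset.disjoint_left.2 fun α hα => (Finset.mem_filter.1 hα).2)
  have h1f : ∀ α, ‖(phiBasis 𝕜 n).repr u α‖ ^ 2 ≤ f α := fun α =>
    le_mul_of_one_le_left (sq_nonneg _) (by linarith [hpos α])
  have h2f : ∀ α, eigval α * ‖(phiBasis 𝕜 n).repr u α‖ ^ 2 ≤ f α := fun α =>
    mul_le_mul_of_nonneg_right (by linarith) (sq_nonneg _)
  refine ⟨fun k => partialSumFun u (F k), fun k => ⟨(contDiff_partialSumFun u _).contDiffOn, ?_⟩,
    ?_, fun ε hε => ?_⟩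
  · have hc := isC2b_partialSumFun u (F k)
    rw [h1Norm_eq, ENNReal.add_lt_top]
    exact ⟨hc.memLp.2, ENNReal.rpow_lt_top_of_nonneg (by norm_num)
      ((hasFiniteIntegral_iff_ofReal (gradNormSq_ae_nonneg _)).1 hc.integrable_gradNormSq.2).ne⟩
  · have hl : Tendsto (fun k => partialSum u (F k)) atTop (𝓝 u) := by
      rw [tendsto_iff_norm_sub_tendsto_zero]
      refine squeeze_zero (fun _ => norm_nonneg _) (fun k => ?_) hδl
      refine norm_le_of_sum_repr_le (hδ0 k).le fun t => le_trans (Finset.sum_le_sum fun α _ => ?_)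
        (hcut k t)
      rw [map_sub, lp.coeFn_sub, Pi.sub_apply, repr_partialSum]
      split_ifs
      · simp
      · simpa using h1f α
    rw [Lp.tendsto_Lp_iff_tendsto_eLpNorm'] at hl
    refine hl.congr fun k => eLpNorm_congr_ae ?_
    filter_upwards [coeFn_partialSum u (F k)] with x hx
    rw [Pi.sub_apply, hx]
  · have hlim : Tendsto (fun p : ℕ × ℕ => ENNReal.ofReal (δ p.1 + δ p.2) +
        ENNReal.ofReal (δ p.1 + δ p.2)) (atTop ×ˢ atTop) (𝓝 0) := by
      have h1 : Tendsto (fun p : ℕ × ℕ => δ p.1) (atTop ×ˢ atTop) (𝓝 0) := hδl.comp tendsto_fst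
      have h2 : Tendsto (fun p : ℕ × ℕ => δ p.2) (atTop ×ˢ atTop) (𝓝 0) := hδl.comp tendsto_snd
      have h := ENNReal.tendsto_ofReal (h1.add h2)
      simpa using h.add h
    rw [prod_atTop_atTop_eq] at hlim
    obtain ⟨⟨N₁, N₂⟩, hN⟩ := eventually_atTop.1 (hlim.eventually_lt_const hε)
    refine ⟨max N₁ N₂, fun k hk l hl => lt_of_le_of_lt ?_
      (hN (k, l) ⟨(le_max_left _ _).trans hk, (le_max_right _ _).trans hl⟩)⟩
    have hsub : IsC2b fun x => partialSumFun u (F k) x - partialSumFun u (F l) x := by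
      simpa [sub_eq_add_neg] using
        (isC2b_partialSumFun u (F k)).add ((isC2b_partialSumFun u (F l)).mul (-1))
    have hV : (partialSum u (F k) - partialSum u (F l) : L2 𝕜 n) =ᵐ[volG n]
        fun x => partialSumFun u (F k) x - partialSumFun u (F l) x := by
      filter_upwards [Lp.coeFn_sub (partialSum u (F k)) (partialSum u (F l)),
        coeFn_partialSum u (F k), coeFn_partialSum u (F l)] with x e1 e2 e3
      rw [e1, Pi.sub_apply, e2, e3]
    have hkl : ∀ (r : (Fin n → ℕ) → ℝ), (∀ α, 0 ≤ r α) →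
        (∀ α, r α * ‖(phiBasis 𝕜 n).repr u α‖ ^ 2 ≤ f α) → ∀ t : Finset (Fin n → ℕ),
        ∑ α ∈ t, r α * ‖(phiBasis 𝕜 n).repr (partialSum u (F k) - partialSum u (F l)) α‖ ^ 2 ≤
          (δ k + δ l) ^ 2 := by
      intro r hr hrf t
      -- A coefficient of the difference survives only outside one of the two finite sets, so its
      -- sum is at most two tails: δ_k² + δ_l² ≤ (δ_k + δ_l)².
      have h1 : ∀ α ∈ t,
          r α * ‖(phiBasis 𝕜 n).repr (partialSum u (F k) - partialSum u (F l)) α‖ ^ 2 ≤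
          (if α ∈ F k then 0 else f α) + if α ∈ F l then 0 else f α := by
        intro α _
        rw [map_sub, lp.coeFn_sub, Pi.sub_apply, repr_partialSum, repr_partialSum]
        have := hrf α
        have := hf0 α
        split_ifs <;> simp <;> linarith
      have h2 := Finset.sum_le_sum h1
      rw [Finset.sum_add_distrib] at h2
      nlinarith [hcut k t, hcut l t, hδ0 k, hδ0 l, mul_pos (hδ0 k) (hδ0 l)]
    exact hsub.h1Norm_le hV (add_nonneg (hδ0 k).le (hδ0 l).le)
      (fun t => by simpa using hkl (fun _ => 1) (fun _ => zero_le_one) (by simpa using h1f) t)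
      (hkl eigval hpos h2f)

/-- The Sobolev space is characterized by the Fourier coefficients. -/
lemma memH1_iff (hn : 1 ≤ n) (u : L2 𝕜 n) :
    MemH1 u ↔ Summable fun α => eigval α * ‖(phiBasis 𝕜 n).repr u α‖ ^ 2 :=
  ⟨fun h => h.summable hn, memH1_of_summable hn⟩

end Sobolev

/-! ### Transfer to the eigenvalues λ_s and the polynomials φ_α -/

section Conclusion

variable {𝕜 : Type*} [RCLike 𝕜] {n : ℕ}

lemma image_phiBasis_multiIndices (s : ℕ) :
    phiBasis 𝕜 n '' (multiIndices n s : Set (Fin n → ℕ)) = {f : L2 𝕜 n |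
      ∃ α ∈ multiIndices n s, f =ᵐ[volG n] fun x => (phi α x : 𝕜)} := by
  ext f
  constructor
  · rintro ⟨α, hα, rfl⟩
    exact ⟨α, hα, coeFn_phiBasis α⟩
  · rintro ⟨α, hα, h⟩
    exact ⟨α, hα, Lp.ext ((coeFn_phiBasis α).trans h.symm)⟩

lemma eigenspace_eq_span_phi (hn : 1 ≤ n) {A : L2 𝕜 n →ₗ.[𝕜] L2 𝕜 n}
    (hA : A.graph ≤ diagGraph (phiBasis 𝕜 n) eigval)
    (hb : ∀ α, (phiBasis 𝕜 n α, (eigval α : 𝕜) • phiBasis 𝕜 n α) ∈ A.graph) (s : ℕ) :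
    eigenspace A (lam n s : 𝕜) = Submodule.span 𝕜 {f : L2 𝕜 n |
      ∃ α ∈ multiIndices n s, f =ᵐ[volG n] fun x => (phi α x : 𝕜)} := by
  rw [eigenspace_eq_span hA hb (eigval_eq_lam_iff hn), image_phiBasis_multiIndices]

lemma isDiscreteSpectrum_of_eigval (hn : 1 ≤ n) {A : L2 𝕜 n →ₗ.[𝕜] L2 𝕜 n}
    (hA : A.graph ≤ diagGraph (phiBasis 𝕜 n) eigval)
    (hb : ∀ α, (phiBasis 𝕜 n α, (eigval α : 𝕜) • phiBasis 𝕜 n α) ∈ A.graph) :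
    IsDiscreteSpectrum A {z : 𝕜 | ∃ s : ℕ, z = (lam n s : 𝕜)} := by
  rw [← setOf_eigval 𝕜 hn]
  exact isDiscreteSpectrum_of_diag hA hb (finite_eigval_eq hn) fun _ _ => lam_eq_of_abs_sub_lt hn

lemma not_bounded_negLaplace (hn : 1 ≤ n) : ¬ ∃ C : ℝ, ∀ f : (negLaplace 𝕜 n).domain,
    ‖negLaplace 𝕜 n f‖ ≤ C * ‖(f : L2 𝕜 n)‖ := by
  rintro ⟨C, hC⟩
  obtain ⟨s, hs⟩ := exists_nat_gt C
  obtain ⟨α, hα⟩ := exists_sum_eq hn s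
  obtain ⟨f, hf1, hf2⟩ := (LinearPMap.mem_graph_iff _).1 (phiBasis_mem_graph (𝕜 := 𝕜) α)
  have h := hC f
  rw [hf2, hf1, norm_smul, (phiBasis 𝕜 n).orthonormal.1 α, mul_one, mul_one, RCLike.norm_ofReal,
    eigval, hα] at h
  linarith [le_abs_self (lam n s), le_lam hn s]

/-- A natural number is at most its square; this is why the domain of the closure is contained in
H¹. -/
lemma eigval_le_sq (hn : 1 ≤ n) (α : Fin n → ℕ) : eigval α ≤ eigval α ^ 2 := by
  rw [eigval, lam_eq_natCast hn]
  exact_mod_cast Nat.le_self_pow two_ne_zero _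

end Conclusion

end BaranBall

end

open BaranBall in
theorem theorem1p1 (𝕜 : Type*) [RCLike 𝕜] (n : ℕ) (hn : 1 ≤ n) :
    -- the Riemannian volume
    volG n = muBall n ∧
    -- the operator is well defined on all of its domain
    (∀ u : E n → 𝕜, IsC2b u → MemLp u 2 (volG n) ∧ MemLp (laplaceBeltrami u) 2 (volG n)) ∧
    (negLaplace 𝕜 n).graph = negLaplaceGraph 𝕜 n ∧
    -- it is densely defined, symmetric and unbounded
    Dense ((negLaplace 𝕜 n).domain : Set (L2 𝕜 n)) ∧
    (negLaplace 𝕜 n).IsFormalAdjoint (negLaplace 𝕜 n) ∧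
    (¬ ∃ C : ℝ, ∀ f : (negLaplace 𝕜 n).domain, ‖negLaplace 𝕜 n f‖ ≤ C * ‖(f : L2 𝕜 n)‖) ∧
    -- the `φ_α` are orthonormal polynomials of degree `|α|`
    (∀ α : Fin n → ℕ, ∃ p : MvPolynomial (Fin n) ℝ, p.totalDegree = ∑ i, α i ∧
      ∀ x ∈ ball n, phi α x = MvPolynomial.eval (fun i => x i) p) ∧
    (∀ α : Fin n → ℕ, MemLp (fun x => (phi α x : 𝕜)) 2 (muBall n)) ∧
    (∀ α β : Fin n → ℕ, ∫ x, phi α x * phi β x ∂muBall n = if α = β then 1 else 0) ∧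
    -- spectrum and eigenspaces
    opSpectrum (negLaplace 𝕜 n) = {z : 𝕜 | ∃ s : ℕ, z = (lam n s : 𝕜)} ∧
    IsDiscreteSpectrum (negLaplace 𝕜 n) (opSpectrum (negLaplace 𝕜 n)) ∧
    {z : 𝕜 | eigenspace (negLaplace 𝕜 n) z ≠ ⊥} = {z : 𝕜 | ∃ s : ℕ, z = (lam n s : 𝕜)} ∧
    (∀ s : ℕ, eigenspace (negLaplace 𝕜 n) (lam n s : 𝕜) =
      Submodule.span 𝕜 {f : L2 𝕜 n | ∃ α ∈ multiIndices n s,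
        f =ᵐ[volG n] fun x => (phi α x : 𝕜)}) ∧
    -- the closure
    (negLaplace 𝕜 n).IsClosable ∧
    IsSelfAdjoint (negLaplace 𝕜 n).closure ∧
    closedSpectrum (negLaplace 𝕜 n).closure = {z : 𝕜 | ∃ s : ℕ, z = (lam n s : 𝕜)} ∧
    IsDiscreteSpectrum (negLaplace 𝕜 n).closure (closedSpectrum (negLaplace 𝕜 n).closure) ∧
    (∀ s : ℕ, eigenspace (negLaplace 𝕜 n).closure (lam n s : 𝕜) =
      Submodule.span 𝕜 {f : L2 𝕜 n | ∃ α ∈ multiIndices n s,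
        f =ᵐ[volG n] fun x => (phi α x : 𝕜)}) ∧
    (∀ u : L2 𝕜 n, u ∈ (negLaplace 𝕜 n).closure.domain ↔
      Summable fun s : ℕ => lam n s ^ 2 * ∑ α ∈ multiIndices n s, ‖fourierCoeff α u‖ ^ 2) ∧
    (∀ u : L2 𝕜 n, u ∈ (negLaplace 𝕜 n).closure.domain → MemH1 u) ∧
    -- the square root of the closure
    (∃ S : L2 𝕜 n →ₗ.[𝕜] L2 𝕜 n, IsPosSqrt S (negLaplace 𝕜 n).closure ∧
      (∀ S' : L2 𝕜 n →ₗ.[𝕜] L2 𝕜 n, IsPosSqrt S' (negLaplace 𝕜 n).closure → S' = S) ∧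
      (∀ u : L2 𝕜 n, u ∈ S.domain ↔
        Summable fun s : ℕ => lam n s * ∑ α ∈ multiIndices n s, ‖fourierCoeff α u‖ ^ 2) ∧
      (∀ u : L2 𝕜 n, u ∈ S.domain ↔ MemH1 u)) := by
  have hA := graph_le_diagGraph (𝕜 := 𝕜) (n := n)
  have hb := phiBasis_mem_graph (𝕜 := 𝕜) (n := n)
  have hcl := closure_eq_diagOp hA hb
  have hA' : (diagOp (phiBasis 𝕜 n) eigval).graph ≤ diagGraph (phiBasis 𝕜 n) eigval :=
    (diagOp_graph _ _).le
  have hb' : ∀ α, (phiBasis 𝕜 n α, (eigval α : 𝕜) • phiBasis 𝕜 n α) ∈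
      (diagOp (phiBasis 𝕜 n) eigval).graph := fun α => by
    rw [diagOp_graph]; exact basis_mem_diagGraph _ _ α
  have hgap := exists_eigval_gap (𝕜 := 𝕜) hn
  have hpos : ∀ α : Fin n → ℕ, 0 ≤ eigval α := fun α => lam_nonneg hn _
  have hspec : opSpectrum (negLaplace 𝕜 n) = {z : 𝕜 | ∃ s : ℕ, z = (lam n s : 𝕜)} := by
    rw [opSpectrum_eq hA hb hgap, setOf_eigval 𝕜 hn]
  have hspec' : closedSpectrum (diagOp (phiBasis 𝕜 n) eigval) =
      {z : 𝕜 | ∃ s : ℕ, z = (lam n s : 𝕜)} := by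
    rw [closedSpectrum_diagOp hgap, setOf_eigval 𝕜 hn]
  have hsqrt : ∀ u : L2 𝕜 n, u ∈ (diagOp (phiBasis 𝕜 n) fun α => √(eigval α)).domain ↔
      Summable fun α => eigval α * ‖(phiBasis 𝕜 n).repr u α‖ ^ 2 := fun u => by
    rw [mem_diagOp_domain]
    simp only [Real.sq_sqrt (hpos _)]
  refine ⟨volG_eq_muBall, fun u hu => ⟨hu.memLp, hu.memLp_laplaceBeltrami⟩, negLaplace_graph,
    dense_domain_of_basis_mem hb, fun f g => ?_, not_bounded_negLaplace hn,
    fun α => ⟨phiPoly α, totalDegree_phiPoly α, fun x hx => phi_eq_eval α hx⟩, fun α => ?_,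
    integral_phi_mul, hspec, ?_, ?_, eigenspace_eq_span_phi hn hA hb, isClosable_of_le_diagGraph hA,
    ?_⟩
  · have h1 := (negLaplace 𝕜 n).mem_graph f
    have h2 := (negLaplace 𝕜 n).mem_graph g
    rw [negLaplace_graph] at h1 h2
    exact negLaplaceGraph_inner h1 h2
  · rw [← volG_eq_muBall]
    exact (memLp_congr_ae (coeFn_phiBasis α)).1 (Lp.memLp _)
  · rw [hspec]; exact isDiscreteSpectrum_of_eigval hn hA hb
  · rw [setOf_eigenspace_ne_bot hA hb, setOf_eigval 𝕜 hn]
  -- From here on the closure is the maximal diagonal operator, and every remaining claim concerns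
  -- Fourier coefficients.
  rw [hcl]
  refine ⟨isSelfAdjoint_diagOp, hspec', ?_, eigenspace_eq_span_phi hn hA' hb', fun u => ?_,
    fun u hu => ?_, _, isPosSqrt_diagOp hpos, fun S hS => hS.eq_diagOp hpos, fun u => ?_,
    fun u => ?_⟩
  · rw [hspec']; exact isDiscreteSpectrum_of_eigval hn hA' hb'
  · simp only [fourierCoeff_eq_repr]
    rw [mem_diagOp_domain]
    exact (summable_lam_iff (fun _ => sq_nonneg _) (· ^ 2) fun _ => sq_nonneg _).symm
  · rw [mem_diagOp_domain] at hu
    rw [memH1_iff hn]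
    exact hu.of_nonneg_of_le (fun α => mul_nonneg (hpos α) (sq_nonneg _))
      fun α => mul_le_mul_of_nonneg_right (eigval_le_sq hn α) (sq_nonneg _)
  · simp only [fourierCoeff_eq_repr]
    rw [hsqrt]
    exact (summable_lam_iff (fun _ => sq_nonneg _) id fun s => lam_nonneg hn s).symm
  · rw [hsqrt, memH1_iff hn]
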